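/- A function $S:[1,\infty)\to\mathbb R$ is called submultiplicative if it is piecewise linear (with locally finitely many breakpoints), continuous, strictly increasing and concave, $S(x)=x$ for $1\le x\le 2$, and $S(xy)\le S(x)S(y)$ for all $x,y\ge 1$. A weight is a non-increasing sequence $w=(w(m))_{m\ge1}$ of positive reals with $w(1)=1$, $w(m)\to0$ and $\sum_m w(m)=\infty$. For a weight $w$ and $1\le p<\infty$, the Lorentz sequence space $d(w,p)$ is the Banach space of real null sequences $a$ with $\|a\|_{w,p}=(\sum_m (a_m^*)^p w(m))^{1/p}<\infty$, where $(a_m^*)$ is the non-increasing rearrangement of $(|a_m|)$. For a real Banach space $X$, a normalized basic sequence $(x_i)\subseteq X$ generates the spreading model $(\tilde x_i)$ if for some $\varepsilon_n\downarrow0$ $$(1+\varepsilon_n)^{-1}\Big\|\sum_{i=1}^n a_i\tilde x_i\Big\|\le\Big\|\sum_{i=1}^n a_i x_{k_i}\Big\|\le(1+\varepsilon_n)\Big\|\sum_{i=1}^n a_i\tilde x_i\Big\|$$ for all $n$, all $(a_i)_1^n\subseteq[-1,1]$ and all $n\le k_1<\dots<k_n$. $SP_w(X)$ is the set of equivalence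 classes of the spreading models generated by normalized weakly null basic sequences in $X$. It is partially ordered by $[(\tilde x_i)]\le[(\tilde y_i)]$ if and only if there is $C<\infty$ with $\|\sum a_i\tilde x_i\|\le C\|\sum a_i\tilde y_i\|$ for all finitely supported real $(a_i)$; two spreading models are equivalent if each dominates the other in this sense. Theorem. (i) There is a sequence $(S_i)_{i\ge1}$ of submultiplicative functions on $[1,\infty)$ such that $$\sup_{m\ge1}\frac{S_j(m)}{\max_{i\in A}S_i(m)}=\infty\quad\text{for every nonempty finite }A\subset\mathbb N\text{ and every }j\in\mathbb N\setminus A.\qquad(*)$$ (ii) Let $(S_i)_{i\ge1}$ be any sequence of submultiplicative functions satisfying $(*)$, and put $w_i(m)=S_i(m)-S_i(m-1)$ for $m\ge1$ (with $S_i(0)=0$); these are weights. Let $1<p<\infty$ and $n\ge1$, and let $X_n(p)=(\sum_{i=1}^n\oplus\, d(w_i,p))_\infty$ be the direct sum with the maximum norm. Then $SP_w(X_n(p))$ is order-isomorphic to $(P(n)\cup\{\{1,\dots,n+1\}\})\setminus\{\emptyset\}$ ordered by inclusion, where $P(n)$ is the power set of $\{1,\dots,n\}$. The order-isomorphism can be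 chosen so that the class of a spreading model corresponds to the top element $\{1,\dots,n+1\}$ if and only if that spreading model is equivalent to the unit vector basis of $\ell_p$. -/

import Mathlib

open Set Filter Topology

noncomputable section

namespace SpreadingModels

/-! ### Spreading models generated by normalized weakly null sequences -/

/-- A sequence in a normed space is *basic* if it is a Schauder basis of its closed linear span. -/
def IsBasicSequence {X : Type*} [NormedAddCommGroup X] [NormedSpace ℝ X] (x : ℕ → X) : Prop :=
  ∃ b : SchauderBasis ℝ ↥(Submodule.span ℝ (Set.range x)).topologicalClosure,
    ∀ i, ((b.basis i : ↥(Submodule.span ℝ (Set.range x)).topologicalClosure) : X) = x i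

/-- A sequence is *weakly null* if every continuous linear functional sends it to a null sequence. -/
def IsWeaklyNull {X : Type*} [NormedAddCommGroup X] [NormedSpace ℝ X] (x : ℕ → X) : Prop :=
  ∀ f : StrongDual ℝ X, Tendsto (fun i => f (x i)) atTop (𝓝 0)

/-- `Generates x N`: the sequence `x` generates a spreading model `(x̃_i)` with
`N a = ‖∑ a_i x̃_i‖` for every `a ∈ c₀₀`. A sequence `(x̃_i)` in a normed space is
determined, up to a linear isometry of the spans, by this seminorm on `c₀₀`, and every seminorm on
`c₀₀` arises in this way. Sequences are indexed from `0` here, so the index `k` of the code is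
the index `k + 1` of the usual convention `n ≤ k₁ < ⋯ < kₙ`. -/
def Generates {X : Type*} [NormedAddCommGroup X] [NormedSpace ℝ X]
    (x : ℕ → X) (N : Seminorm ℝ (ℕ →₀ ℝ)) : Prop :=
  ∃ ε : ℕ → ℝ, Antitone ε ∧ Tendsto ε atTop (𝓝 0) ∧
    ∀ (n : ℕ) (a : Fin n → ℝ), (∀ j, |a j| ≤ 1) →
      ∀ k : Fin n → ℕ, StrictMono k → (∀ j, n ≤ k j + 1) →
        (1 + ε n)⁻¹ * N (∑ j : Fin n, Finsupp.single (j : ℕ) (a j)) ≤ ‖∑ j, a j • x (k j)‖ ∧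
        ‖∑ j, a j • x (k j)‖ ≤ (1 + ε n) * N (∑ j : Fin n, Finsupp.single (j : ℕ) (a j))

/-- A spreading model of the Banach space `X` generated by a normalized weakly null basic sequence,
recorded through the norm it induces on `c₀₀`. -/
structure WeaklyNullSpreadingModel (X : Type*) [NormedAddCommGroup X] [NormedSpace ℝ X]
    [CompleteSpace X] where
  /-- The norm `a ↦ ‖∑ a_i x̃_i‖` on `c₀₀`. -/
  norm : Seminorm ℝ (ℕ →₀ ℝ)
  /-- The sequence generating the spreading model. -/
  generated : ∃ x : ℕ → X, (∀ i, ‖x i‖ = 1) ∧ IsBasicSequence x ∧ IsWeaklyNull x ∧ Generates x norm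

/-- `DominatedBy f g`: the function `f` on `c₀₀` is dominated by `C * g` for some constant `C`. -/
def DominatedBy (f g : (ℕ →₀ ℝ) → ℝ) : Prop :=
  ∃ C : ℝ, ∀ a, f a ≤ C * g a

/-- Spreading models are preordered by domination. -/
instance {X : Type*} [NormedAddCommGroup X] [NormedSpace ℝ X] [CompleteSpace X] :
    Preorder (WeaklyNullSpreadingModel X) where
  le M N := DominatedBy M.norm N.norm
  le_refl M := ⟨1, fun a => by simp⟩
  le_trans := by
    rintro M N P ⟨C, hC⟩ ⟨D, hD⟩
    refine ⟨|C| * D, fun a => (hC a).trans ?_⟩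
    have h1 : C * N.norm a ≤ |C| * N.norm a :=
      mul_le_mul_of_nonneg_right (le_abs_self C) (apply_nonneg _ _)
    have h2 : |C| * N.norm a ≤ |C| * (D * P.norm a) :=
      mul_le_mul_of_nonneg_left (hD a) (abs_nonneg C)
    rw [mul_assoc]
    exact h1.trans h2

/-- The partially ordered set `SP_w(X)`: equivalence classes (for mutual domination) of spreading
models generated by normalized weakly null sequences of `X`, ordered by domination. -/
abbrev SPw (X : Type*) [NormedAddCommGroup X] [NormedSpace ℝ X] [CompleteSpace X] : Type :=
  Antisymmetrization (WeaklyNullSpreadingModel X) (· ≤ ·)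

/-- The `ℓ_p` norm on `c₀₀`. -/
def lpNorm (p : ℝ) (a : ℕ →₀ ℝ) : ℝ := (∑ i ∈ a.support, |a i| ^ p) ^ (1 / p)

/-- The spreading model `M` is equivalent to the unit vector basis of `ℓ_p`. -/
def EquivalentToLp {X : Type*} [NormedAddCommGroup X] [NormedSpace ℝ X] [CompleteSpace X]
    (M : WeaklyNullSpreadingModel X) (p : ℝ) : Prop :=
  DominatedBy M.norm (lpNorm p) ∧ DominatedBy (lpNorm p) M.norm

/-! ### Lorentz sequence spaces -/

/-- A weight: a non-increasing sequence of positive reals with first term `1`, tending to `0`,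
with divergent sum. Indexed from `0`. -/
structure LorentzWeight where
  toFun : ℕ → ℝ
  antitone : Antitone toFun
  pos : ∀ n, 0 < toFun n
  zero_eq_one : toFun 0 = 1
  tendsto_zero : Tendsto toFun atTop (𝓝 0)
  not_summable : ¬ Summable toFun

/-- The non-increasing rearrangement of `(|a n|)`, indexed from `0`. -/
def decRearr (a : ℕ → ℝ) (n : ℕ) : ℝ :=
  sInf {t : ℝ | 0 ≤ t ∧ {i | t < |a i|}.encard ≤ n}

theorem decRearr_nonneg (a : ℕ → ℝ) (n : ℕ) : 0 ≤ decRearr a n :=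
  Real.sInf_nonneg fun _ ht => ht.1

theorem le_decRearr {a : ℕ → ℝ} (ha : Tendsto a atTop (𝓝 0)) {n : ℕ} {F : Finset ℕ}
    (hF : n < F.card) {r : ℝ} (hr : ∀ i ∈ F, r ≤ |a i|) : r ≤ decRearr a n := by
  have hb : ∃ B, ∀ i, |a i| ≤ B := by
    obtain ⟨B, hB⟩ := (Metric.isBounded_range_of_tendsto a ha).exists_norm_le
    exact ⟨B, fun i => hB _ ⟨i, rfl⟩⟩
  obtain ⟨B, hB⟩ := hb
  refine le_csInf ⟨B, (abs_nonneg _).trans (hB 0), ?_⟩ ?_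
  · have : {i | B < |a i|} = ∅ := by
      ext i; simpa using hB i
    rw [this]; simp
  · rintro t ⟨-, ht⟩
    by_contra hlt
    push Not at hlt
    have hsub : (F : Set ℕ) ⊆ {i | t < |a i|} := fun i hi => hlt.trans_le (hr i hi)
    have h := (Set.encard_le_encard hsub).trans ht
    rw [Set.encard_coe_eq_coe_finsetCard] at h
    exact absurd (Nat.cast_le.mp h) (not_le.mpr hF)

theorem decRearr_le {a : ℕ → ℝ} {n : ℕ} {F : Finset ℕ} (hF : F.card ≤ n) {r : ℝ} (hr0 : 0 ≤ r)
    (hr : ∀ i, i ∉ F → |a i| ≤ r) : decRearr a n ≤ r := by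
  refine csInf_le ⟨0, fun t ht => ht.1⟩ ⟨hr0, ?_⟩
  have hsub : {i | r < |a i|} ⊆ (F : Set ℕ) := by
    intro i hi
    by_contra hiF
    exact absurd (hr i hiF) (not_le.mpr hi)
  refine (Set.encard_le_encard hsub).trans ?_
  rw [Set.encard_coe_eq_coe_finsetCard]
  exact_mod_cast hF

/-- The first `N` terms of the rearrangement are attained. -/
theorem exists_decRearr {a : ℕ → ℝ} (ha : Tendsto a atTop (𝓝 0)) (N : ℕ) :
    ∃ σ : ℕ → ℕ, Set.InjOn σ (Finset.range N) ∧ (∀ n ∈ Finset.range N, |a (σ n)| = decRearr a n) ∧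
      ∀ i, i ∉ (Finset.range N).image σ → ∀ n ∈ Finset.range N, |a i| ≤ |a (σ n)| := by
  induction N with
  | zero => exact ⟨id, by simp, by simp, by simp⟩
  | succ N ih =>
    obtain ⟨σ, hinj, heq, hle⟩ := ih
    set F := (Finset.range N).image σ with hFdef
    have hcard : F.card = N := by
      rw [hFdef, Finset.card_image_of_injOn hinj, Finset.card_range]
    have hmax : ∃ i, i ∉ F ∧ ∀ j, j ∉ F → |a j| ≤ |a i| := by
      obtain ⟨i₀, hi₀⟩ := Infinite.exists_notMem_finset F
      by_cases h0 : ∀ j, j ∉ F → |a j| ≤ |a i₀|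
      · exact ⟨i₀, hi₀, h0⟩
      push Not at h0
      obtain ⟨j₀, hj₀, hlt⟩ := h0
      have hpos : 0 < |a j₀| := (abs_nonneg _).trans_lt hlt
      have hev : ∀ᶠ i in atTop, |a i| < |a j₀| := by
        have := ha.abs
        rw [abs_zero] at this
        exact this.eventually (gt_mem_nhds hpos)
      obtain ⟨K, hK⟩ := eventually_atTop.mp hev
      have hj₀K : j₀ < K := by
        by_contra h
        exact lt_irrefl _ (hK j₀ (not_lt.mp h))
      obtain ⟨i, hi, himax⟩ := Finset.exists_max_image ((Finset.range K).filter (· ∉ F))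
        (fun i => |a i|) ⟨j₀, by simp [hj₀K, hj₀]⟩
      refine ⟨i, (Finset.mem_filter.mp hi).2, fun j hj => ?_⟩
      by_cases hjK : j < K
      · exact himax j (by simp [hjK, hj])
      · exact (hK j (not_lt.mp hjK)).le.trans (himax j₀ (by simp [hj₀K, hj₀]))
    obtain ⟨i, hiF, himax⟩ := hmax
    have hval : |a i| = decRearr a N := by
      apply le_antisymm
      · refine le_decRearr ha (F := insert i F) ?_ ?_
        · rw [Finset.card_insert_of_notMem hiF, hcard]; exact Nat.lt_succ_self N
        · intro j hj
          rcases Finset.mem_insert.mp hj with rfl | hj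
          · exact le_rfl
          · obtain ⟨n, hn, rfl⟩ := Finset.mem_image.mp hj
            exact hle i hiF n hn
      · exact decRearr_le hcard.le (abs_nonneg _) himax
    have hup : ∀ n ∈ Finset.range N, Function.update σ N i n = σ n := fun n hn =>
      Function.update_of_ne (Finset.mem_range.mp hn).ne _ _
    have himg : (Finset.range (N + 1)).image (Function.update σ N i) = insert i F := by
      rw [Finset.range_add_one, Finset.image_insert, Function.update_self, hFdef]
      congr 1
      exact Finset.image_congr fun n hn => hup n hn
    refine ⟨Function.update σ N i, ?_, ?_, ?_⟩
    · rw [← Finset.card_image_iff, himg, Finset.card_insert_of_notMem hiF, hcard,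
        Finset.card_range]
    · intro n hn
      rcases Nat.lt_succ_iff_lt_or_eq.mp (Finset.mem_range.mp hn) with h | rfl
      · rw [hup n (Finset.mem_range.mpr h)]
        exact heq n (Finset.mem_range.mpr h)
      · rw [Function.update_self]; exact hval
    · intro j hj n hn
      rw [himg, Finset.mem_insert, not_or] at hj
      rcases Nat.lt_succ_iff_lt_or_eq.mp (Finset.mem_range.mp hn) with h | rfl
      · rw [hup n (Finset.mem_range.mpr h)]
        exact hle j hj.2 n (Finset.mem_range.mpr h)
      · rw [Function.update_self]; exact himax j hj.2

theorem sum_rpow_le_sum_decRearr {a : ℕ → ℝ} (ha : Tendsto a atTop (𝓝 0)) {p : ℝ} (hp : 0 ≤ p)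
    (m : ℕ) : ∀ F : Finset ℕ, F.card = m →
      ∑ i ∈ F, |a i| ^ p ≤ ∑ n ∈ Finset.range m, decRearr a n ^ p := by
  induction m with
  | zero =>
    intro F hF
    rw [Finset.card_eq_zero] at hF
    simp [hF]
  | succ m ih =>
    intro F hF
    obtain ⟨i, hi, himin⟩ := Finset.exists_min_image F (fun i => |a i|)
      (Finset.card_pos.mp (by omega))
    rw [← Finset.sum_erase_add _ _ hi, Finset.sum_range_succ]
    refine add_le_add (ih _ ?_) ?_
    · rw [Finset.card_erase_of_mem hi, hF]; rfl
    · exact Real.rpow_le_rpow (abs_nonneg _) (le_decRearr ha (by omega) himin) hp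

theorem sum_mul_weight_le (w : LorentzWeight) (f g : ℕ → ℝ) (N : ℕ)
    (h : ∀ m ≤ N, ∑ n ∈ Finset.range m, f n ≤ ∑ n ∈ Finset.range m, g n) :
    ∑ n ∈ Finset.range N, f n * w.toFun n ≤ ∑ n ∈ Finset.range N, g n * w.toFun n := by
  have key : ∀ m ≤ N, w.toFun m * (∑ n ∈ Finset.range m, (g n - f n)) ≤
      ∑ n ∈ Finset.range m, (g n - f n) * w.toFun n := by
    intro m
    induction m with
    | zero => intro _; simp
    | succ m ih =>
      intro hm
      have hm' := ih (by omega)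
      have hD : 0 ≤ ∑ n ∈ Finset.range (m + 1), (g n - f n) := by
        rw [Finset.sum_sub_distrib]
        exact sub_nonneg.mpr (h _ hm)
      rw [Finset.sum_range_succ (fun n => (g n - f n) * w.toFun n)]
      have h1 : w.toFun (m + 1) * ∑ n ∈ Finset.range (m + 1), (g n - f n) ≤
          w.toFun m * ∑ n ∈ Finset.range (m + 1), (g n - f n) :=
        mul_le_mul_of_nonneg_right (w.antitone (Nat.le_succ m)) hD
      rw [Finset.sum_range_succ, mul_add] at h1
      rw [Finset.sum_range_succ, mul_add]
      linarith [mul_comm (w.toFun m) (g m - f m)]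
  have hN := key N le_rfl
  have hD : 0 ≤ ∑ n ∈ Finset.range N, (g n - f n) := by
    rw [Finset.sum_sub_distrib]
    exact sub_nonneg.mpr (h _ le_rfl)
  have h0 := (mul_nonneg (w.pos N).le hD).trans hN
  simp only [sub_mul, Finset.sum_sub_distrib] at h0
  linarith

/-- Hardy–Littlewood: the rearrangement maximizes the weighted sums. -/
theorem sum_injOn_le_sum_decRearr (w : LorentzWeight) {a : ℕ → ℝ} (ha : Tendsto a atTop (𝓝 0))
    {p : ℝ} (hp : 0 ≤ p) (N : ℕ) (σ : ℕ → ℕ) (hσ : Set.InjOn σ (Finset.range N)) :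
    ∑ n ∈ Finset.range N, |a (σ n)| ^ p * w.toFun n ≤
      ∑ n ∈ Finset.range N, decRearr a n ^ p * w.toFun n := by
  refine sum_mul_weight_le w _ _ N fun m hm => ?_
  have hσm : Set.InjOn σ (Finset.range m) := hσ.mono (by
    intro x hx; simp only [Finset.coe_range, Set.mem_Iio] at hx ⊢; omega)
  have h := sum_rpow_le_sum_decRearr ha hp m ((Finset.range m).image σ) (by
    rw [Finset.card_image_of_injOn hσm, Finset.card_range])
  rwa [Finset.sum_image hσm] at h

/-- Membership in `d(w,p)`: null sequences `a` with `∑ (a*_n)^p w(n) < ∞`. -/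
def MemLorentz (w : LorentzWeight) (p : ℝ) (a : ℕ → ℝ) : Prop :=
  Tendsto a atTop (𝓝 0) ∧ Summable fun n => decRearr a n ^ p * w.toFun n

/-- The Lorentz norm `(∑ (a*_n)^p w(n))^(1/p)`. -/
def lorentzNorm (w : LorentzWeight) (p : ℝ) (a : ℕ → ℝ) : ℝ :=
  (∑' n, decRearr a n ^ p * w.toFun n) ^ (1 / p)

theorem lorentz_term_nonneg (w : LorentzWeight) (p : ℝ) (a : ℕ → ℝ) (n : ℕ) :
    0 ≤ decRearr a n ^ p * w.toFun n :=
  mul_nonneg (Real.rpow_nonneg (decRearr_nonneg a n) p) (w.pos n).le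

theorem lorentzNorm_nonneg (w : LorentzWeight) (p : ℝ) (a : ℕ → ℝ) : 0 ≤ lorentzNorm w p a :=
  Real.rpow_nonneg (tsum_nonneg (lorentz_term_nonneg w p a)) _

theorem lorentzNorm_rpow (w : LorentzWeight) {p : ℝ} (hp : 1 ≤ p) (a : ℕ → ℝ) :
    lorentzNorm w p a ^ p = ∑' n, decRearr a n ^ p * w.toFun n := by
  rw [lorentzNorm, one_div]
  exact Real.rpow_inv_rpow (tsum_nonneg (lorentz_term_nonneg w p a)) (by linarith)

/-- A bound for all injective weighted sums bounds the Lorentz norm. -/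
theorem memLorentz_of_bound (w : LorentzWeight) {p : ℝ} (hp : 1 ≤ p) {a : ℕ → ℝ}
    (ha : Tendsto a atTop (𝓝 0)) {R : ℝ} (hR : 0 ≤ R)
    (h : ∀ (N : ℕ) (σ : ℕ → ℕ), Set.InjOn σ (Finset.range N) →
      (∑ n ∈ Finset.range N, |a (σ n)| ^ p * w.toFun n) ^ (1 / p) ≤ R) :
    MemLorentz w p a ∧ lorentzNorm w p a ≤ R := by
  have hp0 : 0 < p := by linarith
  have hb : ∀ N, ∑ n ∈ Finset.range N, decRearr a n ^ p * w.toFun n ≤ R ^ p := by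
    intro N
    obtain ⟨σ, hσ, heq, -⟩ := exists_decRearr ha N
    have h1 := h N σ hσ
    have h2 : ∑ n ∈ Finset.range N, decRearr a n ^ p * w.toFun n =
        ∑ n ∈ Finset.range N, |a (σ n)| ^ p * w.toFun n :=
      Finset.sum_congr rfl fun n hn => by rw [heq n hn]
    rw [h2]
    have hnn : 0 ≤ ∑ n ∈ Finset.range N, |a (σ n)| ^ p * w.toFun n :=
      Finset.sum_nonneg fun n _ => mul_nonneg (Real.rpow_nonneg (abs_nonneg _) _) (w.pos n).le
    rw [one_div] at h1
    exact (Real.rpow_inv_le_iff_of_pos hnn hR hp0).mp h1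
  have hs := summable_of_sum_range_le (lorentz_term_nonneg w p a) hb
  refine ⟨⟨ha, hs⟩, ?_⟩
  rw [lorentzNorm, one_div]
  refine (Real.rpow_inv_le_iff_of_pos (tsum_nonneg (lorentz_term_nonneg w p a)) hR hp0).mpr ?_
  exact Real.tsum_le_of_sum_range_le (lorentz_term_nonneg w p a) hb

theorem sum_injOn_le_lorentzNorm (w : LorentzWeight) {p : ℝ} (hp : 1 ≤ p) {a : ℕ → ℝ}
    (ha : MemLorentz w p a) (N : ℕ) (σ : ℕ → ℕ) (hσ : Set.InjOn σ (Finset.range N)) :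
    (∑ n ∈ Finset.range N, |a (σ n)| ^ p * w.toFun n) ^ (1 / p) ≤ lorentzNorm w p a := by
  refine Real.rpow_le_rpow (Finset.sum_nonneg fun n _ =>
    mul_nonneg (Real.rpow_nonneg (abs_nonneg _) _) (w.pos n).le) ?_ (by positivity)
  exact (sum_injOn_le_sum_decRearr w ha.1 (by linarith) N σ hσ).trans
    (ha.2.sum_le_tsum _ fun n _ => lorentz_term_nonneg w p a n)

theorem abs_le_lorentzNorm (w : LorentzWeight) {p : ℝ} (hp : 1 ≤ p) {a : ℕ → ℝ}
    (ha : MemLorentz w p a) (i : ℕ) : |a i| ≤ lorentzNorm w p a := by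
  have h := sum_injOn_le_lorentzNorm w hp ha 1 (fun _ => i) (by simp)
  rw [Finset.sum_range_one, w.zero_eq_one, mul_one, one_div,
    Real.rpow_rpow_inv (abs_nonneg _) (by linarith)] at h
  exact h

theorem lorentz_add (w : LorentzWeight) {p : ℝ} (hp : 1 ≤ p) {a b : ℕ → ℝ}
    (ha : MemLorentz w p a) (hb : MemLorentz w p b) :
    MemLorentz w p (a + b) ∧ lorentzNorm w p (a + b) ≤ lorentzNorm w p a + lorentzNorm w p b := by
  have hp0 : p ≠ 0 := by linarith
  refine memLorentz_of_bound w hp (by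
      have h := ha.1.add hb.1
      rwa [add_zero] at h)
    (add_nonneg (lorentzNorm_nonneg w p a) (lorentzNorm_nonneg w p b)) fun N σ hσ => ?_
  have hterm : ∀ (c : ℝ) (n : ℕ), |c| ^ p * w.toFun n = |c * w.toFun n ^ (1 / p)| ^ p := by
    intro c n
    have hw := (w.pos n).le
    rw [abs_mul, abs_of_nonneg (Real.rpow_nonneg hw _), one_div,
      Real.mul_rpow (abs_nonneg _) (Real.rpow_nonneg hw _), Real.rpow_inv_rpow hw hp0]
  have hM := Real.Lp_add_le (Finset.range N) (fun n => a (σ n) * w.toFun n ^ (1 / p))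
    (fun n => b (σ n) * w.toFun n ^ (1 / p)) hp
  simp only [← add_mul, ← hterm] at hM
  exact hM.trans (add_le_add (sum_injOn_le_lorentzNorm w hp ha N σ hσ)
    (sum_injOn_le_lorentzNorm w hp hb N σ hσ))

theorem lorentz_smul (w : LorentzWeight) {p : ℝ} (hp : 1 ≤ p) (c : ℝ) {a : ℕ → ℝ}
    (ha : MemLorentz w p a) :
    MemLorentz w p (c • a) ∧ lorentzNorm w p (c • a) ≤ |c| * lorentzNorm w p a := by
  have hp0 : p ≠ 0 := by linarith
  refine memLorentz_of_bound w hp (by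
      have h := ha.1.const_mul c
      rwa [mul_zero] at h)
    (mul_nonneg (abs_nonneg c) (lorentzNorm_nonneg w p a)) fun N σ hσ => ?_
  have h1 : ∑ n ∈ Finset.range N, |(c • a) (σ n)| ^ p * w.toFun n =
      |c| ^ p * ∑ n ∈ Finset.range N, |a (σ n)| ^ p * w.toFun n := by
    rw [Finset.mul_sum]
    refine Finset.sum_congr rfl fun n _ => ?_
    rw [Pi.smul_apply, smul_eq_mul, abs_mul, Real.mul_rpow (abs_nonneg _) (abs_nonneg _), mul_assoc]
  rw [h1, Real.mul_rpow (Real.rpow_nonneg (abs_nonneg _) _) (Finset.sum_nonneg fun n _ =>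
    mul_nonneg (Real.rpow_nonneg (abs_nonneg _) _) (w.pos n).le)]
  refine mul_le_mul (le_of_eq ?_) (sum_injOn_le_lorentzNorm w hp ha N σ hσ)
    (Real.rpow_nonneg (Finset.sum_nonneg fun n _ =>
      mul_nonneg (Real.rpow_nonneg (abs_nonneg _) _) (w.pos n).le) _) (abs_nonneg c)
  rw [one_div, Real.rpow_rpow_inv (abs_nonneg _) hp0]

theorem lorentz_zero (w : LorentzWeight) {p : ℝ} (hp : 1 ≤ p) :
    MemLorentz w p 0 ∧ lorentzNorm w p 0 ≤ 0 := by
  have hp0 : p ≠ 0 := by linarith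
  refine memLorentz_of_bound w hp tendsto_const_nhds le_rfl fun N σ _ => ?_
  have hp1 : 1 / p ≠ 0 := one_div_ne_zero hp0
  simp only [abs_zero, Real.zero_rpow hp0, zero_mul, Finset.sum_const_zero,
    Real.zero_rpow hp1, le_refl]

/-- The vector space underlying `d(w,p)`. -/
def lorentzSubmodule (w : LorentzWeight) (p : ℝ) [hp : Fact (1 ≤ p)] : Submodule ℝ (ℕ → ℝ) where
  carrier := {a | MemLorentz w p a}
  zero_mem' := (lorentz_zero w hp.out).1
  add_mem' ha hb := (lorentz_add w hp.out ha hb).1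
  smul_mem' c _ ha := (lorentz_smul w hp.out c ha).1

/-- The Lorentz sequence space `d(w,p)`. -/
def LorentzSpace (w : LorentzWeight) (p : ℝ) [Fact (1 ≤ p)] : Type :=
  ↥(lorentzSubmodule w p)

instance (w : LorentzWeight) (p : ℝ) [Fact (1 ≤ p)] : AddCommGroup (LorentzSpace w p) :=
  inferInstanceAs (AddCommGroup ↥(lorentzSubmodule w p))

instance (w : LorentzWeight) (p : ℝ) [Fact (1 ≤ p)] : Module ℝ (LorentzSpace w p) :=
  inferInstanceAs (Module ℝ ↥(lorentzSubmodule w p))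

instance (w : LorentzWeight) (p : ℝ) [Fact (1 ≤ p)] : Norm (LorentzSpace w p) where
  norm a := lorentzNorm w p a.1

theorem lorentzSpace_core (w : LorentzWeight) (p : ℝ) [hp : Fact (1 ≤ p)] :
    NormedSpace.Core ℝ (LorentzSpace w p) where
  norm_nonneg a := lorentzNorm_nonneg w p a.1
  norm_smul c a := by
    have hle : ∀ (c : ℝ) (a : LorentzSpace w p), ‖c • a‖ ≤ ‖c‖ * ‖a‖ := fun c a =>
      (lorentz_smul w hp.out c a.2).2
    rcases eq_or_ne c 0 with rfl | hc
    · refine le_antisymm (hle 0 a) ?_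
      rw [norm_zero, zero_mul]
      exact lorentzNorm_nonneg w p _
    · refine le_antisymm (hle c a) ?_
      have h := hle c⁻¹ (c • a)
      rw [inv_smul_smul₀ hc, norm_inv] at h
      have hc' : 0 < ‖c‖ := norm_pos_iff.mpr hc
      calc ‖c‖ * ‖a‖ ≤ ‖c‖ * (‖c‖⁻¹ * ‖c • a‖) := mul_le_mul_of_nonneg_left h hc'.le
        _ = ‖c • a‖ := by rw [← mul_assoc, mul_inv_cancel₀ hc'.ne', one_mul]
  norm_triangle a b := (lorentz_add w hp.out a.2 b.2).2
  norm_eq_zero_iff a := by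
    constructor
    · intro h
      apply Subtype.ext
      funext i
      have hi := abs_le_lorentzNorm w hp.out a.2 i
      have h' : lorentzNorm w p a.1 = 0 := h
      rw [h'] at hi
      exact abs_nonpos_iff.mp hi
    · rintro rfl
      exact le_antisymm (lorentz_zero w hp.out).2 (lorentzNorm_nonneg w p _)

instance (w : LorentzWeight) (p : ℝ) [Fact (1 ≤ p)] : NormedAddCommGroup (LorentzSpace w p) :=
  NormedAddCommGroup.ofCore (lorentzSpace_core w p)

instance (w : LorentzWeight) (p : ℝ) [Fact (1 ≤ p)] : NormedSpace ℝ (LorentzSpace w p) :=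
  NormedSpace.ofCore (lorentzSpace_core w p)

/-- `d(w,p)` is a Banach space. -/
instance (w : LorentzWeight) (p : ℝ) [hp : Fact (1 ≤ p)] : CompleteSpace (LorentzSpace w p) := by
  have hp1 := hp.out
  refine Metric.complete_of_cauchySeq_tendsto fun u hu => ?_
  have hcoord : ∀ (x y : LorentzSpace w p) (i : ℕ), |x.1 i - y.1 i| ≤ ‖x - y‖ := fun x y i =>
    abs_le_lorentzNorm w hp1 (x - y).2 i
  have hlim : ∀ i, ∃ l, Tendsto (fun k => (u k).1 i) atTop (𝓝 l) := by
    intro i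
    refine cauchySeq_tendsto_of_complete ?_
    rw [Metric.cauchySeq_iff] at hu ⊢
    intro ε hε
    obtain ⟨K, hK⟩ := hu ε hε
    refine ⟨K, fun m hm n hn => ?_⟩
    have h := hK m hm n hn
    rw [dist_eq_norm] at h
    rw [Real.dist_eq]
    exact (hcoord _ _ i).trans_lt h
  choose a ha using hlim
  have hunif : ∀ ε > 0, ∃ K, ∀ m ≥ K, ∀ i, |a i - (u m).1 i| ≤ ε := by
    intro ε hε
    obtain ⟨K, hK⟩ := Metric.cauchySeq_iff.mp hu ε hε
    refine ⟨K, fun m hm i => ?_⟩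
    refine le_of_tendsto ((ha i).sub_const _).abs ?_
    filter_upwards [eventually_ge_atTop K] with n hn
    have h := hK n hn m hm
    rw [dist_eq_norm] at h
    exact (hcoord _ _ i).trans h.le
  have ha0 : Tendsto a atTop (𝓝 0) := by
    rw [Metric.tendsto_atTop]
    intro ε hε
    obtain ⟨K, hK⟩ := hunif (ε / 2) (by linarith)
    obtain ⟨I, hI⟩ := Metric.tendsto_atTop.mp (u K).2.1 (ε / 2) (by linarith)
    refine ⟨I, fun i hi => ?_⟩
    have h1 := hK K le_rfl i
    have h2 := hI i hi
    rw [Real.dist_eq, sub_zero] at h2 ⊢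
    calc |a i| = |(a i - (u K).1 i) + (u K).1 i| := by rw [sub_add_cancel]
      _ ≤ |a i - (u K).1 i| + |(u K).1 i| := abs_add_le _ _
      _ < ε := by linarith
  have hdiff : ∀ ε > 0, ∃ K, ∀ m ≥ K, MemLorentz w p (a - (u m).1) ∧
      lorentzNorm w p (a - (u m).1) ≤ ε := by
    intro ε hε
    obtain ⟨K, hK⟩ := Metric.cauchySeq_iff.mp hu ε hε
    refine ⟨K, fun m hm => ?_⟩
    refine memLorentz_of_bound w hp1 (by
      have h := ha0.sub (u m).2.1
      rwa [sub_zero] at h) hε.le fun N σ hσ => ?_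
    have htend : Tendsto (fun n => (∑ j ∈ Finset.range N,
        |((u n).1 - (u m).1) (σ j)| ^ p * w.toFun j) ^ (1 / p)) atTop
        (𝓝 ((∑ j ∈ Finset.range N, |(a - (u m).1) (σ j)| ^ p * w.toFun j) ^ (1 / p))) := by
      refine Tendsto.rpow_const ?_ (Or.inr (by positivity))
      refine tendsto_finsetSum _ fun j _ => ?_
      refine Tendsto.mul_const _ ?_
      refine Tendsto.rpow_const ?_ (Or.inr (by linarith))
      exact ((ha (σ j)).sub_const _).abs
    refine le_of_tendsto htend ?_
    filter_upwards [eventually_ge_atTop K] with n hn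
    have h := hK n hn m hm
    rw [dist_eq_norm] at h
    exact (sum_injOn_le_lorentzNorm w hp1 (u n - u m).2 N σ hσ).trans h.le
  have hmem : MemLorentz w p a := by
    obtain ⟨K, hK⟩ := hdiff 1 one_pos
    have h := (lorentz_add w hp1 (hK K le_rfl).1 (u K).2).1
    rwa [sub_add_cancel] at h
  let A : LorentzSpace w p := Subtype.mk (p := fun a => a ∈ lorentzSubmodule w p) a hmem
  refine ⟨A, Metric.tendsto_atTop.mpr ?_⟩
  intro ε hε
  obtain ⟨K, hK⟩ := hdiff (ε / 2) (by linarith)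
  refine ⟨K, fun m hm => ?_⟩
  rw [dist_comm, dist_eq_norm]
  exact (hK m hm).2.trans_lt (by linarith)

/-! ### Submultiplicative functions and their weights -/

/-- `S` is *submultiplicative* on `[1,∞)`; only the values of `S` on `[1,∞)` matter. -/
structure IsSubmultiplicative (S : ℝ → ℝ) : Prop where
  /-- `S` is piecewise linear, with locally finitely many breakpoints. -/
  piecewiseLinear : ∃ t : ℕ → ℝ, t 0 = 1 ∧ StrictMono t ∧ Tendsto t atTop atTop ∧
    ∀ k, ∃ c d : ℝ, ∀ x ∈ Set.Icc (t k) (t (k + 1)), S x = c * x + d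
  continuousOn : ContinuousOn S (Set.Ici 1)
  strictMonoOn : StrictMonoOn S (Set.Ici 1)
  concaveOn : ConcaveOn ℝ (Set.Ici 1) S
  eq_self : ∀ x ∈ Set.Icc (1 : ℝ) 2, S x = x
  mul_le : ∀ x y : ℝ, 1 ≤ x → 1 ≤ y → S (x * y) ≤ S x * S y

/-- A sequence of submultiplicative functions on `[1,∞)` such that for every nonempty finite set `A`
of indices and every `j ∉ A`, the quotients `S_j(m) / max_{i ∈ A} S_i(m)`, `m ≥ 1`, are
unbounded. -/
structure IsIncomparableFamily (S : ℕ → ℝ → ℝ) : Prop where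
  submultiplicative : ∀ i, IsSubmultiplicative (S i)
  unbounded : ∀ (A : Finset ℕ) (hA : A.Nonempty) (j : ℕ), j ∉ A →
    ¬ BddAbove {r : ℝ | ∃ m : ℕ, 1 ≤ m ∧ r = S j m / A.sup' hA fun i => S i m}

/-- The weight sequence `w(m) = S(m) - S(m-1)`, `m ≥ 1`, with `S(0)` read as `0`; the index `k` of
the code stands for `m = k + 1`. -/
def weightSeq (S : ℝ → ℝ) (k : ℕ) : ℝ :=
  if k = 0 then S 1 else S (k + 1) - S k

theorem sum_weightSeq (S : ℝ → ℝ) (m : ℕ) :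
    ∑ k ∈ Finset.range (m + 1), weightSeq S k = S (m + 1) := by
  induction m with
  | zero => simp [weightSeq]
  | succ m ih =>
    rw [Finset.sum_range_succ, ih, weightSeq, if_neg (Nat.succ_ne_zero m)]
    push_cast
    ring

theorem IsSubmultiplicative.weightSeq_pos {S : ℝ → ℝ} (hS : IsSubmultiplicative S) (k : ℕ) :
    0 < weightSeq S k := by
  rw [weightSeq]
  split_ifs with h
  · rw [hS.eq_self 1 (by norm_num)]; exact one_pos
  · have hk : (1 : ℝ) ≤ k := by exact_mod_cast Nat.one_le_iff_ne_zero.mpr h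
    exact sub_pos.mpr (hS.strictMonoOn hk (by simp) (by linarith))

theorem IsSubmultiplicative.weightSeq_antitone {S : ℝ → ℝ} (hS : IsSubmultiplicative S) :
    Antitone (weightSeq S) := by
  refine antitone_nat_of_succ_le fun k => ?_
  rcases Nat.eq_zero_or_pos k with rfl | hk
  · simp only [weightSeq, zero_add, one_ne_zero, if_false, if_true, Nat.cast_one]
    rw [hS.eq_self 1 (by norm_num), hS.eq_self (1 + 1) (by norm_num)]
    norm_num
  · have hk' : (1 : ℝ) ≤ k := by exact_mod_cast hk
    simp only [weightSeq, Nat.succ_ne_zero, hk.ne', if_false]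
    have hk2 : (k : ℝ) + 1 + 1 ∈ Set.Ici (1 : ℝ) := by simp only [Set.mem_Ici]; linarith
    have h := hS.concaveOn.2 (Set.mem_Ici.mpr hk') hk2
      (show (0 : ℝ) ≤ 1 / 2 by norm_num) (show (0 : ℝ) ≤ 1 / 2 by norm_num) (by norm_num)
    have hmid : (1 / 2 : ℝ) • (k : ℝ) + (1 / 2 : ℝ) • ((k : ℝ) + 1 + 1) = k + 1 := by
      simp only [smul_eq_mul]; ring
    rw [hmid] at h
    simp only [smul_eq_mul] at h
    push_cast
    linarith

theorem IsSubmultiplicative.weightSeq_zero {S : ℝ → ℝ} (hS : IsSubmultiplicative S) :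
    weightSeq S 0 = 1 := by
  rw [weightSeq, if_pos rfl, hS.eq_self 1 (by norm_num)]

theorem IsSubmultiplicative.one_le {S : ℝ → ℝ} (hS : IsSubmultiplicative S) {x : ℝ} (hx : 1 ≤ x) :
    1 ≤ S x := by
  have h := hS.strictMonoOn.monotoneOn (Set.mem_Ici.mpr le_rfl) hx hx
  rwa [hS.eq_self 1 (by norm_num)] at h

/-- The weight `w_i` whose fundamental function is `(S_i(m))_m`. -/
def IsIncomparableFamily.weight {S : ℕ → ℝ → ℝ} (hS : IsIncomparableFamily S) (i : ℕ) :
    LorentzWeight where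
  toFun := weightSeq (S i)
  antitone := (hS.submultiplicative i).weightSeq_antitone
  pos := (hS.submultiplicative i).weightSeq_pos
  zero_eq_one := (hS.submultiplicative i).weightSeq_zero
  tendsto_zero := by
    have hi := hS.submultiplicative i
    have hbdd : BddBelow (Set.range (weightSeq (S i))) :=
      ⟨0, by rintro _ ⟨k, rfl⟩; exact (hi.weightSeq_pos k).le⟩
    have hl := tendsto_atTop_ciInf hi.weightSeq_antitone hbdd
    set c := ⨅ k, weightSeq (S i) k with hc
    have hc0 : 0 ≤ c := le_ciInf fun k => (hi.weightSeq_pos k).le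
    rcases hc0.eq_or_lt with h | hpos
    · rwa [← h] at hl
    exfalso
    refine hS.unbounded {i} (Finset.singleton_nonempty i) (i + 1) (by simp) ⟨1 / c, ?_⟩
    rintro _ ⟨m, hm, rfl⟩
    obtain ⟨m, rfl⟩ := Nat.exists_eq_add_of_le' hm
    have hj := hS.submultiplicative (i + 1)
    have h1 : c * (m + 1) ≤ S i (m + 1) := by
      rw [← sum_weightSeq (S i)]
      calc c * (m + 1) = ∑ _k ∈ Finset.range (m + 1), c := by simp [mul_comm]
        _ ≤ _ := Finset.sum_le_sum fun k _ => ciInf_le hbdd k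
    have h2 : S (i + 1) (m + 1) ≤ m + 1 := by
      rw [← sum_weightSeq (S (i + 1))]
      calc _ ≤ ∑ _k ∈ Finset.range (m + 1), (1 : ℝ) := Finset.sum_le_sum fun k _ => by
            rw [← hj.weightSeq_zero]; exact hj.weightSeq_antitone (Nat.zero_le k)
        _ = m + 1 := by simp
    rw [Finset.sup'_singleton]
    push_cast
    have hm0 : (0 : ℝ) < m + 1 := by positivity
    rw [div_le_div_iff₀ (lt_of_lt_of_le (by positivity) h1) hpos]
    nlinarith
  not_summable := by
    intro hsum
    have hi := hS.submultiplicative i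
    refine hS.unbounded {i + 1} (Finset.singleton_nonempty _) i (by simp)
      ⟨∑' k, weightSeq (S i) k, ?_⟩
    rintro _ ⟨m, hm, rfl⟩
    obtain ⟨m, rfl⟩ := Nat.exists_eq_add_of_le' hm
    have h1 : S i (m + 1) ≤ ∑' k, weightSeq (S i) k := by
      rw [← sum_weightSeq (S i)]
      exact hsum.sum_le_tsum _ fun k _ => (hi.weightSeq_pos k).le
    have h2 : 1 ≤ S (i + 1) (m + 1) :=
      (hS.submultiplicative (i + 1)).one_le (by simp)
    have h3 : 1 ≤ S i (m + 1) := hi.one_le (by simp)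
    rw [Finset.sup'_singleton]
    push_cast
    rw [div_le_iff₀ (by linarith)]
    nlinarith

/-- The space `X_n(p)`, the `ℓ_∞`-direct sum of `d(w_1,p), …, d(w_n,p)`; the norm is the
maximum of the norms of the components. -/
abbrev XSpace {S : ℕ → ℝ → ℝ} (hS : IsIncomparableFamily S) (n : ℕ) (p : ℝ) [Fact (1 ≤ p)] : Type :=
  ∀ i : Fin n, LorentzSpace (hS.weight i) p

/-- The sets in `(P(n) ∪ {{1,…,n+1}}) ∖ {∅}`, ordered by inclusion. -/
abbrev Nodes (n : ℕ) : Type :=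
  ↥((𝒫 (Set.Icc 1 n) ∪ {Set.Icc 1 (n + 1)}) \ {∅} : Set (Set ℕ))

end SpreadingModels

end

noncomputable section

namespace SpreadingModels

/-! ### Rearrangements and the Lorentz norm -/

/-! Classification. Let a normalized weakly null sequence of X_n(p) generate a spreading model with
norm N. Coordinates tend to 0, so a gliding hump replaces the sequence by disjoint blocks up to
small errors. Disjoint vectors satisfy an upper p-estimate (`lorentzNorm_sum_rpow_le`), hence N is
at most the ℓ_p norm. Along a subsequence the decreasing rearrangements of every component converge
pointwise. Two cases arise.

If in some component the tails of the rearrangements are not uniformly small (`UniformTails` fails),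
the blocks can be chosen to carry a fixed weighted mass at rearrangement positions lying in disjoint
intervals. Placed side by side, they give a lower ℓ_p estimate, so N is equivalent to ℓ_p.

If all tails are uniformly small, a component whose largest coordinate tends to 0 vanishes in norm.
In any other component a large coordinate gives a lower d(w_i,p) estimate. The upper estimate holds
because a sum of blocks with almost the same rearrangement f behaves like the tensor product of the
coefficients with f, and S_i(jm) ≤ S_i(j)S_i(m) bounds the norm of a tensor product by the product
of the norms (`sum_tensor_le`, `lorentzNorm_tensor_le`). Thus N is equivalent to the maximum of the
d(w_i,p) norms over a nonempty set A; see `Generates.classification`.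

Realization. The vectors that equal e_k in each component of A and 0 elsewhere generate the maximum
over A (`exists_spreadingModel_sup`), and normalized flat blocks of rapidly growing length generate
ℓ_p (`exists_spreadingModel_lp`). Since p > 1, the upper p-estimate makes such sequences weakly
null.

Order. The indicator of m points has norm S_i(m)^(1/p) in d(w_i,p), so (*) separates the maxima over
different sets. It also separates ℓ_p from all of them, since ℓ_p dominates the Lorentz norm of one
further weight, absent from X_n(p) (`nodeSeminorm_dominatedBy_iff`).

Existence of the family. Interpolate S linearly between the points 2^k, with S(2^k) concave in k and
of small increments; then S(2^(j+k+2)) ≤ S(2^j) + S(2^k) ≤ S(2^j)S(2^k), which gives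
submultiplicativity (`IsDyadicProfile.mul_le`). The values S(2^k) come from an infimum of very
sparse tangent lines to 2√t. Each tangent carries a label, each label recurs infinitely often, and
the i-th function omits the tangents labelled i. Near the contact point of a tangent labelled j the
j-th function is far above all the others (`isIncomparableFamily_profile`). -/

theorem exists_finset_abs_le_decRearr {a : ℕ → ℝ} (ha : Tendsto a atTop (𝓝 0)) (n : ℕ) :
    ∃ F : Finset ℕ, F.card ≤ n ∧ ∀ i, i ∉ F → |a i| ≤ decRearr a n := by
  obtain ⟨σ, -, heq, hle⟩ := exists_decRearr ha (n + 1)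
  refine ⟨(Finset.range n).image σ, Finset.card_image_le.trans (by simp), fun i hi => ?_⟩
  rw [← heq n (by simp)]
  by_cases h : i = σ n
  · rw [h]
  · refine hle i ?_ n (by simp)
    rw [Finset.range_add_one, Finset.image_insert, Finset.mem_insert, not_or]
    exact ⟨h, hi⟩

theorem decRearr_antitone {a : ℕ → ℝ} (ha : Tendsto a atTop (𝓝 0)) : Antitone (decRearr a) := by
  intro m n hmn
  obtain ⟨F, hF, h⟩ := exists_finset_abs_le_decRearr ha m
  exact decRearr_le (hF.trans hmn) (decRearr_nonneg a m) h

theorem decRearr_mono {a b : ℕ → ℝ} (hb : Tendsto b atTop (𝓝 0)) (h : ∀ i, |a i| ≤ |b i|) (n : ℕ) :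
    decRearr a n ≤ decRearr b n := by
  obtain ⟨F, hF, hle⟩ := exists_finset_abs_le_decRearr hb n
  exact decRearr_le hF (decRearr_nonneg b n) fun i hi => (h i).trans (hle i hi)

theorem tendsto_zero_of_abs_le {a b : ℕ → ℝ} (hb : Tendsto b atTop (𝓝 0))
    (h : ∀ i, |a i| ≤ |b i|) : Tendsto a atTop (𝓝 0) := by
  refine squeeze_zero_norm (fun i => ?_) (by simpa using hb.abs)
  exact h i

theorem finsupp_tendsto_zero (a : ℕ →₀ ℝ) : Tendsto a atTop (𝓝 0) := by
  refine tendsto_const_nhds.congr' ?_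
  rw [← Nat.cofinite_eq_atTop]
  filter_upwards [a.support.finite_toSet.compl_mem_cofinite] with n hn
  simpa [eq_comm] using hn

/-- The fundamental function `m ↦ w(1) + ⋯ + w(m)` of a weight. -/
def LorentzWeight.partialSum (w : LorentzWeight) (m : ℕ) : ℝ := ∑ k ∈ Finset.range m, w.toFun k

theorem LorentzWeight.le_one (w : LorentzWeight) (n : ℕ) : w.toFun n ≤ 1 := by
  rw [← w.zero_eq_one]; exact w.antitone n.zero_le

theorem LorentzWeight.partialSum_mono (w : LorentzWeight) : Monotone w.partialSum := by
  intro m n h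
  exact Finset.sum_le_sum_of_subset_of_nonneg (Finset.range_subset_range.mpr h)
    fun i _ _ => (w.pos i).le

theorem LorentzWeight.partialSum_nonneg (w : LorentzWeight) (m : ℕ) : 0 ≤ w.partialSum m :=
  Finset.sum_nonneg fun i _ => (w.pos i).le

theorem LorentzWeight.partialSum_pos (w : LorentzWeight) {m : ℕ} (hm : 0 < m) :
    0 < w.partialSum m :=
  Finset.sum_pos (fun i _ => w.pos i) ⟨0, by simpa using hm⟩

theorem LorentzWeight.tendsto_partialSum (w : LorentzWeight) :
    Tendsto w.partialSum atTop atTop :=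
  (not_summable_iff_tendsto_nat_atTop_of_nonneg fun n => (w.pos n).le).mp w.not_summable

/-- The largest element of a set with s + 1 elements is at least s, and the weight is
non-increasing; removing maxima one at a time compares the set with an initial segment. -/
theorem LorentzWeight.sum_le_partialSum_card (w : LorentzWeight) (E : Finset ℕ) :
    ∑ n ∈ E, w.toFun n ≤ w.partialSum E.card := by
  rw [LorentzWeight.partialSum]
  induction E using Finset.induction_on_max with
  | empty => simp
  | insert m s hm ih =>
    have hms : m ∉ s := fun h => lt_irrefl _ (hm m h)
    have hc : s.card ≤ m := by
      have := Finset.card_le_card (show s ⊆ Finset.range m from fun x hx => by simpa using hm x hx)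
      simpa using this
    rw [Finset.sum_insert hms, Finset.card_insert_of_notMem hms, Finset.sum_range_succ, add_comm]
    exact add_le_add ih (w.antitone hc)

/-! ### Bounds for the Lorentz norm by injective placements, and the upper p-estimate -/

section

variable {w : LorentzWeight} {p : ℝ}

/-- Arbitrary finite sets of positions are allowed, not only initial segments; this freedom is what
later lets several blocks occupy disjoint ranges of weights. -/
theorem sum_positions_le (hp : 1 ≤ p) {a : ℕ → ℝ} (ha : MemLorentz w p a) (P : Finset ℕ)
    (σ : ℕ → ℕ) (hσ : Set.InjOn σ P) :
    ∑ n ∈ P, |a (σ n)| ^ p * w.toFun n ≤ lorentzNorm w p a ^ p := by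
  set N := P.sup id + 1
  set B := (P.image σ).sup id + 1
  have hN : ∀ n ∈ P, n < N := fun n hn => Nat.lt_succ_of_le (Finset.le_sup (f := id) hn)
  have hB : ∀ n ∈ P, σ n < B := fun n hn =>
    Nat.lt_succ_of_le (Finset.le_sup (f := id) (Finset.mem_image_of_mem σ hn))
  -- Positions outside `P` are filled with coordinates beyond the image of `σ`, which keeps the
  -- extended map injective; their terms are nonnegative and can be dropped.
  set σ' : ℕ → ℕ := fun n => if n ∈ P then σ n else B + n with hσ'
  have hinj : Set.InjOn σ' (Finset.range N) := by
    intro x _ y _ hxy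
    simp only [hσ'] at hxy
    split_ifs at hxy with h1 h2 h2
    · exact hσ h1 h2 hxy
    · have := hB x h1; omega
    · have := hB y h2; omega
    · omega
  have h1 := sum_injOn_le_sum_decRearr w ha.1 (by linarith) N σ' hinj
  rw [lorentzNorm_rpow w hp]
  refine le_trans ?_ (h1.trans (ha.2.sum_le_tsum _ fun n _ => lorentz_term_nonneg w p a n))
  calc ∑ n ∈ P, |a (σ n)| ^ p * w.toFun n = ∑ n ∈ P, |a (σ' n)| ^ p * w.toFun n :=
        Finset.sum_congr rfl fun n hn => by simp [hσ', hn]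
    _ ≤ _ := Finset.sum_le_sum_of_subset_of_nonneg (fun n hn => by simpa using hN n hn)
        fun n _ _ => mul_nonneg (Real.rpow_nonneg (abs_nonneg _) _) (w.pos n).le

theorem memLorentz_of_rpow_bound (hp : 1 ≤ p) {a : ℕ → ℝ} (ha : Tendsto a atTop (𝓝 0)) {R : ℝ}
    (hR : 0 ≤ R) (h : ∀ (N : ℕ) (σ : ℕ → ℕ), Set.InjOn σ (Finset.range N) →
      ∑ n ∈ Finset.range N, |a (σ n)| ^ p * w.toFun n ≤ R) :
    MemLorentz w p a ∧ lorentzNorm w p a ^ p ≤ R := by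
  have hp0 : 0 < p := by linarith
  obtain ⟨h1, h2⟩ := memLorentz_of_bound w hp ha (R := R ^ (1 / p)) (Real.rpow_nonneg hR _)
    fun N σ hσ => Real.rpow_le_rpow (Finset.sum_nonneg fun n _ =>
      mul_nonneg (Real.rpow_nonneg (abs_nonneg _) _) (w.pos n).le) (h N σ hσ) (by positivity)
  refine ⟨h1, ?_⟩
  have := Real.rpow_le_rpow (lorentzNorm_nonneg w p a) h2 hp0.le
  rwa [one_div, Real.rpow_inv_rpow hR hp0.ne'] at this

/-- A null sequence dominated by an injective relabelling of `b` has smaller Lorentz norm. -/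
theorem lorentzNorm_le_of_relabel (hp : 1 ≤ p) {a b : ℕ → ℝ} (hb : MemLorentz w p b)
    (ha : Tendsto a atTop (𝓝 0)) (θ : ℕ → ℕ) (hθ : Set.InjOn θ {n | a n ≠ 0})
    (h : ∀ n, a n ≠ 0 → |a n| ≤ |b (θ n)|) :
    MemLorentz w p a ∧ lorentzNorm w p a ≤ lorentzNorm w p b := by
  have hp0 : 0 < p := by linarith
  obtain ⟨h1, h2⟩ := memLorentz_of_rpow_bound (w := w) hp ha (R := lorentzNorm w p b ^ p)
    (Real.rpow_nonneg (lorentzNorm_nonneg w p b) _) fun N σ hσ => by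
      have hsub := sum_positions_le hp hb ((Finset.range N).filter fun n => a (σ n) ≠ 0)
        (fun n => θ (σ n)) (by
          intro x hx y hy hxy
          simp only [Finset.coe_filter, Set.mem_ofPred_eq] at hx hy
          exact hσ hx.1 hy.1 (hθ hx.2 hy.2 hxy))
      refine le_trans ?_ hsub
      rw [Finset.sum_filter]
      refine Finset.sum_le_sum fun n _ => ?_
      split_ifs with h0
      · exact mul_le_mul_of_nonneg_right
          (Real.rpow_le_rpow (abs_nonneg _) (h _ h0) hp0.le) (w.pos n).le
      · rw [ne_eq, not_not] at h0
        rw [h0, abs_zero, Real.zero_rpow hp0.ne', zero_mul]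
  exact ⟨h1, (Real.rpow_le_rpow_iff (lorentzNorm_nonneg w p a) (lorentzNorm_nonneg w p b) hp0).mp h2⟩

theorem lorentzNorm_le_of_abs_le (hp : 1 ≤ p) {a b : ℕ → ℝ} (hb : MemLorentz w p b)
    (h : ∀ n, |a n| ≤ |b n|) : MemLorentz w p a ∧ lorentzNorm w p a ≤ lorentzNorm w p b :=
  lorentzNorm_le_of_relabel hp hb (tendsto_zero_of_abs_le hb.1 h) id (Set.injOn_id _)
    fun n _ => h n

theorem abs_indicator_le (T : Set ℕ) (a : ℕ → ℝ) (n : ℕ) : |T.indicator a n| ≤ |a n| := by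
  by_cases h : n ∈ T <;> simp [h]

theorem abs_sum_rpow_of_disjoint {ι : Type*} (s : Finset ι) (v : ι → ℝ) (hp : 0 < p)
    (h : ∀ i ∈ s, ∀ j ∈ s, v i ≠ 0 → v j ≠ 0 → i = j) : |∑ i ∈ s, v i| ^ p = ∑ i ∈ s, |v i| ^ p := by
  by_cases h0 : ∀ i ∈ s, v i = 0
  · rw [Finset.sum_eq_zero h0, Finset.sum_eq_zero, abs_zero, Real.zero_rpow hp.ne']
    intro i hi
    rw [h0 i hi, abs_zero, Real.zero_rpow hp.ne']
  · push Not at h0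
    obtain ⟨i, hi, hvi⟩ := h0
    have hz : ∀ j ∈ s, j ≠ i → v j = 0 := fun j hj hji => by
      by_contra hvj
      exact hji (h j hj i hi hvj hvi)
    rw [Finset.sum_eq_single_of_mem i hi hz, Finset.sum_eq_single_of_mem i hi]
    intro j hj hji
    rw [hz j hj hji, abs_zero, Real.zero_rpow hp.ne']

theorem memLorentz_sum (hp : 1 ≤ p) {ι : Type*} (s : Finset ι) (u : ι → ℕ → ℝ)
    (hu : ∀ i ∈ s, MemLorentz w p (u i)) : MemLorentz w p (∑ i ∈ s, u i) := by
  have : Fact (1 ≤ p) := ⟨hp⟩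
  exact (lorentzSubmodule w p).sum_mem hu

/-- The upper `p`-estimate for disjointly supported sums. -/
theorem lorentzNorm_sum_rpow_le (hp : 1 ≤ p) {ι : Type*} (s : Finset ι) (u : ι → ℕ → ℝ)
    (hu : ∀ i ∈ s, MemLorentz w p (u i))
    (hd : ∀ n, ∀ i ∈ s, ∀ j ∈ s, u i n ≠ 0 → u j n ≠ 0 → i = j) :
    lorentzNorm w p (∑ i ∈ s, u i) ^ p ≤ ∑ i ∈ s, lorentzNorm w p (u i) ^ p := by
  refine (memLorentz_of_rpow_bound hp (memLorentz_sum hp s u hu).1 (Finset.sum_nonneg fun i _ =>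
    Real.rpow_nonneg (lorentzNorm_nonneg w p _) _) fun N σ hσ => ?_).2
  calc ∑ n ∈ Finset.range N, |(∑ i ∈ s, u i) (σ n)| ^ p * w.toFun n
      = ∑ n ∈ Finset.range N, ∑ i ∈ s, |u i (σ n)| ^ p * w.toFun n := by
        refine Finset.sum_congr rfl fun n _ => ?_
        rw [Finset.sum_apply, abs_sum_rpow_of_disjoint s _ (by linarith) (hd (σ n)), Finset.sum_mul]
    _ = ∑ i ∈ s, ∑ n ∈ Finset.range N, |u i (σ n)| ^ p * w.toFun n := Finset.sum_comm
    _ ≤ _ := Finset.sum_le_sum fun i hi => sum_positions_le hp (hu i hi) _ σ hσ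

/-- The rearrangement of a tail is dominated termwise by that of `a` and tends to 0 at every
position, so dominated convergence applies to the defining series. -/
theorem tendsto_lorentzNorm_tail (hp : 1 ≤ p) {a : ℕ → ℝ} (ha : MemLorentz w p a) :
    Tendsto (fun t : ℕ => lorentzNorm w p ((Set.Ici t).indicator a)) atTop (𝓝 0) := by
  have hp0 : 0 < p := by linarith
  have hpt : ∀ n, Tendsto (fun t : ℕ => decRearr ((Set.Ici t).indicator a) n) atTop (𝓝 0) := by
    intro n
    rw [Metric.tendsto_atTop]
    intro ε hε
    obtain ⟨T, hT⟩ := Metric.tendsto_atTop.mp ha.1 (ε / 2) (by linarith)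
    refine ⟨T, fun t ht => ?_⟩
    rw [Real.dist_eq, sub_zero, abs_of_nonneg (decRearr_nonneg _ _)]
    refine lt_of_le_of_lt (decRearr_le (F := ∅) (by simp) (half_pos hε).le fun i _ => ?_)
      (half_lt_self hε)
    by_cases hi : i ∈ Set.Ici t
    · rw [Set.indicator_of_mem hi]
      have := hT i (ht.le.trans hi)
      rw [Real.dist_eq, sub_zero] at this
      exact this.le
    · rw [Set.indicator_of_notMem hi, abs_zero]; linarith
  have h := tendsto_tsum_of_dominated_convergence (𝓕 := atTop)
    (f := fun (t : ℕ) n => decRearr ((Set.Ici t).indicator a) n ^ p * w.toFun n)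
    (g := fun _ => 0) (bound := fun n => decRearr a n ^ p * w.toFun n) ha.2
    (fun n => by
      have := ((hpt n).rpow_const (p := p) (Or.inr hp0.le)).mul_const (w.toFun n)
      simpa [Real.zero_rpow hp0.ne'] using this)
    (Eventually.of_forall fun t n => by
      rw [Real.norm_of_nonneg (lorentz_term_nonneg w p _ n)]
      exact mul_le_mul_of_nonneg_right (Real.rpow_le_rpow (decRearr_nonneg _ _)
        (decRearr_mono ha.1 (abs_indicator_le _ a) n) hp0.le) (w.pos n).le)
  rw [tsum_zero] at h
  have h2 := h.rpow_const (p := 1 / p) (Or.inr (by positivity))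
  rwa [Real.zero_rpow (by positivity)] at h2

theorem decRearr_finsupp_eq_zero (a : ℕ →₀ ℝ) {n : ℕ} (hn : a.support.card ≤ n) :
    decRearr a n = 0 := by
  refine le_antisymm (decRearr_le hn le_rfl fun i hi => ?_) (decRearr_nonneg _ _)
  rw [Finsupp.notMem_support_iff.mp hi, abs_zero]

theorem memLorentz_finsupp (hp : 1 ≤ p) (a : ℕ →₀ ℝ) : MemLorentz w p a := by
  refine ⟨finsupp_tendsto_zero a, summable_of_ne_finset_zero (s := Finset.range a.support.card) ?_⟩
  intro n hn
  rw [decRearr_finsupp_eq_zero a (by simpa using hn), Real.zero_rpow (by linarith), zero_mul]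

end

/-! ### Tensor products in Lorentz spaces with submultiplicative fundamental function -/

/-- Abel summation: it turns weighted sums into combinations of values of the fundamental function,
where submultiplicativity can be used. -/
theorem sum_sub_mul_partialSum (w : LorentzWeight) (b : ℕ → ℝ) (J : ℕ) :
    ∑ s ∈ Finset.range J, (b s - b (s + 1)) * w.partialSum (s + 1) =
      ∑ s ∈ Finset.range J, b s * w.toFun s - b J * w.partialSum J := by
  induction J with
  | zero => simp [LorentzWeight.partialSum]
  | succ J ih =>
    rw [Finset.sum_range_succ, ih, Finset.sum_range_succ]
    simp only [LorentzWeight.partialSum, Finset.sum_range_succ]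
    ring

theorem eq_sum_sub_of_eq_zero {b : ℕ → ℝ} {J : ℕ} (hJ : b J = 0) {s : ℕ} (hs : s ≤ J) :
    b s = ∑ r ∈ Finset.range J, if s ≤ r then b r - b (r + 1) else 0 := by
  rw [← Finset.sum_filter]
  have : (Finset.range J).filter (fun r => s ≤ r) = Finset.Ico s J := by
    ext r; simp [and_comm]
  rw [this, Finset.sum_Ico_eq_sum_range]
  have := Finset.sum_range_sub' (fun k => b (s + k)) (J - s)
  simp only [add_zero, Nat.add_sub_cancel' hs, hJ, sub_zero] at this
  rw [← this]
  rfl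

/-- Writing `b` and `F` as sums of their decrements reduces the claim to rectangles. At most
(s+1)(t+1) positions carry labels in the rectangle with corner (s,t), so their total weight is at
most the fundamental function at (s+1)(t+1), hence at most the product of its values at s+1 and t+1.
Abel summation reassembles the two factors. -/
theorem sum_tensor_le (w : LorentzWeight)
    (hS : ∀ j m, w.partialSum (j * m) ≤ w.partialSum j * w.partialSum m)
    {b F : ℕ → ℝ} (hb : Antitone b) (hF : Antitone F) {J M : ℕ} (hbJ : b J = 0) (hFM : F M = 0)
    (P : Finset ℕ) (l : ℕ → ℕ × ℕ) (hl : Set.InjOn l P)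
    (hlt : ∀ n ∈ P, (l n).1 ≤ J ∧ (l n).2 ≤ M) :
    ∑ n ∈ P, b (l n).1 * F (l n).2 * w.toFun n ≤
      (∑ s ∈ Finset.range J, b s * w.toFun s) * ∑ t ∈ Finset.range M, F t * w.toFun t := by
  have hcard : ∀ s t, ∑ n ∈ P.filter (fun n => (l n).1 ≤ s ∧ (l n).2 ≤ t), w.toFun n ≤
      w.partialSum (s + 1) * w.partialSum (t + 1) := by
    intro s t
    refine (w.sum_le_partialSum_card _).trans ((w.partialSum_mono ?_).trans (hS _ _))
    rw [← Finset.card_range (s + 1), ← Finset.card_range (t + 1), ← Finset.card_product]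
    refine Finset.card_le_card_of_injOn l ?_ (hl.mono fun n hn => (Finset.mem_filter.mp hn).1)
    intro n hn
    simp only [Finset.coe_filter, Set.mem_ofPred_eq] at hn
    simp only [Finset.coe_product, Finset.coe_range, Set.mem_prod, Set.mem_Iio]
    omega
  have e1 := sum_sub_mul_partialSum w b J
  have e2 := sum_sub_mul_partialSum w F M
  rw [hbJ, zero_mul, sub_zero] at e1
  rw [hFM, zero_mul, sub_zero] at e2
  rw [← e1, ← e2, Finset.sum_mul_sum]
  calc ∑ n ∈ P, b (l n).1 * F (l n).2 * w.toFun n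
      = ∑ n ∈ P, ∑ s ∈ Finset.range J, ∑ t ∈ Finset.range M,
          (if (l n).1 ≤ s ∧ (l n).2 ≤ t then
            (b s - b (s + 1)) * (F t - F (t + 1)) * w.toFun n else 0) := by
        refine Finset.sum_congr rfl fun n hn => ?_
        rw [eq_sum_sub_of_eq_zero hbJ (hlt n hn).1, eq_sum_sub_of_eq_zero hFM (hlt n hn).2,
          Finset.sum_mul_sum, Finset.sum_mul]
        refine Finset.sum_congr rfl fun s _ => ?_
        rw [Finset.sum_mul]
        refine Finset.sum_congr rfl fun t _ => ?_
        by_cases h1 : (l n).1 ≤ s <;> by_cases h2 : (l n).2 ≤ t <;> simp [h1, h2]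
    _ = ∑ s ∈ Finset.range J, ∑ t ∈ Finset.range M, (b s - b (s + 1)) * (F t - F (t + 1)) *
          ∑ n ∈ P.filter (fun n => (l n).1 ≤ s ∧ (l n).2 ≤ t), w.toFun n := by
        rw [Finset.sum_comm]
        refine Finset.sum_congr rfl fun s _ => ?_
        rw [Finset.sum_comm]
        refine Finset.sum_congr rfl fun t _ => ?_
        rw [Finset.mul_sum, Finset.sum_filter]
    _ ≤ _ := by
        refine Finset.sum_le_sum fun s _ => Finset.sum_le_sum fun t _ => ?_
        have h1 := sub_nonneg.mpr (hb (Nat.le_succ s))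
        have h2 := sub_nonneg.mpr (hF (Nat.le_succ t))
        calc _ ≤ (b s - b (s + 1)) * (F t - F (t + 1)) *
              (w.partialSum (s + 1) * w.partialSum (t + 1)) :=
              mul_le_mul_of_nonneg_left (hcard s t) (mul_nonneg h1 h2)
          _ = _ := by ring

/-- A sequence dominated by an injective labelling of the tensor product of `a` and `G` has norm
at most the product of the norms of `a` and `G`. -/
theorem lorentzNorm_tensor_le {w : LorentzWeight} {p : ℝ} (hp : 1 ≤ p)
    (hS : ∀ j m, w.partialSum (j * m) ≤ w.partialSum j * w.partialSum m)
    (a : ℕ →₀ ℝ) {G : ℕ → ℝ} (hG : Antitone G) (hG0 : ∀ m, 0 ≤ G m) {M : ℕ} (hGM : G M = 0)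
    {z : ℕ → ℝ} (hz : Tendsto z atTop (𝓝 0)) (l : ℕ → ℕ × ℕ) (hl : Set.InjOn l {n | z n ≠ 0})
    (h : ∀ n, z n ≠ 0 → (l n).2 ≤ M ∧ |z n| ≤ |a (l n).1| * G (l n).2) :
    MemLorentz w p z ∧ lorentzNorm w p z ^ p ≤
      lorentzNorm w p a ^ p * ∑ t ∈ Finset.range M, G t ^ p * w.toFun t := by
  have hp0 : 0 < p := by linarith
  set J := a.support.card
  have ha := memLorentz_finsupp (w := w) hp a
  obtain ⟨τ, hτ, heq, hle⟩ := exists_decRearr ha.1 J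
  have hex : ∀ j, a j ≠ 0 → ∃ s < J, τ s = j := by
    intro j hj
    by_contra hne
    push Not at hne
    have hjn : j ∉ (Finset.range J).image τ := by
      simp only [Finset.mem_image, Finset.mem_range, not_exists, not_and]
      exact hne
    have hsub : insert j ((Finset.range J).image τ) ⊆ a.support := by
      intro i hi
      rcases Finset.mem_insert.mp hi with rfl | hi
      · exact Finsupp.mem_support_iff.mpr hj
      · obtain ⟨s, hs, rfl⟩ := Finset.mem_image.mp hi
        rw [Finsupp.mem_support_iff, ← abs_pos]
        exact (abs_pos.mpr hj).trans_le (hle j hjn s hs)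
    have hc := Finset.card_le_card hsub
    rw [Finset.card_insert_of_notMem hjn, Finset.card_image_of_injOn hτ, Finset.card_range] at hc
    exact absurd hc (by simp [J])
  -- `rk j` is the rank of the coordinate `j` in the rearrangement of `a`; its values off the
  -- support play no role. It converts labels by coordinates into labels by ranks, along which
  -- `decRearr a` decreases.
  have hrk : ∃ rk : ℕ → ℕ, ∀ j, a j ≠ 0 → rk j < J ∧ τ (rk j) = j := by
    choose! rk h1 using hex
    exact ⟨rk, h1⟩
  obtain ⟨rk, hrk⟩ := hrk
  have ha0 : ∀ n, z n ≠ 0 → a (l n).1 ≠ 0 := by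
    intro n hn h0
    have := (h n hn).2
    rw [h0, abs_zero, zero_mul] at this
    exact hn (abs_nonpos_iff.mp this)
  have hnn : 0 ≤ ∑ t ∈ Finset.range M, G t ^ p * w.toFun t := Finset.sum_nonneg fun t _ =>
    mul_nonneg (Real.rpow_nonneg (hG0 t) _) (w.pos t).le
  refine memLorentz_of_rpow_bound hp hz
    (mul_nonneg (Real.rpow_nonneg (lorentzNorm_nonneg w p a) _) hnn) fun N σ hσ => ?_
  have key := sum_tensor_le w hS (b := fun s => decRearr a s ^ p) (F := fun t => G t ^ p)
    (fun x y hxy => Real.rpow_le_rpow (decRearr_nonneg _ _) (decRearr_antitone ha.1 hxy) hp0.le)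
    (fun x y hxy => Real.rpow_le_rpow (hG0 _) (hG hxy) hp0.le) (J := J) (M := M)
    (by
      rw [decRearr_finsupp_eq_zero a le_rfl, Real.zero_rpow hp0.ne'])
    (by
      rw [hGM, Real.zero_rpow hp0.ne'])
    ((Finset.range N).filter fun n => z (σ n) ≠ 0)
    (fun n => (rk (l (σ n)).1, (l (σ n)).2)) (by
      intro x hx y hy hxy
      simp only [Finset.coe_filter, Set.mem_ofPred_eq] at hx hy
      simp only [Prod.mk.injEq] at hxy
      refine hσ hx.1 hy.1 (hl hx.2 hy.2 (Prod.ext ?_ hxy.2))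
      rw [← (hrk _ (ha0 _ hx.2)).2, ← (hrk _ (ha0 _ hy.2)).2, hxy.1])
    (by
      intro n hn
      have hn' := (Finset.mem_filter.mp hn).2
      exact ⟨(hrk _ (ha0 _ hn')).1.le, (h _ hn').1⟩)
  have hsum : ∑ s ∈ Finset.range J, decRearr a s ^ p * w.toFun s ≤ lorentzNorm w p a ^ p := by
    rw [lorentzNorm_rpow w hp]
    exact ha.2.sum_le_tsum _ fun n _ => lorentz_term_nonneg w p a n
  refine le_trans ?_ (key.trans (mul_le_mul_of_nonneg_right hsum hnn))
  rw [Finset.sum_filter]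
  refine Finset.sum_le_sum fun n _ => ?_
  split_ifs with h0
  · refine mul_le_mul_of_nonneg_right ?_ (w.pos n).le
    obtain ⟨hr1, hr2⟩ := hrk _ (ha0 _ h0)
    rw [← heq _ (Finset.mem_range.mpr hr1), hr2, ← Real.mul_rpow (abs_nonneg _) (hG0 _)]
    exact Real.rpow_le_rpow (abs_nonneg _) (h _ h0).2 hp0.le
  · rw [ne_eq, not_not] at h0
    rw [h0, abs_zero, Real.zero_rpow hp0.ne', zero_mul]

/-! ### Seminorms on `c₀₀` and vectors of Lorentz spaces -/

namespace LorentzSpace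

variable {w : LorentzWeight} {p : ℝ} [hp : Fact (1 ≤ p)]

/-- The inclusion of `d(w,p)` into the space of all sequences. -/
def toSeq : LorentzSpace w p →ₗ[ℝ] (ℕ → ℝ) := (lorentzSubmodule w p).subtype

theorem memLorentz (u : LorentzSpace w p) : MemLorentz w p (toSeq u) := u.2

theorem norm_eq (u : LorentzSpace w p) : ‖u‖ = lorentzNorm w p (toSeq u) := rfl

theorem abs_toSeq_le (u : LorentzSpace w p) (m : ℕ) : |toSeq u m| ≤ ‖u‖ :=
  abs_le_lorentzNorm w hp.out u.2 m

theorem toSeq_sum_smul {ι : Type*} (s : Finset ι) (a : ι → ℝ) (u : ι → LorentzSpace w p) (m : ℕ) :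
    toSeq (∑ i ∈ s, a i • u i) m = ∑ i ∈ s, a i * toSeq (u i) m := by
  simp [map_sum, Finset.sum_apply]

theorem norm_le_of_abs_le {u v : LorentzSpace w p} (h : ∀ m, |toSeq u m| ≤ |toSeq v m|) :
    ‖u‖ ≤ ‖v‖ :=
  (lorentzNorm_le_of_abs_le hp.out v.2 h).2

/-- Restriction of a sequence to a set of coordinates. -/
def restrict (T : Set ℕ) (u : LorentzSpace w p) : LorentzSpace w p :=
  ⟨T.indicator u.1, (lorentzNorm_le_of_abs_le hp.out u.2 (abs_indicator_le T u.1)).1⟩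

theorem toSeq_restrict (T : Set ℕ) (u : LorentzSpace w p) :
    toSeq (restrict T u) = T.indicator (toSeq u) := rfl

theorem norm_restrict_le (T : Set ℕ) (u : LorentzSpace w p) : ‖restrict T u‖ ≤ ‖u‖ :=
  norm_le_of_abs_le fun m => by
    rw [toSeq_restrict]
    exact abs_indicator_le T (toSeq u) m

theorem toSeq_injective : Function.Injective (toSeq : LorentzSpace w p →ₗ[ℝ] (ℕ → ℝ)) :=
  Subtype.val_injective

theorem restrict_add_restrict_compl (T : Set ℕ) (u : LorentzSpace w p) :
    restrict T u + restrict Tᶜ u = u := by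
  apply toSeq_injective
  rw [map_add, toSeq_restrict, toSeq_restrict, Set.indicator_self_add_compl]

variable (w p) in
/-- Finitely supported sequences as vectors of `d(w,p)`. -/
def ofFinsupp : (ℕ →₀ ℝ) →ₗ[ℝ] LorentzSpace w p where
  toFun a := ⟨a, memLorentz_finsupp hp.out a⟩
  map_add' _ _ := rfl
  map_smul' _ _ := rfl

theorem toSeq_ofFinsupp (a : ℕ →₀ ℝ) : toSeq (ofFinsupp w p a) = a := rfl

variable (w p) in
/-- The coordinate functionals. -/
def coord (m : ℕ) : StrongDual ℝ (LorentzSpace w p) :=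
  LinearMap.mkContinuous ((LinearMap.proj m).comp toSeq) 1 fun u => by
    rw [one_mul]; exact abs_toSeq_le u m

end LorentzSpace

open LorentzSpace

/-- The norm of `d(w,p)` on `c₀₀`. -/
def lorentzSeminorm (w : LorentzWeight) (p : ℝ) [Fact (1 ≤ p)] : Seminorm ℝ (ℕ →₀ ℝ) :=
  (normSeminorm ℝ (LorentzSpace w p)).comp (ofFinsupp w p)

theorem lorentzSeminorm_apply (w : LorentzWeight) (p : ℝ) [Fact (1 ≤ p)] (a : ℕ →₀ ℝ) :
    lorentzSeminorm w p a = lorentzNorm w p a := rfl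

theorem lpNorm_eq_sum {p : ℝ} (hp : 0 < p) (a : ℕ →₀ ℝ) {s : Finset ℕ} (hs : a.support ⊆ s) :
    lpNorm p a = (∑ i ∈ s, |a i| ^ p) ^ (1 / p) := by
  rw [lpNorm, Finset.sum_subset hs]
  intro i _ hi
  rw [Finsupp.notMem_support_iff.mp hi, abs_zero, Real.zero_rpow hp.ne']

/-- The `ℓ_p` norm as a seminorm on `c₀₀`. -/
def lpSeminorm (p : ℝ) [hp : Fact (1 ≤ p)] : Seminorm ℝ (ℕ →₀ ℝ) :=
  Seminorm.of (lpNorm p)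
    (fun a b => by
      have hp0 : 0 < p := by linarith [hp.out]
      rw [lpNorm_eq_sum hp0 (a + b) Finsupp.support_add,
        lpNorm_eq_sum hp0 a (Finset.subset_union_left (s₂ := b.support)),
        lpNorm_eq_sum hp0 b (Finset.subset_union_right (s₁ := a.support))]
      exact Real.Lp_add_le _ _ _ hp.out)
    (fun c a => by
      have hp0 : 0 < p := by linarith [hp.out]
      rw [lpNorm_eq_sum hp0 (c • a) Finsupp.support_smul, lpNorm, Real.norm_eq_abs]
      simp only [Finsupp.smul_apply, smul_eq_mul, abs_mul]
      simp only [Real.mul_rpow (abs_nonneg _) (abs_nonneg _), ← Finset.mul_sum]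
      rw [Real.mul_rpow (Real.rpow_nonneg (abs_nonneg _) _)
        (Finset.sum_nonneg fun i _ => Real.rpow_nonneg (abs_nonneg _) _), one_div,
        Real.rpow_rpow_inv (abs_nonneg _) hp0.ne'])

theorem lpSeminorm_apply (p : ℝ) [Fact (1 ≤ p)] (a : ℕ →₀ ℝ) : lpSeminorm p a = lpNorm p a := rfl

theorem lpNorm_nonneg (p : ℝ) (a : ℕ →₀ ℝ) : 0 ≤ lpNorm p a :=
  Real.rpow_nonneg (Finset.sum_nonneg fun _ _ => Real.rpow_nonneg (abs_nonneg _) _) _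

theorem lpNorm_rpow {p : ℝ} (hp : 1 ≤ p) (a : ℕ →₀ ℝ) :
    lpNorm p a ^ p = ∑ i ∈ a.support, |a i| ^ p := by
  rw [lpNorm, one_div, Real.rpow_inv_rpow
    (Finset.sum_nonneg fun _ _ => Real.rpow_nonneg (abs_nonneg _) _) (by linarith)]

/-! ### Estimates for disjointly supported sequences -/

/-- The vectors `v 0, v 1, …` have pairwise disjoint supports. -/
def IsDisjoint {w : LorentzWeight} {p : ℝ} [Fact (1 ≤ p)] (v : ℕ → LorentzSpace w p) : Prop :=
  ∀ m i j, toSeq (v i) m ≠ 0 → toSeq (v j) m ≠ 0 → i = j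

section

variable {w : LorentzWeight} {p : ℝ} [hp : Fact (1 ≤ p)]

theorem isDisjoint_restrict (u : ℕ → LorentzSpace w p) {T : ℕ → Set ℕ}
    (hT : ∀ m i j, m ∈ T i → m ∈ T j → i = j) : IsDisjoint fun j => restrict (T j) (u j) := by
  intro m i j hi hj
  exact hT m i j (Set.mem_of_indicator_ne_zero hi) (Set.mem_of_indicator_ne_zero hj)

theorem IsDisjoint.toSeq_sum {v : ℕ → LorentzSpace w p} (hv : IsDisjoint v) (a : ℕ →₀ ℝ)
    {j m : ℕ} (h : toSeq (v j) m ≠ 0) :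
    toSeq (∑ i ∈ a.support, a i • v i) m = a j * toSeq (v j) m := by
  rw [toSeq_sum_smul]
  refine Finset.sum_eq_single j (fun i _ hij => ?_) fun hj => ?_
  · by_contra h0
    exact hij (hv m i j (right_ne_zero_of_mul h0) h)
  · rw [Finsupp.notMem_support_iff.mp hj, zero_mul]

theorem IsDisjoint.norm_sum_le {v : ℕ → LorentzSpace w p} (hv : IsDisjoint v)
    (hv1 : ∀ j, ‖v j‖ ≤ 1) (a : ℕ →₀ ℝ) : ‖∑ j ∈ a.support, a j • v j‖ ≤ lpNorm p a := by
  have hp0 : 0 < p := by linarith [hp.out]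
  have h := lorentzNorm_sum_rpow_le (w := w) hp.out a.support (fun j => toSeq (a j • v j))
    (fun j _ => (a j • v j).memLorentz) (fun m i _ j _ hi hj => by
      rw [map_smul, Pi.smul_apply, smul_eq_mul] at hi hj
      exact hv m i j (right_ne_zero_of_mul hi) (right_ne_zero_of_mul hj))
  rw [← map_sum, ← norm_eq] at h
  refine (Real.rpow_le_rpow_iff (norm_nonneg _) (lpNorm_nonneg p a) hp0).mp (h.trans ?_)
  rw [lpNorm_rpow hp.out]
  refine Finset.sum_le_sum fun j _ => ?_
  rw [← norm_eq, norm_smul, Real.norm_eq_abs]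
  refine Real.rpow_le_rpow (by positivity) ?_ hp0.le
  exact mul_le_of_le_one_right (abs_nonneg _) (hv1 j)

/-- Disjoint vectors with a large coordinate dominate the unit vector basis of `d(w,p)`. -/
theorem IsDisjoint.le_norm_sum_of_coord {v : ℕ → LorentzSpace w p} (hv : IsDisjoint v) {c : ℝ}
    (hc : 0 < c) (m : ℕ → ℕ) (hm : ∀ j, c ≤ |toSeq (v j) (m j)|) (a : ℕ →₀ ℝ) :
    c * lorentzNorm w p a ≤ ‖∑ j ∈ a.support, a j • v j‖ := by
  have hne : ∀ j, toSeq (v j) (m j) ≠ 0 := fun j => abs_pos.mp (hc.trans_le (hm j))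
  have h := lorentzNorm_le_of_relabel (w := w) hp.out
    (memLorentz (∑ j ∈ a.support, a j • v j)) (finsupp_tendsto_zero (c • a)) m
    (fun i _ j _ hij => hv (m i) i j (hne i) (by rw [hij]; exact hne j))
    (fun j _ => by
      rw [hv.toSeq_sum a (hne j), Finsupp.smul_apply, smul_eq_mul, abs_mul, abs_mul, mul_comm,
        abs_of_pos hc]
      exact mul_le_mul_of_nonneg_left (hm j) (abs_nonneg _))
  have h2 : lorentzNorm w p (c • a : ℕ →₀ ℝ) = c * lorentzNorm w p a := by
    have := map_smul_eq_mul (lorentzSeminorm w p) c a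
    rwa [Real.norm_of_nonneg hc.le] at this
  rw [← h2]
  exact h.2

/-- Disjoint vectors that can be put side by side dominate the unit vector basis of `ℓ_p`. -/
theorem IsDisjoint.le_norm_sum_of_positions {v : ℕ → LorentzSpace w p} (hv : IsDisjoint v)
    (d : ℕ → ℝ) (I : ℕ → Finset ℕ) (hI : ∀ n i j, n ∈ I i → n ∈ I j → i = j)
    (σ : ℕ → ℕ → ℕ) (hσ : ∀ j, Set.InjOn (σ j) (I j))
    (hne : ∀ j, ∀ n ∈ I j, toSeq (v j) (σ j n) ≠ 0)
    (a : ℕ →₀ ℝ)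
    (hd : ∀ j ∈ a.support, d j ≤ ∑ n ∈ I j, |toSeq (v j) (σ j n)| ^ p * w.toFun n) :
    ∑ j ∈ a.support, |a j| ^ p * d j ≤ ‖∑ j ∈ a.support, a j • v j‖ ^ p := by
  classical
  -- Since the sets `I j` are disjoint, a position determines its block, and the maps `σ j` glue to
  -- a single map on the union. The glued map is injective because the supports of the `v j` are
  -- disjoint.
  have hidx : ∃ J : ℕ → ℕ, ∀ j, ∀ n ∈ I j, J n = j := by
    have : ∀ n, ∃ i, ∀ j, n ∈ I j → i = j := by
      intro n
      by_cases h : ∃ j, n ∈ I j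
      · obtain ⟨j, hj⟩ := h
        exact ⟨j, fun i hi => hI n j i hj hi⟩
      · exact ⟨0, fun j hj => absurd ⟨j, hj⟩ h⟩
    choose J hJ using this
    exact ⟨J, fun j n hn => hJ n j hn⟩
  obtain ⟨J, hJ⟩ := hidx
  have h := sum_positions_le hp.out (memLorentz (∑ j ∈ a.support, a j • v j)) (a.support.biUnion I)
    (fun n => σ (J n) n) (by
      intro x hx y hy hxy
      rw [Finset.mem_coe, Finset.mem_biUnion] at hx hy
      obtain ⟨i, -, hx⟩ := hx
      obtain ⟨j, -, hy⟩ := hy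
      simp only [hJ i x hx, hJ j y hy] at hxy
      have hij : i = j := hv (σ i x) i j (hne i x hx) (by rw [hxy]; exact hne j y hy)
      subst hij
      exact hσ i hx hy hxy)
  rw [← norm_eq, Finset.sum_biUnion (fun i _ j _ hij => Finset.disjoint_left.mpr fun n hi hj =>
    hij (hI n i j hi hj))] at h
  refine le_trans (Finset.sum_le_sum fun j hj => ?_) h
  have hp0 : 0 < p := by linarith [hp.out]
  calc |a j| ^ p * d j ≤ |a j| ^ p * ∑ n ∈ I j, |toSeq (v j) (σ j n)| ^ p * w.toFun n :=
        mul_le_mul_of_nonneg_left (hd j hj) (Real.rpow_nonneg (abs_nonneg _) _)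
    _ = _ := by
        rw [Finset.mul_sum]
        refine Finset.sum_congr rfl fun n hn => ?_
        simp only [hJ j n hn]
        rw [hv.toSeq_sum a (hne j n hn), abs_mul, Real.mul_rpow (abs_nonneg _) (abs_nonneg _),
          mul_assoc]

/-- The upper p-estimate applied to the unit vectors, which have norm at most 1. -/
theorem lorentzNorm_le_lpNorm (a : ℕ →₀ ℝ) : lorentzNorm w p a ≤ lpNorm p a := by
  have hd : IsDisjoint fun j => ofFinsupp w p (Finsupp.single j 1) := by
    intro m i j hi hj
    rw [toSeq_ofFinsupp, Finsupp.single_apply_ne_zero] at hi hj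
    rw [← hi.1, hj.1]
  have h1 : ∀ j, ‖ofFinsupp w p (Finsupp.single j 1)‖ ≤ 1 := by
    intro j
    rw [norm_eq]
    refine (Real.rpow_le_rpow_iff (lorentzNorm_nonneg w p _) zero_le_one
      (by linarith [hp.out] : 0 < p)).mp ?_
    rw [Real.one_rpow]
    refine (memLorentz_of_rpow_bound (w := w) hp.out (finsupp_tendsto_zero _) zero_le_one
      fun N σ hσ => ?_).2
    calc ∑ n ∈ Finset.range N, |(Finsupp.single j (1 : ℝ)) (σ n)| ^ p * w.toFun n
        ≤ ∑ n ∈ Finset.range N, if σ n = j then 1 else 0 := by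
          refine Finset.sum_le_sum fun n _ => ?_
          rw [Finsupp.single_apply]
          have hp0 : p ≠ 0 := by linarith [hp.out]
          split_ifs with h1 h2 h2
          · simpa using w.le_one n
          · exact absurd h1.symm h2
          · exact absurd h2.symm h1
          · simp [Real.zero_rpow hp0]
      _ ≤ 1 := by
          rw [← Finset.sum_filter, Finset.sum_const, nsmul_eq_mul, mul_one]
          have : ((Finset.range N).filter fun n => σ n = j).card ≤ 1 := by
            rw [Finset.card_le_one]
            intro x hx y hy
            rw [Finset.mem_filter] at hx hy
            exact hσ hx.1 hy.1 (hx.2.trans hy.2.symm)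
          exact_mod_cast this
  have h := hd.norm_sum_le h1 a
  have : ∑ j ∈ a.support, a j • ofFinsupp w p (Finsupp.single j 1) = ofFinsupp w p a := by
    conv_rhs => rw [← a.sum_single, Finsupp.sum, map_sum]
    refine Finset.sum_congr rfl fun j _ => ?_
    rw [← map_smul, Finsupp.smul_single, smul_eq_mul, mul_one]
  rw [this] at h
  exact h

end

/-! ### Tails of rearrangements -/

section

variable {w : LorentzWeight} {p : ℝ}

theorem summable_rearr_shift (hp : 1 ≤ p) {a : ℕ → ℝ} (ha : MemLorentz w p a) (M : ℕ) :
    Summable fun m => decRearr a (m + M) ^ p * w.toFun m :=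
  Summable.of_nonneg_of_le
    (fun m => mul_nonneg (Real.rpow_nonneg (decRearr_nonneg _ _) _) (w.pos m).le)
    (fun m => mul_le_mul_of_nonneg_right (Real.rpow_le_rpow (decRearr_nonneg _ _)
      (decRearr_antitone ha.1 (Nat.le_add_right m M)) (by linarith)) (w.pos m).le) ha.2

theorem summable_rearr_tail {a : ℕ → ℝ} (ha : MemLorentz w p a) (M : ℕ) :
    Summable fun m => decRearr a (m + M) ^ p * w.toFun (m + M) :=
  (summable_nat_add_iff M).mpr ha.2

/-- After deletion of the M' largest entries the weights restart at the first one, and this bounds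
the price. Let D be the sum on the right without its factor 3. As S(M') ≤ 2(S(M') - S(M)), the first
M' terms contribute at most a*(M')^p S(M') ≤ 2D; the remaining terms contribute at most D because
both factors decrease. -/
theorem tsum_rearr_shift_le (hp : 1 ≤ p) {a : ℕ → ℝ} (ha : MemLorentz w p a) {M M' : ℕ}
    (hMM : M ≤ M') (h2 : 2 * w.partialSum M ≤ w.partialSum M') :
    ∑' m, decRearr a (m + M') ^ p * w.toFun m ≤
      3 * ∑' m, decRearr a (m + M) ^ p * w.toFun (m + M) := by
  have hp0 : 0 ≤ p := by linarith
  set D := ∑' m, decRearr a (m + M) ^ p * w.toFun (m + M)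
  have hanti := decRearr_antitone ha.1
  have hmono : ∀ {i j}, i ≤ j → decRearr a j ^ p ≤ decRearr a i ^ p := fun h =>
    Real.rpow_le_rpow (decRearr_nonneg _ _) (hanti h) hp0
  have hs := summable_rearr_shift hp ha M'
  rw [← hs.sum_add_tsum_nat_add M']
  have htail : ∑' m, decRearr a (m + M' + M') ^ p * w.toFun (m + M') ≤ D := by
    have e : ∑' m, decRearr a (m + M' + M') ^ p * w.toFun (m + M') ≤
        ∑' m, decRearr a (m + M) ^ p * w.toFun (m + M) := by
      refine Summable.tsum_le_tsum (fun m => ?_) ((summable_nat_add_iff M').mpr hs)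
        (summable_rearr_tail ha M)
      exact mul_le_mul (hmono (by omega)) (w.antitone (by omega)) (w.pos _).le
        (Real.rpow_nonneg (decRearr_nonneg _ _) _)
    exact e
  have hmid : decRearr a M' ^ p * (w.partialSum M' - w.partialSum M) ≤ D := by
    have e1 : w.partialSum M' - w.partialSum M = ∑ m ∈ Finset.range (M' - M), w.toFun (m + M) := by
      rw [LorentzWeight.partialSum, LorentzWeight.partialSum,
        ← Finset.sum_range_add_sum_Ico _ hMM, add_sub_cancel_left, Finset.sum_Ico_eq_sum_range]
      exact Finset.sum_congr rfl fun m _ => by rw [add_comm]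
    rw [e1, Finset.mul_sum]
    refine le_trans (Finset.sum_le_sum fun m hm => ?_)
      ((summable_rearr_tail ha M).sum_le_tsum (Finset.range (M' - M)) fun m _ =>
        lorentz_term_nonneg w p a (m + M))
    have := Finset.mem_range.mp hm
    exact mul_le_mul_of_nonneg_right (hmono (by omega)) (w.pos _).le
  have hhead : ∑ m ∈ Finset.range M', decRearr a (m + M') ^ p * w.toFun m ≤
      decRearr a M' ^ p * w.partialSum M' := by
    rw [LorentzWeight.partialSum, Finset.mul_sum]
    exact Finset.sum_le_sum fun m _ =>
      mul_le_mul_of_nonneg_right (hmono (Nat.le_add_left _ _)) (w.pos _).le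
  have hx : 0 ≤ decRearr a M' ^ p := Real.rpow_nonneg (decRearr_nonneg _ _) _
  nlinarith

/-- Splitting off the `M` largest coordinates. -/
theorem exists_head (hp : 1 ≤ p) {a : ℕ → ℝ} (ha : MemLorentz w p a) (M : ℕ) :
    ∃ σ : ℕ → ℕ, Set.InjOn σ (Finset.range M) ∧
      (∀ m ∈ Finset.range M, |a (σ m)| = decRearr a m) ∧
      lorentzNorm w p (Set.indicator ((((Finset.range M).image σ : Finset ℕ) : Set ℕ)ᶜ) a) ^ p ≤
        ∑' m, decRearr a (m + M) ^ p * w.toFun m := by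
  obtain ⟨σ, hσ, heq, hle⟩ := exists_decRearr ha.1 M
  refine ⟨σ, hσ, heq, ?_⟩
  set E := (Finset.range M).image σ
  have hcard : E.card = M := by rw [Finset.card_image_of_injOn hσ, Finset.card_range]
  have hmem := (lorentzNorm_le_of_abs_le hp ha (abs_indicator_le ((E : Set ℕ)ᶜ) a)).1
  rw [lorentzNorm_rpow w hp]
  refine Summable.tsum_le_tsum (fun m => ?_) hmem.2 (summable_rearr_shift hp ha M)
  refine mul_le_mul_of_nonneg_right (Real.rpow_le_rpow (decRearr_nonneg _ _) ?_ (by linarith))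
    (w.pos m).le
  obtain ⟨F, hF, hFle⟩ := exists_finset_abs_le_decRearr ha.1 (m + M)
  have hout : ∀ i, |Set.indicator ((E : Set ℕ)ᶜ) a i| ≤ decRearr a (m + M) ∨
      (i ∉ E ∧ Set.indicator ((E : Set ℕ)ᶜ) a i = a i) := by
    intro i
    by_cases hi : i ∈ E
    · left
      rw [Set.indicator_of_notMem (by simpa using hi), abs_zero]
      exact decRearr_nonneg _ _
    · right
      exact ⟨hi, Set.indicator_of_mem (by simpa using hi) _⟩
  -- If `F` contains `E`, at most m exceptional coordinates remain off `E`. Otherwise some member of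
  -- `E` lies outside `F`, so it is at most `decRearr a (m + M)`, and every coordinate off `E` is
  -- smaller still.
  by_cases hEF : E ⊆ F
  · refine decRearr_le (F := F \ E) ?_ (decRearr_nonneg _ _) fun i hi => ?_
    · rw [Finset.card_sdiff_of_subset hEF]; omega
    · rcases hout i with h | ⟨h1, h2⟩
      · exact h
      · rw [h2]
        exact hFle i fun hiF => hi (Finset.mem_sdiff.mpr ⟨hiF, h1⟩)
  · obtain ⟨e, heE, heF⟩ := Finset.not_subset.mp hEF
    obtain ⟨n, hn, rfl⟩ := Finset.mem_image.mp heE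
    refine decRearr_le (F := ∅) (by simp) (decRearr_nonneg _ _) fun i _ => ?_
    rcases hout i with h | ⟨h1, h2⟩
    · exact h
    · rw [h2]
      exact (hle i h1 n hn).trans (hFle _ heF)

end

/-! ### Sequences with uniformly small rearrangement tails -/

/-- The tails of the rearrangements of `y k` are small, uniformly for large `k`. -/
def UniformTails {w : LorentzWeight} {p : ℝ} [Fact (1 ≤ p)] (y : ℕ → LorentzSpace w p) : Prop :=
  ∀ η > 0, ∃ M, ∀ᶠ k in atTop,
    ∑' m, decRearr (toSeq (y k)) (m + M) ^ p * w.toFun (m + M) ≤ η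

section

variable {w : LorentzWeight} {p : ℝ} [hp : Fact (1 ≤ p)]

/-- The p-th power of the norm splits at position M: the tail is uniformly small, and the head is at
most the p-th power of the largest coordinate times `w.partialSum M`. -/
theorem UniformTails.tendsto_norm {y : ℕ → LorentzSpace w p} (ht : UniformTails y)
    (h0 : Tendsto (fun k => decRearr (toSeq (y k)) 0) atTop (𝓝 0)) :
    Tendsto (fun k => ‖y k‖) atTop (𝓝 0) := by
  have hp0 : 0 < p := by linarith [hp.out]
  have key : Tendsto (fun k => ‖y k‖ ^ p) atTop (𝓝 0) := by
    rw [Metric.tendsto_atTop']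
    intro ε hε
    obtain ⟨M, hM⟩ := ht (ε / 2) (by linarith)
    have h1 : Tendsto (fun k => decRearr (toSeq (y k)) 0 ^ p * w.partialSum M) atTop (𝓝 0) := by
      have := (h0.rpow_const (p := p) (Or.inr hp0.le)).mul_const (w.partialSum M)
      rwa [Real.zero_rpow hp0.ne', zero_mul] at this
    obtain ⟨K, hK⟩ := eventually_atTop.mp (hM.and (h1.eventually (gt_mem_nhds (half_pos hε))))
    refine ⟨K, fun k hk => ?_⟩
    obtain ⟨h2, h3⟩ := hK k hk.le
    rw [Real.dist_eq, sub_zero, abs_of_nonneg (Real.rpow_nonneg (norm_nonneg _) _), norm_eq,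
      lorentzNorm_rpow w hp.out, ← (y k).memLorentz.2.sum_add_tsum_nat_add M]
    have h4 : ∑ m ∈ Finset.range M, decRearr (toSeq (y k)) m ^ p * w.toFun m ≤
        decRearr (toSeq (y k)) 0 ^ p * w.partialSum M := by
      rw [LorentzWeight.partialSum, Finset.mul_sum]
      exact Finset.sum_le_sum fun m _ => mul_le_mul_of_nonneg_right
        (Real.rpow_le_rpow (decRearr_nonneg _ _)
          (decRearr_antitone (y k).memLorentz.1 m.zero_le) hp0.le) (w.pos m).le
    linarith
  have h2 := key.rpow_const (p := 1 / p) (Or.inr (by positivity))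
  rw [Real.zero_rpow (by positivity)] at h2
  refine h2.congr fun k => ?_
  rw [one_div, Real.rpow_rpow_inv (norm_nonneg _) hp0.ne']

theorem norm_sum_smul_le {X : Type*} [NormedAddCommGroup X] [NormedSpace ℝ X] (a : ℕ →₀ ℝ)
    {v : ℕ → X} {η : ℝ} (hv : ∀ j, ‖v j‖ ≤ η) :
    ‖∑ j ∈ a.support, a j • v j‖ ≤ η * ∑ j ∈ a.support, |a j| := by
  refine (norm_sum_le _ _).trans ?_
  rw [Finset.mul_sum]
  refine Finset.sum_le_sum fun j _ => ?_
  rw [norm_smul, Real.norm_eq_abs, mul_comm]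
  exact mul_le_mul_of_nonneg_right (hv j) (abs_nonneg _)

theorem sum_rearr_limit_le {y : ℕ → LorentzSpace w p} (hy : ∀ k, ‖y k‖ ≤ 1) {f : ℕ → ℝ}
    (hf : ∀ m, Tendsto (fun k => decRearr (toSeq (y k)) m) atTop (𝓝 (f m))) (M : ℕ) :
    ∑ m ∈ Finset.range M, f m ^ p * w.toFun m ≤ 1 := by
  have hp0 : 0 < p := by linarith [hp.out]
  refine le_of_tendsto (tendsto_finsetSum _ fun m _ =>
    ((hf m).rpow_const (p := p) (Or.inr hp0.le)).mul_const (w.toFun m))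
    (Eventually.of_forall fun k => ?_)
  calc ∑ m ∈ Finset.range M, decRearr (toSeq (y k)) m ^ p * w.toFun m
      ≤ lorentzNorm w p (toSeq (y k)) ^ p := by
        rw [lorentzNorm_rpow w hp.out]
        exact (y k).memLorentz.2.sum_le_tsum _ fun n _ => lorentz_term_nonneg w p _ n
    _ ≤ 1 := Real.rpow_le_one (lorentzNorm_nonneg _ _ _) (hy k) hp0.le

/-- Sequences with uniformly small tails and convergent rearrangements are dominated by the unit
vector basis of `d(w,p)`, up to a small multiple of the `ℓ₁` norm. -/
theorem UniformTails.norm_sum_restrict_le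
    (hS : ∀ j m, w.partialSum (j * m) ≤ w.partialSum j * w.partialSum m)
    {y : ℕ → LorentzSpace w p} (ht : UniformTails y) (hy : ∀ k, ‖y k‖ ≤ 1) {f : ℕ → ℝ}
    (hf : ∀ m, Tendsto (fun k => decRearr (toSeq (y k)) m) atTop (𝓝 (f m))) {η : ℝ} (hη : 0 < η) :
    ∃ K, ∀ (a : ℕ →₀ ℝ) (k : ℕ → ℕ), (∀ j, K ≤ k j) → ∀ T : ℕ → Set ℕ,
      (∀ m i j, m ∈ T i → m ∈ T j → i = j) →
      ‖∑ j ∈ a.support, a j • restrict (T j) (y (k j))‖ ≤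
        2 * lorentzNorm w p a + η * ∑ j ∈ a.support, |a j| := by
  classical
  have hp0 : 0 < p := by linarith [hp.out]
  have hηp : 0 < η ^ p := Real.rpow_pos_of_pos hη p
  -- The divisor 3 compensates the constant of `tsum_rearr_shift_le`, so that what is left after
  -- removing the `M` largest coordinates has norm at most `η`.
  obtain ⟨M₀, hM₀⟩ := ht (η ^ p / 3) (by positivity)
  obtain ⟨M, hMM, hM2⟩ : ∃ M, M₀ ≤ M ∧ 2 * w.partialSum M₀ ≤ w.partialSum M :=
    ((eventually_ge_atTop M₀).and (w.tendsto_partialSum.eventually_ge_atTop _)).exists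
  have hSM := w.partialSum_nonneg M
  -- Raising the first `M` values of f^p by `κ` adds at most 1 to the weighted sum, so the enlarged
  -- profile has weighted sum at most 2.
  set κ : ℝ := 1 / (w.partialSum M + 1) with hκ
  have hκ0 : 0 < κ := by positivity
  have hκS : κ * w.partialSum M ≤ 1 := by
    rw [hκ, one_div_mul_eq_div, div_le_one (by positivity)]; linarith
  have hf0 : ∀ m, 0 ≤ f m := fun m => ge_of_tendsto' (hf m) fun k => decRearr_nonneg _ _
  have hfa : Antitone f := fun m n hmn => le_of_tendsto_of_tendsto' (hf n) (hf m) fun k =>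
    decRearr_antitone (y k).memLorentz.1 hmn
  have hclose : ∀ᶠ k in atTop, ∀ m ∈ Finset.range M,
      decRearr (toSeq (y k)) m ^ p ≤ f m ^ p + κ := by
    rw [Filter.eventually_all_finset]
    intro m _
    exact ((hf m).rpow_const (p := p) (Or.inr hp0.le)).eventually_le_const (by linarith)
  obtain ⟨K, hK⟩ := eventually_atTop.mp (hM₀.and hclose)
  refine ⟨K, fun a k hk T hT => ?_⟩
  -- One decreasing profile, cut off at `M`, that dominates the heads of the rearrangements of all
  -- `y k` with k ≥ K. It is the second tensor factor.
  set G : ℕ → ℝ := fun m => if m < M then (f m ^ p + κ) ^ (1 / p) else 0 with hG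
  have hG0 : ∀ m, 0 ≤ G m := by
    intro m
    simp only [hG]
    split_ifs
    · exact Real.rpow_nonneg (add_nonneg (Real.rpow_nonneg (hf0 m) _) hκ0.le) _
    · exact le_rfl
  have hGa : Antitone G := by
    intro m n hmn
    by_cases hn : n < M
    · simp only [hG, if_pos hn, if_pos (hmn.trans_lt hn)]
      refine Real.rpow_le_rpow (add_nonneg (Real.rpow_nonneg (hf0 n) _) hκ0.le) ?_ (by positivity)
      have := Real.rpow_le_rpow (hf0 n) (hfa hmn) hp0.le
      linarith
    · have : G n = 0 := by simp only [hG, if_neg hn]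
      rw [this]
      exact hG0 m
  have hGp : ∀ m < M, G m ^ p = f m ^ p + κ := by
    intro m hm
    simp only [hG, if_pos hm]
    rw [one_div, Real.rpow_inv_rpow (add_nonneg (Real.rpow_nonneg (hf0 m) _) hκ0.le) hp0.ne']
  have hGsum : ∑ m ∈ Finset.range M, G m ^ p * w.toFun m ≤ 2 := by
    calc ∑ m ∈ Finset.range M, G m ^ p * w.toFun m
        = ∑ m ∈ Finset.range M, f m ^ p * w.toFun m + κ * w.partialSum M := by
          rw [LorentzWeight.partialSum, Finset.mul_sum, ← Finset.sum_add_distrib]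
          refine Finset.sum_congr rfl fun m hm => ?_
          rw [hGp m (Finset.mem_range.mp hm), add_mul]
      _ ≤ 1 + 1 := add_le_add (sum_rearr_limit_le hy hf M) hκS
      _ = 2 := by norm_num
  have hhead := fun k => exists_head hp.out (y k).memLorentz M
  choose σ hσinj hσeq hσtail using hhead
  set E : ℕ → Set ℕ := fun k => (((Finset.range M).image (σ k) : Finset ℕ) : Set ℕ) with hE
  have hsplit : ∑ j ∈ a.support, a j • restrict (T j) (y (k j)) =
      ∑ j ∈ a.support, a j • restrict (E (k j)) (restrict (T j) (y (k j))) +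
      ∑ j ∈ a.support, a j • restrict (E (k j))ᶜ (restrict (T j) (y (k j))) := by
    rw [← Finset.sum_add_distrib]
    refine Finset.sum_congr rfl fun j _ => ?_
    rw [← smul_add, restrict_add_restrict_compl]
  rw [hsplit]
  refine (norm_add_le _ _).trans (add_le_add ?_ (norm_sum_smul_le a fun j => ?_))
  · set z := ∑ j ∈ a.support, a j • restrict (E (k j)) (restrict (T j) (y (k j))) with hz
    have hdisj : IsDisjoint fun j => restrict (E (k j)) (restrict (T j) (y (k j))) := by
      intro m i j hi hj
      exact hT m i j (Set.mem_of_indicator_ne_zero (Set.indicator_apply_ne_zero.mp hi).2)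
        (Set.mem_of_indicator_ne_zero (Set.indicator_apply_ne_zero.mp hj).2)
    -- Each nonzero coordinate of the head sum is labelled by its block and by its rank within that
    -- block; the pair recovers the coordinate, so the labelling is injective.
    have hlab : ∀ n, toSeq z n ≠ 0 → ∃ l : ℕ × ℕ, l.2 < M ∧ σ (k l.1) l.2 = n ∧
        |toSeq z n| ≤ |a l.1| * G l.2 := by
      intro n hn
      obtain ⟨j, hj⟩ : ∃ j, toSeq (restrict (E (k j)) (restrict (T j) (y (k j)))) n ≠ 0 := by
        by_contra hall
        push Not at hall
        apply hn
        rw [hz, toSeq_sum_smul]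
        exact Finset.sum_eq_zero fun j _ => by rw [hall j, mul_zero]
      have hzn := hdisj.toSeq_sum a hj
      rw [← hz] at hzn
      have hnE : n ∈ E (k j) := (Set.indicator_apply_ne_zero.mp hj).1
      simp only [hE, Finset.coe_image, Set.mem_image, Finset.mem_coe] at hnE
      obtain ⟨m, hm, rfl⟩ := hnE
      have hmM := Finset.mem_range.mp hm
      refine ⟨(j, m), hmM, rfl, ?_⟩
      rw [hzn, abs_mul]
      refine mul_le_mul_of_nonneg_left ?_ (abs_nonneg _)
      refine ((abs_indicator_le _ _ _).trans (abs_indicator_le (T j) (toSeq (y (k j))) _)).trans ?_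
      rw [hσeq _ m hm]
      refine (Real.rpow_le_rpow_iff (decRearr_nonneg _ _) (hG0 m) hp0).mp ?_
      rw [hGp m hmM]
      exact (hK _ (hk j)).2 m hm
    have hlab' : ∃ l : ℕ → ℕ × ℕ, ∀ n, toSeq z n ≠ 0 → (l n).2 < M ∧
        σ (k (l n).1) (l n).2 = n ∧ |toSeq z n| ≤ |a (l n).1| * G (l n).2 := by
      choose! l hl using hlab
      exact ⟨l, hl⟩
    obtain ⟨l, hl⟩ := hlab'
    have hten := lorentzNorm_tensor_le hp.out hS a hGa hG0 (M := M) (by simp [hG])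
      z.memLorentz.1 l (by
        intro m hm n hn hmn
        rw [← (hl m hm).2.1, ← (hl n hn).2.1, hmn])
      (fun n hn => ⟨(hl n hn).1.le, (hl n hn).2.2⟩)
    have hn0 := lorentzNorm_nonneg w p a
    rw [norm_eq]
    refine (Real.rpow_le_rpow_iff (lorentzNorm_nonneg _ _ _) (by positivity) hp0).mp ?_
    rw [Real.mul_rpow (by norm_num) hn0]
    have h2 : (2 : ℝ) ≤ 2 ^ p := by
      conv_lhs => rw [← Real.rpow_one 2]
      exact Real.rpow_le_rpow_of_exponent_le (by norm_num) hp.out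
    calc _ ≤ lorentzNorm w p a ^ p * ∑ t ∈ Finset.range M, G t ^ p * w.toFun t := hten.2
      _ ≤ lorentzNorm w p a ^ p * 2 := mul_le_mul_of_nonneg_left hGsum (Real.rpow_nonneg hn0 _)
      _ ≤ 2 ^ p * lorentzNorm w p a ^ p := by
        rw [mul_comm]; exact mul_le_mul_of_nonneg_right h2 (Real.rpow_nonneg hn0 _)
  · have h1 : ‖restrict (E (k j))ᶜ (restrict (T j) (y (k j)))‖ ≤ ‖restrict (E (k j))ᶜ (y (k j))‖ := by
      refine norm_le_of_abs_le fun m => ?_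
      rw [toSeq_restrict, toSeq_restrict, toSeq_restrict]
      by_cases hm : m ∈ (E (k j))ᶜ
      · rw [Set.indicator_of_mem hm, Set.indicator_of_mem hm]
        exact abs_indicator_le _ _ _
      · rw [Set.indicator_of_notMem hm, Set.indicator_of_notMem hm]
    refine h1.trans ((Real.rpow_le_rpow_iff (norm_nonneg _) hη.le hp0).mp ?_)
    have h2 := tsum_rearr_shift_le hp.out (y (k j)).memLorentz hMM hM2
    have h3 := (hK _ (hk j)).1
    have h4 := hσtail (k j)
    rw [norm_eq]
    refine h4.trans (h2.trans ?_)
    linarith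

/-- Tails beyond position `t` keep mass more than η for infinitely many `k`, and finitely many
positions already carry more than 3η/4 of it. Those placed on coordinates below `t` contribute less
than η/4 because the coordinates tend to 0. Hence η/2 survives with both positions and coordinates
beyond `t`, ready for a gliding hump in both at once. -/
theorem not_uniformTails_positions {y : ℕ → LorentzSpace w p} (ht : ¬ UniformTails y)
    (h0 : ∀ m, Tendsto (fun k => toSeq (y k) m) atTop (𝓝 0)) :
    ∃ η > 0, ∀ t, ∃ᶠ k in atTop, ∀ᶠ t' in atTop, ∃ (I : Finset ℕ) (σ : ℕ → ℕ),
      Set.InjOn σ I ∧ (∀ n ∈ I, n ∈ Set.Ico t t' ∧ σ n ∈ Set.Ico t t' ∧ toSeq (y k) (σ n) ≠ 0) ∧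
      η ≤ ∑ n ∈ I, |toSeq (y k) (σ n)| ^ p * w.toFun n := by
  have hp0 : 0 < p := by linarith [hp.out]
  rw [UniformTails] at ht
  push Not at ht
  obtain ⟨η, hη, ht⟩ := ht
  refine ⟨η / 2, by linarith, fun t => ?_⟩
  have hsmall : ∀ᶠ k in atTop, ∑ q ∈ Finset.range t, |toSeq (y k) q| ^ p < η / 4 := by
    have : Tendsto (fun k => ∑ q ∈ Finset.range t, |toSeq (y k) q| ^ p) atTop
        (𝓝 (∑ q ∈ Finset.range t, |(0 : ℝ)| ^ p)) :=
      tendsto_finsetSum _ fun q _ => ((h0 q).abs).rpow_const (Or.inr hp0.le)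
    simp only [abs_zero, Real.zero_rpow hp0.ne', Finset.sum_const_zero] at this
    exact this.eventually (gt_mem_nhds (by linarith))
  refine ((ht t).and_eventually hsmall).mono ?_
  rintro k ⟨hk, hks⟩
  set u := toSeq (y k) with hu
  have hmem : MemLorentz w p u := (y k).memLorentz
  obtain ⟨N₀, hN₀⟩ : ∃ N₀, 3 / 4 * η < ∑ m ∈ Finset.range N₀,
      decRearr u (m + t) ^ p * w.toFun (m + t) :=
    ((summable_rearr_tail hmem t).hasSum.tendsto_sum_nat.eventually
      (lt_mem_nhds (show 3 / 4 * η < _ by linarith))).exists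
  obtain ⟨σ, hσ, heq, -⟩ := exists_decRearr hmem.1 (t + N₀)
  filter_upwards [eventually_ge_atTop (t + N₀),
    eventually_gt_atTop (((Finset.range (t + N₀)).image σ).sup id)] with t' ht1 ht2
  have hIco : ∀ n ∈ Finset.Ico t (t + N₀), n ∈ Finset.range (t + N₀) := fun n hn =>
    Finset.mem_range.mpr (Finset.mem_Ico.mp hn).2
  have hsum : 3 / 4 * η < ∑ n ∈ Finset.Ico t (t + N₀), |u (σ n)| ^ p * w.toFun n := by
    refine hN₀.trans_eq ?_
    rw [Finset.sum_Ico_eq_sum_range, Nat.add_sub_cancel_left]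
    refine Finset.sum_congr rfl fun m hm => ?_
    rw [heq (t + m) (by simpa using hm), add_comm]
  rw [← Finset.sum_filter_add_sum_filter_not _ (fun n => σ n < t)] at hsum
  have hlow : ∑ n ∈ Finset.Ico t (t + N₀) with σ n < t, |u (σ n)| ^ p * w.toFun n ≤ η / 4 := by
    refine le_trans ?_ hks.le
    calc ∑ n ∈ Finset.Ico t (t + N₀) with σ n < t, |u (σ n)| ^ p * w.toFun n
        ≤ ∑ n ∈ Finset.Ico t (t + N₀) with σ n < t, |u (σ n)| ^ p :=
          Finset.sum_le_sum fun n _ => mul_le_of_le_one_right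
            (Real.rpow_nonneg (abs_nonneg _) _) (w.le_one n)
      _ = ∑ q ∈ (Finset.Ico t (t + N₀)).filter (fun n => σ n < t) |>.image σ, |u q| ^ p := by
          rw [Finset.sum_image]
          intro x hx y hy hxy
          exact hσ (hIco x (Finset.mem_filter.mp hx).1) (hIco y (Finset.mem_filter.mp hy).1) hxy
      _ ≤ _ := by
          refine Finset.sum_le_sum_of_subset_of_nonneg ?_ fun q _ _ =>
            Real.rpow_nonneg (abs_nonneg _) _
          intro q hq
          obtain ⟨n, hn, rfl⟩ := Finset.mem_image.mp hq
          exact Finset.mem_range.mpr (Finset.mem_filter.mp hn).2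
  refine ⟨(Finset.Ico t (t + N₀)).filter (fun n => ¬ σ n < t ∧ u (σ n) ≠ 0), σ, ?_, ?_, ?_⟩
  · intro x hx y hy hxy
    exact hσ (hIco x (Finset.mem_filter.mp hx).1) (hIco y (Finset.mem_filter.mp hy).1) hxy
  · intro n hn
    rw [Finset.mem_filter] at hn
    have hn1 := Finset.mem_Ico.mp hn.1
    have h3 : σ n ≤ ((Finset.range (t + N₀)).image σ).sup id :=
      Finset.le_sup (f := id) (Finset.mem_image_of_mem σ (hIco n hn.1))
    refine ⟨⟨hn1.1, by omega⟩, ⟨by omega, by omega⟩, hn.2.2⟩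
  · have : ∑ n ∈ (Finset.Ico t (t + N₀)).filter (fun n => ¬ σ n < t ∧ u (σ n) ≠ 0),
        |u (σ n)| ^ p * w.toFun n =
        ∑ n ∈ Finset.Ico t (t + N₀) with ¬ σ n < t, |u (σ n)| ^ p * w.toFun n := by
      refine Finset.sum_subset (fun n hn => ?_) fun n hn hn' => ?_
      · rw [Finset.mem_filter] at hn ⊢
        exact ⟨hn.1, hn.2.1⟩
      · rw [Finset.mem_filter] at hn hn'
        have : u (σ n) = 0 := by
          by_contra hne
          exact hn' ⟨hn.1, hn.2, hne⟩
        rw [this, abs_zero, Real.zero_rpow hp0.ne', zero_mul]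
    rw [this]
    linarith

end

/-! ### Gliding humps -/

/-- The recursion carries the last index used and the current left endpoint. The next index is
chosen first, then the right endpoint, which may depend on that index. -/
theorem exists_hump {R : ℕ → ℕ → ℕ → Prop} (h : ∀ t, ∃ᶠ k in atTop, ∀ᶠ t' in atTop, R t k t')
    (K : ℕ) : ∃ k t : ℕ → ℕ, StrictMono k ∧ StrictMono t ∧ (∀ j, K ≤ k j) ∧
      ∀ j, R (t j) (k j) (t (j + 1)) := by
  have hstep : ∀ s : ℕ × ℕ, ∃ s' : ℕ × ℕ, s.1 < s'.1 ∧ s.2 < s'.2 ∧ R s.2 s'.1 s'.2 := by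
    rintro ⟨k₀, t⟩
    obtain ⟨k, hk, hk0⟩ := ((h t).and_eventually (eventually_gt_atTop k₀)).exists
    obtain ⟨t', ht, ht0⟩ := (hk.and (eventually_gt_atTop t)).exists
    exact ⟨(k, t'), hk0, ht0, ht⟩
  choose next hnext using hstep
  set s : ℕ → ℕ × ℕ := fun j => next^[j] (K, 0) with hs
  have hsucc : ∀ j, s (j + 1) = next (s j) := fun j => Function.iterate_succ_apply' next j _
  have h1 : StrictMono fun j => (s j).1 := strictMono_nat_of_lt_succ fun j => by
    rw [hsucc]; exact (hnext _).1
  have h2 : StrictMono fun j => (s j).2 := strictMono_nat_of_lt_succ fun j => by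
    rw [hsucc]; exact (hnext _).2.1
  -- The shift reflects the order of choice: the j-th index is selected only after the j-th left
  -- endpoint is known.
  refine ⟨fun j => (s (j + 1)).1, fun j => (s j).2, fun i j hij => h1 (Nat.succ_lt_succ hij), h2,
    fun j => ?_, fun j => ?_⟩
  · exact h1.monotone (Nat.zero_le (j + 1))
  · change R (s j).2 (s (j + 1)).1 (s (j + 1)).2
    rw [hsucc]
    exact (hnext _).2.2

theorem disjoint_Ico_of_strictMono {t : ℕ → ℕ} (ht : StrictMono t) (m i j : ℕ)
    (hi : m ∈ Set.Ico (t i) (t (i + 1))) (hj : m ∈ Set.Ico (t j) (t (j + 1))) : i = j := by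
  have h1 : i < j + 1 := ht.lt_iff_lt.mp (hi.1.trans_lt hj.2)
  have h2 : j < i + 1 := ht.lt_iff_lt.mp (hj.1.trans_lt hi.2)
  omega

section

variable {w : LorentzWeight} {p : ℝ} [hp : Fact (1 ≤ p)]

theorem tendsto_norm_restrict_Iio {y : ℕ → LorentzSpace w p}
    (h0 : ∀ m, Tendsto (fun k => toSeq (y k) m) atTop (𝓝 0)) (t : ℕ) :
    Tendsto (fun k => ‖restrict (Set.Iio t) (y k)‖) atTop (𝓝 0) := by
  have heq : ∀ u : LorentzSpace w p, restrict (Set.Iio t) u =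
      ∑ m ∈ Finset.range t, toSeq u m • ofFinsupp w p (Finsupp.single m 1) := by
    intro u
    apply toSeq_injective
    funext n
    rw [toSeq_sum_smul, toSeq_restrict]
    simp only [toSeq_ofFinsupp, Finsupp.single_apply, mul_ite, mul_one, mul_zero]
    rw [Finset.sum_ite_eq']
    simp [Set.indicator_apply]
  have : Tendsto (fun k => ∑ m ∈ Finset.range t,
      toSeq (y k) m • ofFinsupp w p (Finsupp.single m 1)) atTop
      (𝓝 (∑ m ∈ Finset.range t, (0 : ℝ) • ofFinsupp w p (Finsupp.single m 1))) :=
    tendsto_finsetSum _ fun m _ => (h0 m).smul_const _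
  simp only [zero_smul, Finset.sum_const_zero] at this
  simpa only [heq, norm_zero] using this.norm

theorem norm_sub_restrict_Ico_le (u : LorentzSpace w p) {t t' : ℕ} (h : t ≤ t') :
    ‖u - restrict (Set.Ico t t') u‖ ≤ ‖restrict (Set.Iio t) u‖ + ‖restrict (Set.Ici t') u‖ := by
  have : u - restrict (Set.Ico t t') u = restrict (Set.Iio t) u + restrict (Set.Ici t') u := by
    rw [sub_eq_iff_eq_add]
    apply toSeq_injective
    funext n
    simp only [map_add, Pi.add_apply, toSeq_restrict, Set.indicator_apply, Set.mem_Iio,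
      Set.mem_Ici, Set.mem_Ico]
    by_cases h1 : n < t
    · have h2 : ¬ t' ≤ n := by omega
      have h3 : ¬ t ≤ n := by omega
      simp [h1, h2, h3]
    · by_cases h2 : t' ≤ n
      · have h3 : ¬ n < t' := by omega
        simp [h1, h2, h3]
      · have h3 : n < t' := by omega
        have h4 : t ≤ n := by omega
        simp [h1, h2, h3, h4]
  rw [this]
  exact norm_add_le _ _

theorem eventually_norm_sub_restrict_Ico_le {y : ℕ → LorentzSpace w p}
    (h0 : ∀ m, Tendsto (fun k => toSeq (y k) m) atTop (𝓝 0)) {η : ℝ} (hη : 0 < η) (t : ℕ) :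
    ∀ᶠ k in atTop, ∀ᶠ t' in atTop, ‖y k - restrict (Set.Ico t t') (y k)‖ ≤ η := by
  filter_upwards [(tendsto_norm_restrict_Iio h0 t).eventually_le_const (half_pos hη)] with k hk
  have h2 : Tendsto (fun t' : ℕ => ‖restrict (Set.Ici t') (y k)‖) atTop (𝓝 0) :=
    tendsto_lorentzNorm_tail hp.out (y k).memLorentz
  filter_upwards [h2.eventually_le_const (half_pos hη), eventually_ge_atTop t] with t' ht1 ht2
  refine (norm_sub_restrict_Ico_le _ ht2).trans ?_
  linarith

end

/-! ### Classification of the spreading models of direct sums of Lorentz spaces -/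

/-- Passing to blocks costs a factor 1 + δ and an error proportional to δ times the ℓ₁ norm of the
coefficients. For fixed coefficients both disappear in the limit, so the estimates for blocks pass
to the spreading model with no loss of constant. -/
theorem le_of_forall_pos_one_add_mul {x u v : ℝ} (h : ∀ δ > 0, x ≤ (1 + δ) * (u + δ * v)) :
    x ≤ u := by
  have ht : Tendsto (fun δ : ℝ => (1 + δ) * (u + δ * v)) (𝓝[>] 0) (𝓝 ((1 + 0) * (u + 0 * v))) := by
    refine Tendsto.mono_left ?_ nhdsWithin_le_nhds
    exact (Continuous.tendsto (by fun_prop) 0)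
  rw [add_zero, one_mul, zero_mul, add_zero] at ht
  exact ge_of_tendsto ht (by filter_upwards [self_mem_nhdsWithin] with δ hδ using h δ hδ)

theorem Generates.comp_strictMono {X : Type*} [NormedAddCommGroup X] [NormedSpace ℝ X]
    {x : ℕ → X} {N : Seminorm ℝ (ℕ →₀ ℝ)} (h : Generates x N) {φ : ℕ → ℕ} (hφ : StrictMono φ) :
    Generates (fun k => x (φ k)) N := by
  obtain ⟨ε, h1, h2, h3⟩ := h
  refine ⟨ε, h1, h2, fun n a ha k hk hkn => h3 n a ha (fun j => φ (k j)) (hφ.comp hk) fun j => ?_⟩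
  have h4 := hφ.le_apply (x := k j)
  have := hkn j
  omega

/-- The defining inequalities concern coefficients in [-1,1]; homogeneity extends them to all
finitely supported coefficients, and a large n makes the distortion at most 1 + δ. -/
theorem Generates.approx {X : Type*} [NormedAddCommGroup X] [NormedSpace ℝ X]
    {x : ℕ → X} {N : Seminorm ℝ (ℕ →₀ ℝ)} (h : Generates x N) (a : ℕ →₀ ℝ) {δ : ℝ} (hδ : 0 < δ) :
    ∃ K, ∀ k : ℕ → ℕ, StrictMono k → (∀ j, K ≤ k j) →
      N a ≤ (1 + δ) * ‖∑ j ∈ a.support, a j • x (k j)‖ ∧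
      ‖∑ j ∈ a.support, a j • x (k j)‖ ≤ (1 + δ) * N a := by
  obtain ⟨ε, hε, hε0, hN⟩ := h
  have hεnn : ∀ n, 0 ≤ ε n := fun n => hε.le_of_tendsto hε0 n
  obtain ⟨n, hn1, hn2⟩ := ((hε0.eventually_le_const hδ).and
    (eventually_ge_atTop (a.support.sup id + 1))).exists
  -- A scale at least as large as every coefficient; the added 1 keeps it positive when `a = 0`.
  set B : ℝ := 1 + ∑ j ∈ a.support, |a j| with hB
  have hB0 : 0 < B := by
    have : 0 ≤ ∑ j ∈ a.support, |a j| := Finset.sum_nonneg fun _ _ => abs_nonneg _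
    linarith
  have hsub : a.support ⊆ Finset.range n := fun j hj => by
    have : j ≤ a.support.sup id := Finset.le_sup (f := id) hj
    exact Finset.mem_range.mpr (by omega)
  have hle : ∀ j, |B⁻¹ * a j| ≤ 1 := by
    intro j
    rw [abs_mul, abs_of_pos (inv_pos.mpr hB0), inv_mul_le_iff₀ hB0, mul_one]
    by_cases hj : j ∈ a.support
    · have := Finset.single_le_sum (f := fun j => |a j|) (fun _ _ => abs_nonneg _) hj
      linarith
    · rw [Finsupp.notMem_support_iff.mp hj, abs_zero]; exact hB0.le
  have hvec : ∑ j : Fin n, Finsupp.single (j : ℕ) (B⁻¹ * a j) = B⁻¹ • a := by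
    rw [Fin.sum_univ_eq_sum_range (fun j => Finsupp.single j (B⁻¹ * a j)) n]
    conv_rhs => rw [← a.sum_single, Finsupp.sum, Finset.smul_sum]
    simp only [Finsupp.smul_single, smul_eq_mul]
    refine (Finset.sum_subset hsub fun j _ hj => ?_).symm
    rw [Finsupp.notMem_support_iff.mp hj]; simp
  refine ⟨n, fun k hk hkn => ?_⟩
  have hmain := hN n (fun j => B⁻¹ * a j) (fun j => hle j) (fun j => k j)
    (fun i j hij => hk hij) (fun j => (hkn j).trans (Nat.le_succ _))
  have hx : ∑ j : Fin n, (B⁻¹ * a j) • x (k j) = B⁻¹ • ∑ j ∈ a.support, a j • x (k j) := by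
    rw [Fin.sum_univ_eq_sum_range (fun j => (B⁻¹ * a j) • x (k j)) n, Finset.smul_sum]
    simp only [← mul_smul]
    refine (Finset.sum_subset hsub fun j _ hj => ?_).symm
    rw [Finsupp.notMem_support_iff.mp hj]; simp
  rw [hvec, hx, map_smul_eq_mul, norm_smul, Real.norm_of_nonneg (inv_pos.mpr hB0).le] at hmain
  obtain ⟨h1, h2⟩ := hmain
  have hnn := norm_nonneg (∑ j ∈ a.support, a j • x (k j))
  have hNn := apply_nonneg N a
  have hpos : 0 < 1 + ε n := by linarith [hεnn n]
  have hBi := inv_pos.mpr hB0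
  constructor
  · rw [inv_mul_le_iff₀ hpos, mul_left_comm, mul_le_mul_iff_right₀ hBi] at h1
    exact h1.trans (mul_le_mul_of_nonneg_right (by linarith) hnn)
  · rw [mul_left_comm, mul_le_mul_iff_right₀ hBi] at h2
    exact h2.trans (mul_le_mul_of_nonneg_right (by linarith) hNn)

section

variable {n : ℕ} {W : Fin n → LorentzWeight} {p : ℝ} [hp : Fact (1 ≤ p)]

theorem sum_smul_pi_apply (a : ℕ →₀ ℝ) (y : ℕ → ∀ i, LorentzSpace (W i) p) (i : Fin n) :
    (∑ j ∈ a.support, a j • y j) i = ∑ j ∈ a.support, a j • y j i := by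
  rw [Finset.sum_apply]
  rfl

/-- A spreading model is computed by arbitrarily sparse disjoint blocks. -/
theorem Generates.exists_blocks {y : ℕ → ∀ i, LorentzSpace (W i) p} {N : Seminorm ℝ (ℕ →₀ ℝ)}
    (hg : Generates y N) (h0 : ∀ i m, Tendsto (fun k => toSeq (y k i) m) atTop (𝓝 0))
    {R : ℕ → ℕ → ℕ → Prop} (hR : ∀ t, ∃ᶠ k in atTop, ∀ᶠ t' in atTop, R t k t')
    (a : ℕ →₀ ℝ) {δ : ℝ} (hδ : 0 < δ) (K : ℕ) :
    ∃ k t : ℕ → ℕ, StrictMono t ∧ (∀ j, K ≤ k j) ∧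
      (∀ j, R (t j) (k j) (t (j + 1))) ∧
      N a ≤ (1 + δ) * ‖∑ j ∈ a.support, a j • y (k j)‖ ∧
      ‖∑ j ∈ a.support, a j • y (k j)‖ ≤ (1 + δ) * N a ∧
      ∀ i, ‖∑ j ∈ a.support, a j • y (k j) i -
        ∑ j ∈ a.support, a j • restrict (Set.Ico (t j) (t (j + 1))) (y (k j) i)‖ ≤
        δ * ∑ j ∈ a.support, |a j| := by
  obtain ⟨K₁, hK₁⟩ := hg.approx a hδ
  have hR' : ∀ t, ∃ᶠ k in atTop, ∀ᶠ t' in atTop, R t k t' ∧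
      ∀ i, ‖y k i - restrict (Set.Ico t t') (y k i)‖ ≤ δ := by
    intro t
    have hev : ∀ᶠ k in atTop, ∀ i, ∀ᶠ t' in atTop,
        ‖y k i - restrict (Set.Ico t t') (y k i)‖ ≤ δ :=
      eventually_all.mpr fun i => eventually_norm_sub_restrict_Ico_le (h0 i) hδ t
    refine ((hR t).and_eventually hev).mono ?_
    rintro k ⟨h1, h2⟩
    exact h1.and (eventually_all.mpr h2)
  obtain ⟨k, t, hk, ht, hKk, hRk⟩ := exists_hump hR' (max K K₁)
  obtain ⟨h1, h2⟩ := hK₁ k hk fun j => (le_max_right _ _).trans (hKk j)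
  refine ⟨k, t, ht, fun j => (le_max_left _ _).trans (hKk j), fun j => (hRk j).1, h1, h2,
    fun i => ?_⟩
  rw [← Finset.sum_sub_distrib]
  simp only [← smul_sub]
  exact norm_sum_smul_le a fun j => (hRk j).2 i

/-- In each component the blocks are disjoint of norm at most 1, so the upper p-estimate applies
with constant 1. -/
theorem Generates.le_lpNorm {y : ℕ → ∀ i, LorentzSpace (W i) p} {N : Seminorm ℝ (ℕ →₀ ℝ)}
    (hg : Generates y N) (h0 : ∀ i m, Tendsto (fun k => toSeq (y k i) m) atTop (𝓝 0))
    (h1 : ∀ k, ‖y k‖ = 1) (a : ℕ →₀ ℝ) : N a ≤ lpNorm p a := by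
  have hsn : 0 ≤ ∑ j ∈ a.support, |a j| := Finset.sum_nonneg fun _ _ => abs_nonneg _
  refine le_of_forall_pos_one_add_mul (v := ∑ j ∈ a.support, |a j|) fun δ hδ => ?_
  obtain ⟨k, t, ht, -, -, hN, -, hb⟩ := hg.exists_blocks h0 (R := fun _ _ _ => True)
    (fun t => by simpa using atTop_neBot) a hδ 0
  refine hN.trans (mul_le_mul_of_nonneg_left ?_ (by linarith))
  rw [pi_norm_le_iff_of_nonneg (add_nonneg (lpNorm_nonneg p a) (mul_nonneg hδ.le hsn))]
  intro i
  rw [sum_smul_pi_apply]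
  refine (norm_le_norm_add_norm_sub' _ _).trans (add_le_add ?_ (hb i))
  refine (isDisjoint_restrict _ (disjoint_Ico_of_strictMono ht)).norm_sum_le (fun j => ?_) a
  exact (norm_restrict_le _ _).trans ((norm_le_pi_norm _ i).trans_eq (h1 _))

theorem Generates.lorentzNorm_le {y : ℕ → ∀ i, LorentzSpace (W i) p} {N : Seminorm ℝ (ℕ →₀ ℝ)}
    (hg : Generates y N) (h0 : ∀ i m, Tendsto (fun k => toSeq (y k i) m) atTop (𝓝 0))
    (i : Fin n) {c : ℝ} (hc : 0 < c) (hy : ∃ᶠ k in atTop, ∃ m, c ≤ |toSeq (y k i) m|)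
    (a : ℕ →₀ ℝ) : c * lorentzNorm (W i) p a ≤ N a := by
  refine le_of_forall_pos_one_add_mul (v := ∑ j ∈ a.support, |a j|) fun δ hδ => ?_
  have hsn : 0 ≤ ∑ j ∈ a.support, |a j| := Finset.sum_nonneg fun _ _ => abs_nonneg _
  obtain ⟨k, t, ht, -, hR, -, hN, hb⟩ := hg.exists_blocks h0
    (R := fun t k t' => ∃ m ∈ Set.Ico t t', c ≤ |toSeq (y k i) m|)
    -- For large `k` the coordinates below `t` are smaller than `c`, so the large coordinate lies
    -- beyond `t` and is captured by the block.
    (fun t => by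
      have hev : ∀ᶠ k in atTop, ∀ m ∈ Finset.range t, |toSeq (y k i) m| < c := by
        rw [Filter.eventually_all_finset]
        intro m _
        have := (h0 i m).abs
        rw [abs_zero] at this
        exact this.eventually (gt_mem_nhds hc)
      refine (hy.and_eventually hev).mono ?_
      rintro k ⟨⟨m, hm⟩, hk⟩
      filter_upwards [eventually_gt_atTop m] with t' ht'
      refine ⟨m, ⟨?_, ht'⟩, hm⟩
      by_contra hlt
      exact absurd (hk m (Finset.mem_range.mpr (not_le.mp hlt))) (not_lt.mpr hm)) a hδ 0
  choose m hm hcm using hR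
  have h1 := (isDisjoint_restrict (fun j => y (k j) i)
    (disjoint_Ico_of_strictMono ht)).le_norm_sum_of_coord hc m (fun j => by
      rw [toSeq_restrict, Set.indicator_of_mem (hm j)]; exact hcm j) a
  have h2 := norm_le_pi_norm (∑ j ∈ a.support, a j • y (k j)) i
  rw [sum_smul_pi_apply] at h2
  have h3 := norm_le_norm_add_norm_sub (∑ j ∈ a.support, a j • y (k j) i)
    (∑ j ∈ a.support, a j • restrict (Set.Ico (t j) (t (j + 1))) (y (k j) i))
  have h4 := hb i
  nlinarith [mul_nonneg hδ.le (mul_nonneg hδ.le hsn)]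

/-- Each block carries mass η on rearrangement positions inside its own interval. Concatenating
these placements makes the p-th powers add up, which is a lower ℓ_p estimate. -/
theorem Generates.exists_lpNorm_le {y : ℕ → ∀ i, LorentzSpace (W i) p} {N : Seminorm ℝ (ℕ →₀ ℝ)}
    (hg : Generates y N) (h0 : ∀ i m, Tendsto (fun k => toSeq (y k i) m) atTop (𝓝 0))
    (i : Fin n) (hy : ¬ UniformTails fun k => y k i) :
    ∃ c > 0, ∀ a, c * lpNorm p a ≤ N a := by
  have hp0 : 0 < p := by linarith [hp.out]
  obtain ⟨η, hη, hpos⟩ := not_uniformTails_positions hy (h0 i)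
  refine ⟨η ^ (1 / p), Real.rpow_pos_of_pos hη _, fun a => ?_⟩
  refine le_of_forall_pos_one_add_mul (v := ∑ j ∈ a.support, |a j|) fun δ hδ => ?_
  have hsn : 0 ≤ ∑ j ∈ a.support, |a j| := Finset.sum_nonneg fun _ _ => abs_nonneg _
  obtain ⟨k, t, ht, -, hR, -, hN, hb⟩ := hg.exists_blocks h0 hpos a hδ 0
  choose I σ hσ hI hsum using hR
  have hr : ∀ j, ∀ m ∈ I j, toSeq (restrict (Set.Ico (t j) (t (j + 1))) (y (k j) i)) (σ j m) =
      toSeq (y (k j) i) (σ j m) := fun j m hm => by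
    rw [toSeq_restrict, Set.indicator_of_mem (hI j m hm).2.1]
  have h1 := (isDisjoint_restrict (fun j => y (k j) i)
    (disjoint_Ico_of_strictMono ht)).le_norm_sum_of_positions (fun _ => η) I
    (fun m i' j hi hj => disjoint_Ico_of_strictMono ht m i' j (hI _ _ hi).1 (hI _ _ hj).1)
    σ hσ (fun j m hm => by rw [hr j m hm]; exact (hI j m hm).2.2) a (fun j _ => by
      refine (hsum j).trans_eq (Finset.sum_congr rfl fun m hm => ?_)
      rw [hr j m hm])
  rw [← Finset.sum_mul, ← lpNorm_rpow hp.out, mul_comm] at h1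
  have h1' : η ^ (1 / p) * lpNorm p a ≤
      ‖∑ j ∈ a.support, a j • restrict (Set.Ico (t j) (t (j + 1))) (y (k j) i)‖ := by
    refine (Real.rpow_le_rpow_iff (mul_nonneg (Real.rpow_nonneg hη.le _) (lpNorm_nonneg p a))
      (norm_nonneg _) hp0).mp ?_
    rwa [Real.mul_rpow (Real.rpow_nonneg hη.le _) (lpNorm_nonneg p a), one_div,
      Real.rpow_inv_rpow hη.le hp0.ne']
  have h2 := norm_le_pi_norm (∑ j ∈ a.support, a j • y (k j)) i
  rw [sum_smul_pi_apply] at h2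
  have h3 := norm_le_norm_add_norm_sub (∑ j ∈ a.support, a j • y (k j) i)
    (∑ j ∈ a.support, a j • restrict (Set.Ico (t j) (t (j + 1))) (y (k j) i))
  have h4 := hb i
  nlinarith [mul_nonneg hδ.le (mul_nonneg hδ.le hsn)]

/-- Components outside `A` tend to 0 in norm. For the others the tensor estimate
`UniformTails.norm_sum_restrict_le` applies and supplies the constant 2. -/
theorem Generates.le_sup_lorentzSeminorm
    (hW : ∀ i j m, (W i).partialSum (j * m) ≤ (W i).partialSum j * (W i).partialSum m)
    {y : ℕ → ∀ i, LorentzSpace (W i) p} {N : Seminorm ℝ (ℕ →₀ ℝ)}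
    (hg : Generates y N) (h0 : ∀ i m, Tendsto (fun k => toSeq (y k i) m) atTop (𝓝 0))
    (h1 : ∀ k, ‖y k‖ = 1) {f : Fin n → ℕ → ℝ}
    (hf : ∀ i m, Tendsto (fun k => decRearr (toSeq (y k i)) m) atTop (𝓝 (f i m)))
    (ht : ∀ i, UniformTails fun k => y k i) {A : Finset (Fin n)} (hA : ∀ i, i ∉ A → f i 0 = 0)
    (a : ℕ →₀ ℝ) : N a ≤ 2 * A.sup (fun i => lorentzSeminorm (W i) p) a := by
  have hsn : 0 ≤ ∑ j ∈ a.support, |a j| := Finset.sum_nonneg fun _ _ => abs_nonneg _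
  -- The factor 2 leaves room for two errors: the truncation to blocks and the discarded tails of
  -- the rearrangements.
  refine le_of_forall_pos_one_add_mul (v := 2 * ∑ j ∈ a.support, |a j|) fun δ hδ => ?_
  have hy1 : ∀ i k, ‖y k i‖ ≤ 1 := fun i k => (norm_le_pi_norm _ i).trans_eq (h1 k)
  have hu := fun i => (ht i).norm_sum_restrict_le (hW i) (hy1 i) (hf i) hδ
  choose K hK using hu
  have hz : ∀ᶠ k in atTop, ∀ i, i ∉ A → ‖y k i‖ ≤ δ := by
    rw [Filter.eventually_all]
    intro i
    by_cases hi : i ∈ A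
    · simp [hi]
    · have := (ht i).tendsto_norm (by rw [← hA i hi]; exact hf i 0)
      filter_upwards [this.eventually_le_const hδ] with k hk _ using hk
  obtain ⟨K', hK'⟩ := eventually_atTop.mp hz
  obtain ⟨k, t, htm, hKk, -, hN, -, hb⟩ := hg.exists_blocks h0 (R := fun _ _ _ => True)
    (fun t => by simpa using atTop_neBot) a hδ (K' + ∑ i, K i)
  refine hN.trans (mul_le_mul_of_nonneg_left ?_ (by linarith))
  have hsup : 0 ≤ A.sup (fun i => lorentzSeminorm (W i) p) a := apply_nonneg _ _
  rw [pi_norm_le_iff_of_nonneg (by positivity)]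
  intro i
  rw [sum_smul_pi_apply]
  by_cases hi : i ∈ A
  · have hKi : ∀ j, K i ≤ k j := fun j => by
      have := Finset.single_le_sum (f := K) (fun _ _ => Nat.zero_le _) (Finset.mem_univ i)
      have := hKk j
      omega
    have h2 := hK i a k hKi _ (disjoint_Ico_of_strictMono htm)
    have h3 : lorentzNorm (W i) p a ≤ A.sup (fun i => lorentzSeminorm (W i) p) a :=
      Finset.le_sup (f := fun i => lorentzSeminorm (W i) p) hi a
    refine (norm_le_norm_add_norm_sub' _ _).trans ((add_le_add h2 (hb i)).trans ?_)
    linarith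
  · have h2 := norm_sum_smul_le a (v := fun j => y (k j) i) (η := δ)
      fun j => hK' _ (by have := hKk j; omega) i hi
    refine h2.trans ?_
    nlinarith [mul_nonneg hδ.le hsn]

/-- It excludes N = 0, hence the empty maximum in the classification. -/
theorem Generates.one_le_two_mul_apply_single {X : Type*} [NormedAddCommGroup X] [NormedSpace ℝ X]
    {x : ℕ → X} {N : Seminorm ℝ (ℕ →₀ ℝ)} (h : Generates x N) (h1 : ∀ k, ‖x k‖ = 1) :
    1 ≤ 2 * N (Finsupp.single 0 1) := by
  obtain ⟨K, hK⟩ := h.approx (Finsupp.single 0 1) one_pos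
  have := (hK (fun j => K + j) (fun i j hij => by simpa using hij) (fun j => by omega)).2
  rw [Finsupp.support_single (0 : ℕ) (one_ne_zero (α := ℝ)), Finset.sum_singleton,
    Finsupp.single_eq_same, one_smul, h1] at this
  linarith

/-- Every spreading model of a direct sum of Lorentz spaces with submultiplicative fundamental
functions is equivalent to `ℓ_p` or to a maximum of some of the Lorentz norms. -/
theorem Generates.classification
    (hW : ∀ i j m, (W i).partialSum (j * m) ≤ (W i).partialSum j * (W i).partialSum m)
    {x : ℕ → ∀ i, LorentzSpace (W i) p} {N : Seminorm ℝ (ℕ →₀ ℝ)}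
    (hg : Generates x N) (hw : IsWeaklyNull x) (h1 : ∀ k, ‖x k‖ = 1) :
    (DominatedBy N (lpNorm p) ∧ DominatedBy (lpNorm p) N) ∨
    ∃ A : Finset (Fin n), A.Nonempty ∧
      DominatedBy N (A.sup fun i => lorentzSeminorm (W i) p : Seminorm ℝ (ℕ →₀ ℝ)) ∧
      DominatedBy (A.sup fun i => lorentzSeminorm (W i) p : Seminorm ℝ (ℕ →₀ ℝ)) N := by
  have hx0 : ∀ i m, Tendsto (fun k => toSeq (x k i) m) atTop (𝓝 0) := fun i m =>
    hw ((LorentzSpace.coord (W i) p m).comp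
      (ContinuousLinearMap.proj (R := ℝ) (φ := fun i => LorentzSpace (W i) p) i))
  -- All the rearrangements lie in a cube that is compact for pointwise convergence, so one
  -- subsequence serves every component and every position.
  have hcomp : IsCompact (Set.Icc (0 : Fin n → ℕ → ℝ) 1) := isCompact_Icc
  obtain ⟨f, -, φ, hφ, hlim⟩ := hcomp.tendsto_subseq
    (x := fun k i m => decRearr (toSeq (x k i)) m) (fun k => ⟨fun i m => decRearr_nonneg _ _,
      fun i m => decRearr_le (F := ∅) (by simp) zero_le_one fun q _ =>
        (abs_toSeq_le (x k i) q).trans ((norm_le_pi_norm _ i).trans_eq (h1 k))⟩)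
  have hf : ∀ i m, Tendsto (fun k => decRearr (toSeq (x (φ k) i)) m) atTop (𝓝 (f i m)) :=
    fun i m => tendsto_pi_nhds.mp (tendsto_pi_nhds.mp hlim i) m
  have hy0 : ∀ i m, Tendsto (fun k => toSeq (x (φ k) i) m) atTop (𝓝 0) := fun i m =>
    (hx0 i m).comp hφ.tendsto_atTop
  have hgy := hg.comp_strictMono hφ
  have hy1 : ∀ k, ‖x (φ k)‖ = 1 := fun k => h1 _
  by_cases ht : ∀ i, UniformTails fun k => x (φ k) i
  · right
    -- The components whose largest coordinate does not vanish in the limit.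
    set A : Finset (Fin n) := Finset.univ.filter fun i => f i 0 ≠ 0 with hAdef
    have hup := hgy.le_sup_lorentzSeminorm hW hy0 hy1 hf ht (A := A)
      (fun i hi => by simpa [hAdef] using hi)
    refine ⟨A, ?_, ⟨2, hup⟩, ?_⟩
    · rw [Finset.nonempty_iff_ne_empty]
      intro hA
      have h2 := hup (Finsupp.single 0 1)
      rw [hA, Finset.sup_empty] at h2
      have h3 := hgy.one_le_two_mul_apply_single hy1
      have h4 : (⊥ : Seminorm ℝ (ℕ →₀ ℝ)) (Finsupp.single 0 1) = 0 := rfl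
      rw [h4] at h2
      linarith
    · have hlow : ∀ i ∈ A, ∃ c > 0, ∀ a : ℕ →₀ ℝ, c * lorentzNorm (W i) p a ≤ N a := by
        intro i hi
        have hfi : f i 0 ≠ 0 := by simpa [hAdef] using hi
        have hpos : 0 < f i 0 :=
          lt_of_le_of_ne (ge_of_tendsto' (hf i 0) fun k => decRearr_nonneg _ _) hfi.symm
        refine ⟨f i 0 / 2, by linarith, fun a =>
          hgy.lorentzNorm_le hy0 i (by linarith) (Eventually.frequently ?_) a⟩
        filter_upwards [(hf i 0).eventually (lt_mem_nhds (half_lt_self hpos))] with k hk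
        obtain ⟨σ, -, heq, -⟩ := exists_decRearr (x (φ k) i).memLorentz.1 1
        refine ⟨σ 0, ?_⟩
        rw [heq 0 (by simp)]
        exact hk.le
      choose! c hc hcN using hlow
      refine ⟨∑ i ∈ A, (c i)⁻¹, fun a => ?_⟩
      have hci : ∀ i ∈ A, 0 ≤ (c i)⁻¹ := fun i hi => (inv_pos.mpr (hc i hi)).le
      refine Seminorm.finset_sup_apply_le (mul_nonneg (Finset.sum_nonneg hci) (apply_nonneg _ _))
        fun i hi => ?_
      rw [lorentzSeminorm_apply]
      calc lorentzNorm (W i) p a ≤ (c i)⁻¹ * N a := by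
            rw [← div_eq_inv_mul, le_div_iff₀ (hc i hi), mul_comm]
            exact hcN i hi a
        _ ≤ _ := mul_le_mul_of_nonneg_right (Finset.single_le_sum hci hi) (apply_nonneg _ _)
  · left
    push Not at ht
    obtain ⟨i, hi⟩ := ht
    obtain ⟨c, hc, hcN⟩ := hgy.exists_lpNorm_le hy0 i hi
    refine ⟨⟨1, fun a => by rw [one_mul]; exact hgy.le_lpNorm hy0 hy1 a⟩, ⟨c⁻¹, fun a => ?_⟩⟩
    rw [← div_eq_inv_mul, le_div_iff₀ hc, mul_comm]
    exact hcN a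

end

/-! ### Disjoint sequences are basic and weakly null -/

/-- The partial sum operators are contractive on the span by `hC`, hence on its closure by
continuity. They fix each vector of the span eventually, so by density they converge to the identity
on the closure. -/
theorem isBasicSequence_of_biorthogonal {X : Type*} [NormedAddCommGroup X] [NormedSpace ℝ X]
    {u : ℕ → X} (f : ℕ → StrongDual ℝ X) (hf : ∀ i j, f i (u j) = if i = j then 1 else 0)
    (hC : ∀ (a : ℕ →₀ ℝ) (n : ℕ),
      ‖∑ i ∈ Finset.range n, a i • u i‖ ≤ ‖∑ i ∈ a.support, a i • u i‖) :
    IsBasicSequence u := by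
  classical
  set V := (Submodule.span ℝ (Set.range u)).topologicalClosure with hV
  have hsub : Submodule.span ℝ (Set.range u) ≤ V := Submodule.le_topologicalClosure _
  set P : ℕ → X →L[ℝ] X := fun n => ∑ i ∈ Finset.range n, (f i).smulRight (u i) with hP
  have hPapp : ∀ n x, P n x = ∑ i ∈ Finset.range n, f i x • u i := fun n x => by
    simp [hP, ContinuousLinearMap.smulRight_apply]
  have hcoef : ∀ (c : ℕ →₀ ℝ) i, f i (∑ j ∈ c.support, c j • u j) = c i := by
    intro c i
    rw [map_sum]
    simp only [map_smul, hf, smul_eq_mul, mul_ite, mul_one, mul_zero, Finset.sum_ite_eq]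
    split_ifs with h
    · rfl
    · exact (Finsupp.notMem_support_iff.mp h).symm
  have hspan : ∀ x ∈ Submodule.span ℝ (Set.range u), ∃ c : ℕ →₀ ℝ,
      x = ∑ j ∈ c.support, c j • u j := by
    intro x hx
    obtain ⟨c, hc⟩ := Finsupp.mem_span_range_iff_exists_finsupp.mp hx
    exact ⟨c, hc.symm⟩
  have hPspan : ∀ n, ∀ x ∈ Submodule.span ℝ (Set.range u), ‖P n x‖ ≤ ‖x‖ := by
    intro n x hx
    obtain ⟨c, rfl⟩ := hspan x hx
    rw [hPapp]
    simp only [hcoef]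
    exact hC c n
  have hPV : ∀ n, ∀ x ∈ V, ‖P n x‖ ≤ ‖x‖ := by
    intro n x hx
    have hcl : IsClosed {x : X | ‖P n x‖ ≤ ‖x‖} :=
      isClosed_le (P n).continuous.norm continuous_norm
    exact closure_minimal (hPspan n) hcl hx
  have hPtend : ∀ x ∈ V, Tendsto (fun n => P n x) atTop (𝓝 x) := by
    intro x hx
    rw [Metric.tendsto_atTop]
    intro ε hε
    obtain ⟨y, hy, hxy⟩ := Metric.mem_closure_iff.mp hx (ε / 2) (by linarith)
    obtain ⟨c, hc⟩ := hspan y hy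
    refine ⟨c.support.sup id + 1, fun n hn => ?_⟩
    have hPy : P n y = y := by
      rw [hPapp]
      have h1 : ∀ i, f i y = c i := fun i => by rw [hc, hcoef]
      simp only [h1]
      rw [hc]
      refine (Finset.sum_subset (fun j hj => ?_) fun j _ hj => ?_).symm
      · have : j ≤ c.support.sup id := Finset.le_sup (f := id) hj
        exact Finset.mem_range.mpr (by omega)
      · rw [Finsupp.notMem_support_iff.mp hj, zero_smul]
    have h2 : P n x - x = P n (x - y) + (y - x) := by rw [map_sub, hPy]; abel
    rw [dist_eq_norm] at hxy ⊢
    rw [h2]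
    calc ‖P n (x - y) + (y - x)‖ ≤ ‖P n (x - y)‖ + ‖y - x‖ := norm_add_le _ _
      _ ≤ ‖x - y‖ + ‖x - y‖ :=
        add_le_add (hPV n _ (V.sub_mem hx (hsub hy))) (norm_sub_rev _ _).le
      _ < ε := by linarith
  refine ⟨{ basis := fun i => ⟨u i, hsub (Submodule.subset_span ⟨i, rfl⟩)⟩
            coord := fun i => (f i).comp V.subtypeL
            ortho := fun i j => ?_
            expansion := fun x => ?_ }, fun i => rfl⟩
  · change f i (u j) = _
    rw [hf]
    by_cases h : i = j
    · subst h; simp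
    · simp [h, Pi.single, Function.update]
  -- The expansion converges conditionally: only partial sums over initial ranges are required to
  -- converge.
  · rw [HasSum, SummationFilter.conditional_filter_eq_map_range, tendsto_map'_iff, tendsto_subtype_rng]
    refine (hPtend x x.2).congr fun n => ?_
    rw [hPapp]
    simp

/-- If |f(u_k)| ≥ ε for infinitely many k, a signed sum of m such vectors gives mε ≤ ‖f‖ m^(1/p),
which fails for large m because p > 1. -/
theorem isWeaklyNull_of_norm_sum_le {X : Type*} [NormedAddCommGroup X] [NormedSpace ℝ X]
    {u : ℕ → X} {p : ℝ} (hp : 1 < p)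
    (h : ∀ a : ℕ →₀ ℝ, ‖∑ j ∈ a.support, a j • u j‖ ≤ lpNorm p a) : IsWeaklyNull u := by
  classical
  intro f
  by_contra hnt
  rw [Metric.tendsto_atTop] at hnt
  push Not at hnt
  obtain ⟨ε, hε, hfreq⟩ := hnt
  have hinf : {k | ε ≤ |f (u k)|}.Infinite := by
    rw [← Nat.frequently_atTop_iff_infinite, Filter.frequently_atTop]
    intro a
    obtain ⟨b, hb, hb'⟩ := hfreq a
    rw [Real.dist_eq, sub_zero] at hb'
    exact ⟨b, hb, hb'⟩
  have hp0 : 0 < p := by linarith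
  have hbound : ∀ m : ℕ, m * ε ≤ ‖f‖ * (m : ℝ) ^ (1 / p) := by
    intro m
    obtain ⟨F, hF, hFm⟩ := hinf.exists_subset_card_eq m
    set g : ℕ → ℝ := fun k => if k ∈ F then (SignType.sign (f (u k)) : ℝ) else 0 with hg
    set a : ℕ →₀ ℝ := Finsupp.onFinset F g (fun k hk => by
      by_contra h'; simp [hg, h'] at hk) with ha
    have hsub : a.support ⊆ F := Finsupp.support_onFinset_subset
    have haF : ∀ k ∈ F, a k = (SignType.sign (f (u k)) : ℝ) := fun k hk => by
      simp [ha, hg, hk]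
    have h1 : f (∑ j ∈ a.support, a j • u j) = ∑ j ∈ F, |f (u j)| := by
      rw [map_sum, Finset.sum_subset hsub fun j _ hj => by
        rw [Finsupp.notMem_support_iff.mp hj, zero_smul, map_zero]]
      refine Finset.sum_congr rfl fun j hj => ?_
      rw [map_smul, haF j hj, smul_eq_mul, sign_mul_self]
    have h2 : m * ε ≤ ∑ j ∈ F, |f (u j)| := by
      rw [← hFm, ← nsmul_eq_mul, ← Finset.sum_const]
      exact Finset.sum_le_sum fun j hj => hF hj
    have h3 : lpNorm p a ≤ (m : ℝ) ^ (1 / p) := by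
      rw [lpNorm_eq_sum hp0 a hsub]
      refine Real.rpow_le_rpow (Finset.sum_nonneg fun _ _ => Real.rpow_nonneg (abs_nonneg _) _) ?_
        (by positivity)
      rw [← hFm, ← mul_one (F.card : ℝ), ← nsmul_eq_mul, ← Finset.sum_const]
      refine Finset.sum_le_sum fun j hj => ?_
      refine Real.rpow_le_one (abs_nonneg _) ?_ hp0.le
      rw [haF j hj]
      rcases lt_trichotomy (f (u j)) 0 with h' | h' | h' <;> simp [h']
    calc m * ε ≤ f (∑ j ∈ a.support, a j • u j) := h2.trans_eq h1.symm
      _ ≤ ‖f‖ * ‖∑ j ∈ a.support, a j • u j‖ := (le_abs_self _).trans (f.le_opNorm _)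
      _ ≤ ‖f‖ * (m : ℝ) ^ (1 / p) := mul_le_mul_of_nonneg_left ((h a).trans h3) (norm_nonneg _)
  have hlim : Tendsto (fun m : ℕ => (m : ℝ) ^ (1 - 1 / p)) atTop atTop :=
    (tendsto_rpow_atTop (by
      rw [sub_pos, div_lt_one hp0]; exact hp)).comp tendsto_natCast_atTop_atTop
  obtain ⟨m, hm1, hm2⟩ := ((hlim.eventually_gt_atTop (‖f‖ / ε)).and
    (eventually_gt_atTop 0)).exists
  have hm0 : (0 : ℝ) < m := by exact_mod_cast hm2
  rw [div_lt_iff₀ hε] at hm1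
  have h4 : (m : ℝ) = (m : ℝ) ^ (1 - 1 / p) * (m : ℝ) ^ (1 / p) := by
    rw [← Real.rpow_add hm0, sub_add_cancel, Real.rpow_one]
  have h5 := hbound m
  have h6 : 0 < (m : ℝ) ^ (1 / p) := Real.rpow_pos_of_pos hm0 _
  have h7 : (m : ℝ) * ε = (m : ℝ) ^ (1 - 1 / p) * ε * (m : ℝ) ^ (1 / p) := by
    conv_lhs => rw [h4]
    ring
  rw [h7] at h5
  exact absurd (le_of_mul_le_mul_right h5 h6) (not_le.mpr hm1)

section

variable {n : ℕ} {W : Fin n → LorentzWeight} {p : ℝ} [hp : Fact (1 ≤ p)]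

/-- The biorthogonal functionals are coordinate evaluations at a point in the support of each
vector, normalized there. Truncating a combination only decreases coordinates in absolute value, so
partial sums are contractive. -/
theorem isBasicSequence_of_disjoint {u : ℕ → ∀ i, LorentzSpace (W i) p}
    (hd : ∀ i, IsDisjoint fun k => u k i) (hne : ∀ k, u k ≠ 0) : IsBasicSequence u := by
  classical
  have hpt : ∀ k, ∃ i m, toSeq (u k i) m ≠ 0 := by
    intro k
    by_contra hall
    push Not at hall
    exact hne k (funext fun i => toSeq_injective (funext fun m => hall i m))
  choose i m him using hpt
  refine isBasicSequence_of_biorthogonal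
    (fun k => (toSeq (u k (i k)) (m k))⁻¹ • (LorentzSpace.coord (W (i k)) p (m k)).comp
      (ContinuousLinearMap.proj (R := ℝ) (φ := fun i => LorentzSpace (W i) p) (i k)))
    (fun k j => ?_) fun a N => ?_
  · change (toSeq (u k (i k)) (m k))⁻¹ * toSeq (u j (i k)) (m k) = _
    split_ifs with h
    · rw [← h, inv_mul_cancel₀ (him k)]
    · have : toSeq (u j (i k)) (m k) = 0 := by
        by_contra h0
        exact h (hd (i k) (m k) k j (him k) h0)
      rw [this, mul_zero]
  · rw [pi_norm_le_iff_of_nonneg (norm_nonneg _)]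
    intro i
    refine le_trans ?_ (norm_le_pi_norm _ i)
    set b : ℕ →₀ ℝ := a.filter (· < N) with hb
    have hsum : ∑ j ∈ Finset.range N, a j • u j = ∑ j ∈ b.support, b j • u j := by
      have h1 : b.support ⊆ Finset.range N := fun j hj => by
        rw [hb, Finsupp.support_filter, Finset.mem_filter] at hj
        exact Finset.mem_range.mpr hj.2
      rw [Finset.sum_subset h1 fun j _ hj => by rw [Finsupp.notMem_support_iff.mp hj, zero_smul]]
      refine Finset.sum_congr rfl fun j hj => ?_
      rw [hb, Finsupp.filter_apply_pos (· < N) a (Finset.mem_range.mp hj)]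
    rw [hsum, sum_smul_pi_apply, sum_smul_pi_apply]
    refine norm_le_of_abs_le fun q => ?_
    by_cases hq : ∃ k, toSeq (u k i) q ≠ 0
    · obtain ⟨k, hk⟩ := hq
      rw [(hd i).toSeq_sum b hk, (hd i).toSeq_sum a hk, abs_mul, abs_mul]
      refine mul_le_mul_of_nonneg_right ?_ (abs_nonneg _)
      rw [hb, Finsupp.filter_apply]
      split_ifs
      · exact le_rfl
      · rw [abs_zero]; exact abs_nonneg _
    · push Not at hq
      rw [toSeq_sum_smul, toSeq_sum_smul]
      simp [hq]

theorem norm_sum_le_lpNorm_of_disjoint {u : ℕ → ∀ i, LorentzSpace (W i) p}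
    (hd : ∀ i, IsDisjoint fun k => u k i) (h1 : ∀ k, ‖u k‖ ≤ 1) (a : ℕ →₀ ℝ) :
    ‖∑ j ∈ a.support, a j • u j‖ ≤ lpNorm p a := by
  rw [pi_norm_le_iff_of_nonneg (lpNorm_nonneg p a)]
  intro i
  rw [sum_smul_pi_apply]
  exact (hd i).norm_sum_le (fun j => (norm_le_pi_norm _ i).trans (h1 j)) a

end

/-! ### The spreading models generated by unit vectors and by flat blocks -/

/-- It reduces the finite index choices in the definition to sums over `b.support` along infinite
increasing sequences, the form in which the norms of disjoint sums are computed. -/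
theorem generates_of_forall_strictMono {X : Type*} [NormedAddCommGroup X] [NormedSpace ℝ X]
    {x : ℕ → X} {N : Seminorm ℝ (ℕ →₀ ℝ)} {ε : ℕ → ℝ} (h1 : Antitone ε)
    (h2 : Tendsto ε atTop (𝓝 0))
    (h : ∀ (n : ℕ) (b : ℕ →₀ ℝ) (k : ℕ → ℕ), StrictMono k → (∀ j, n ≤ k j + 1) →
      (1 + ε n)⁻¹ * N b ≤ ‖∑ j ∈ b.support, b j • x (k j)‖ ∧
      ‖∑ j ∈ b.support, b j • x (k j)‖ ≤ (1 + ε n) * N b) : Generates x N := by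
  refine ⟨ε, h1, h2, fun n a _ k hk hkn => ?_⟩
  -- The extension beyond n starts above the sum of all given indices, hence above each of them, and
  -- exceeds `n` as well.
  set g : ℕ → ℕ := fun j => if hj : j < n then k ⟨j, hj⟩ else ∑ i, k i + 1 + j + n with hg
  have hgk : ∀ j : Fin n, g j = k j := fun j => by simp [hg]
  have hgm : StrictMono g := by
    intro i j hij
    simp only [hg]
    split_ifs with hi hj hj
    · exact hk hij
    · have := Finset.single_le_sum (f := k) (fun _ _ => Nat.zero_le _) (Finset.mem_univ ⟨i, hi⟩)
      omega
    · omega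
    · omega
  have hgn : ∀ j, n ≤ g j + 1 := by
    intro j
    simp only [hg]
    split_ifs with hj
    · exact hkn _
    · omega
  set b : ℕ →₀ ℝ := ∑ j : Fin n, Finsupp.single (j : ℕ) (a j) with hb
  have hbj : ∀ j : Fin n, b j = a j := by
    intro j
    rw [hb, Finsupp.finsetSum_apply]
    simp only [Finsupp.single_apply, Fin.val_inj]
    rw [Finset.sum_ite_eq' Finset.univ j a, if_pos (Finset.mem_univ _)]
  have hsupp : b.support ⊆ Finset.range n := by
    intro j hj
    by_contra hjn
    rw [Finset.mem_range] at hjn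
    rw [Finsupp.mem_support_iff] at hj
    apply hj
    rw [hb, Finsupp.finsetSum_apply]
    refine Finset.sum_eq_zero fun i _ => ?_
    rw [Finsupp.single_apply, if_neg]
    have := i.2
    omega
  have hsum : ∑ j ∈ b.support, b j • x (g j) = ∑ j, a j • x (k j) := by
    rw [Finset.sum_subset hsupp fun j _ hj => by rw [Finsupp.notMem_support_iff.mp hj, zero_smul],
      ← Fin.sum_univ_eq_sum_range (fun j => b j • x (g j)) n]
    exact Finset.sum_congr rfl fun j _ => by rw [hbj, hgk]
  have := h n b g hgm hgn
  rwa [hsum] at this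

/-- The indicator of an interval `[s, t)`. -/
def intervalVec (s t : ℕ) : ℕ →₀ ℝ :=
  Finsupp.onFinset (Finset.Ico s t) (fun m => if m ∈ Finset.Ico s t then 1 else 0)
    (fun m hm => by by_contra h; simp [h] at hm)

theorem intervalVec_apply (s t m : ℕ) :
    intervalVec s t m = if m ∈ Finset.Ico s t then 1 else 0 := rfl

/-- An injective placement meets the interval in at most t - s positions. These vectors recover the
fundamental function from the norm and serve as test vectors for comparing spreading models. -/
theorem lorentzNorm_intervalVec (w : LorentzWeight) {p : ℝ} (hp : 1 ≤ p) (s t : ℕ) :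
    lorentzNorm w p (intervalVec s t) ^ p = w.partialSum (t - s) := by
  have hp0 : 0 < p := by linarith
  apply le_antisymm
  · refine (memLorentz_of_rpow_bound (w := w) hp (finsupp_tendsto_zero _)
      (w.partialSum_nonneg _) fun N σ hσ => ?_).2
    calc ∑ n ∈ Finset.range N, |intervalVec s t (σ n)| ^ p * w.toFun n
        = ∑ n ∈ Finset.range N with σ n ∈ Finset.Ico s t, w.toFun n := by
          rw [Finset.sum_filter]
          refine Finset.sum_congr rfl fun n _ => ?_
          rw [intervalVec_apply]
          split_ifs
          · simp
          · simp [Real.zero_rpow hp0.ne']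
      _ ≤ w.partialSum (((Finset.range N).filter fun n => σ n ∈ Finset.Ico s t).card) :=
          w.sum_le_partialSum_card _
      _ ≤ w.partialSum (t - s) := by
          refine w.partialSum_mono ?_
          rw [← Nat.card_Ico]
          refine Finset.card_le_card_of_injOn σ (fun n hn => (Finset.mem_filter.mp hn).2) ?_
          exact hσ.mono fun n hn => (Finset.mem_filter.mp hn).1
  · have h := sum_positions_le (w := w) hp (memLorentz_finsupp hp (intervalVec s t))
      (Finset.range (t - s)) (fun n => s + n) (fun x _ y _ hxy => by
        simpa using hxy)
    refine le_trans (le_of_eq ?_) h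
    rw [LorentzWeight.partialSum]
    refine Finset.sum_congr rfl fun n hn => ?_
    have : s + n ∈ Finset.Ico s t := by
      have := Finset.mem_range.mp hn
      exact Finset.mem_Ico.mpr ⟨by omega, by omega⟩
    rw [intervalVec_apply, if_pos this]
    simp

theorem norm_ofFinsupp_single (w : LorentzWeight) (p : ℝ) [hp : Fact (1 ≤ p)] (k : ℕ) :
    ‖ofFinsupp w p (Finsupp.single k 1)‖ = 1 := by
  apply le_antisymm
  · rw [norm_eq]
    refine (lorentzNorm_le_lpNorm (Finsupp.single k 1)).trans_eq ?_
    rw [lpNorm, Finsupp.support_single k (one_ne_zero (α := ℝ))]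
    simp
  · have := abs_toSeq_le (ofFinsupp w p (Finsupp.single k 1)) k
    rw [toSeq_ofFinsupp] at this
    simpa using this

section

variable {w : LorentzWeight} {p : ℝ} [hp : Fact (1 ≤ p)]

theorem isDisjoint_unitVectors {k : ℕ → ℕ} (hk : Function.Injective k) :
    IsDisjoint fun j => ofFinsupp w p (Finsupp.single (k j) 1) := by
  intro m i j hi hj
  rw [toSeq_ofFinsupp, Finsupp.single_apply_ne_zero] at hi hj
  exact hk (hi.1.symm.trans hj.1)

/-- The Lorentz norm depends only on the rearrangement, so an injective relabelling of coordinates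
preserves it. -/
theorem norm_sum_unitVectors {k : ℕ → ℕ} (hk : Function.Injective k) (b : ℕ →₀ ℝ) :
    ‖∑ j ∈ b.support, b j • ofFinsupp w p (Finsupp.single (k j) 1)‖ = lorentzNorm w p b := by
  have hd := isDisjoint_unitVectors (w := w) (p := p) hk
  have hone : ∀ j, toSeq (ofFinsupp w p (Finsupp.single (k j) 1)) (k j) = 1 := fun j => by
    rw [toSeq_ofFinsupp, Finsupp.single_eq_same]
  apply le_antisymm
  · rw [norm_eq]
    set z := ∑ j ∈ b.support, b j • ofFinsupp w p (Finsupp.single (k j) 1) with hz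
    have hzk : ∀ j, toSeq z (k j) = b j := fun j => by
      rw [hz, hd.toSeq_sum b (j := j) (by rw [hone]; exact one_ne_zero), hone, mul_one]
    have hex : ∀ m, toSeq z m ≠ 0 → ∃ j, k j = m := by
      intro m hm
      by_contra hne
      push Not at hne
      apply hm
      rw [hz, toSeq_sum_smul]
      refine Finset.sum_eq_zero fun j _ => ?_
      rw [toSeq_ofFinsupp, Finsupp.single_apply, if_neg (hne j), mul_zero]
    choose! θ hθ using hex
    refine (lorentzNorm_le_of_relabel hp.out (memLorentz_finsupp hp.out b) z.memLorentz.1 θ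
      (fun x hx y hy hxy => ?_) fun m hm => ?_).2
    · rw [← hθ x hx, ← hθ y hy, hxy]
    · conv_lhs => rw [← hθ m hm]
      rw [hzk]
  · have := hd.le_norm_sum_of_coord one_pos k (fun j => by rw [hone, abs_one]) b
    rwa [one_mul] at this

end

/-! ### Spreading models realizing the finite maxima and ℓ_p -/

section

variable {n : ℕ} {W : Fin n → LorentzWeight} {p : ℝ} [hp : Fact (1 ≤ p)]

/-- The generating sequence repeats e_k in every component of `A`. Its finite sums have a norm
independent of the chosen indices, so the spreading model is attained exactly, with ε = 0. -/
theorem exists_spreadingModel_sup (hp1 : 1 < p) {A : Finset (Fin n)} (hA : A.Nonempty) :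
    ∃ M : WeaklyNullSpreadingModel (∀ i, LorentzSpace (W i) p),
      M.norm = A.sup fun i => lorentzSeminorm (W i) p := by
  classical
  set u : ℕ → ∀ i, LorentzSpace (W i) p := fun k i =>
    if i ∈ A then ofFinsupp (W i) p (Finsupp.single k 1) else 0 with hu
  have hcomp : ∀ i ∈ A, ∀ k, u k i = ofFinsupp (W i) p (Finsupp.single k 1) := fun i hi k => by
    simp [hu, hi]
  have hcomp' : ∀ i, i ∉ A → ∀ k, u k i = 0 := fun i hi k => by simp [hu, hi]
  have hle1 : ∀ k i, ‖u k i‖ ≤ 1 := by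
    intro k i
    by_cases hi : i ∈ A
    · rw [hcomp i hi, norm_ofFinsupp_single]
    · rw [hcomp' i hi, norm_zero]; exact zero_le_one
  have h1 : ∀ k, ‖u k‖ = 1 := by
    intro k
    apply le_antisymm
    · exact (pi_norm_le_iff_of_nonneg zero_le_one).mpr (hle1 k)
    · obtain ⟨i, hi⟩ := hA
      have := norm_le_pi_norm (u k) i
      rwa [hcomp i hi, norm_ofFinsupp_single] at this
  have hd : ∀ i, IsDisjoint fun k => u k i := by
    intro i
    by_cases hi : i ∈ A
    · simp only [hcomp i hi]
      exact isDisjoint_unitVectors Function.injective_id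
    · intro m k j hk _
      simp only [hcomp' i hi, map_zero, Pi.zero_apply, ne_eq, not_true_eq_false] at hk
  have heq : ∀ (b : ℕ →₀ ℝ) (k : ℕ → ℕ), StrictMono k → ‖∑ j ∈ b.support, b j • u (k j)‖ =
      (A.sup fun i => lorentzSeminorm (W i) p : Seminorm ℝ (ℕ →₀ ℝ)) b := by
    intro b k hk
    apply le_antisymm
    · rw [pi_norm_le_iff_of_nonneg (apply_nonneg _ _)]
      intro i
      rw [sum_smul_pi_apply b (fun j => u (k j))]
      by_cases hi : i ∈ A
      · simp only [hcomp i hi]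
        rw [norm_sum_unitVectors hk.injective]
        exact Finset.le_sup (f := fun i => lorentzSeminorm (W i) p) hi b
      · simp only [hcomp' i hi, smul_zero, Finset.sum_const_zero, norm_zero]
        exact apply_nonneg _ _
    · refine Seminorm.finset_sup_apply_le (norm_nonneg _) fun i hi => ?_
      have h := norm_le_pi_norm (∑ j ∈ b.support, b j • u (k j)) i
      rw [sum_smul_pi_apply b (fun j => u (k j))] at h
      simp only [hcomp i hi] at h
      rw [norm_sum_unitVectors hk.injective] at h
      exact h
  refine ⟨⟨A.sup fun i => lorentzSeminorm (W i) p, u, h1,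
    isBasicSequence_of_disjoint hd fun k hk => ?_,
    isWeaklyNull_of_norm_sum_le hp1 (norm_sum_le_lpNorm_of_disjoint hd fun k => (h1 k).le),
    generates_of_forall_strictMono (ε := fun _ => 0) antitone_const tendsto_const_nhds
      fun m b k hk _ => ?_⟩, rfl⟩
  · have := h1 k
    rw [hk, norm_zero] at this
    exact zero_ne_one this
  · rw [heq b k hk]
    simp

/-- The weights preceding a block become a negligible fraction of the fundamental function at its
length. A flat block may then use the positions it occupies, instead of the first ones, almost
without loss. -/
theorem exists_fast_growth (w : LorentzWeight) : ∃ t : ℕ → ℕ, StrictMono t ∧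
    ∀ k : ℕ, ((k : ℝ) + 3) * w.partialSum (t k) ≤ w.partialSum (t (k + 1) - t k) := by
  have hstep : ∀ k s : ℕ, ∃ s', s < s' ∧
      ((k : ℝ) + 3) * w.partialSum s ≤ w.partialSum (s' - s) := by
    intro k s
    obtain ⟨r, hr1, hr2⟩ := ((w.tendsto_partialSum.eventually_ge_atTop
      (((k : ℝ) + 3) * w.partialSum s)).and (eventually_gt_atTop 0)).exists
    exact ⟨s + r, by omega, by rwa [Nat.add_sub_cancel_left]⟩
  choose next h1 h2 using hstep
  exact ⟨fun k => Nat.rec 0 (fun k s => next k s) k, strictMono_nat_of_lt_succ fun k => h1 k _,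
    fun k => h2 k _⟩

/-- Flat blocks generate the unit vector basis of `ℓ_p`. -/
theorem exists_spreadingModel_lp (hp1 : 1 < p) (i₀ : Fin n) :
    ∃ M : WeaklyNullSpreadingModel (∀ i, LorentzSpace (W i) p), M.norm = lpSeminorm p := by
  classical
  have hp0 : 0 < p := by linarith
  set w := W i₀ with hw
  obtain ⟨t, ht, hgrow⟩ := exists_fast_growth w
  have hlt : ∀ k, t k < t (k + 1) := fun k => ht (Nat.lt_succ_self k)
  have hS : ∀ k, 0 < w.partialSum (t (k + 1) - t k) := fun k =>
    w.partialSum_pos (Nat.sub_pos_of_lt (hlt k))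
  set c : ℕ → ℝ := fun k => (w.partialSum (t (k + 1) - t k))⁻¹ ^ (1 / p) with hc
  have hc0 : ∀ k, 0 < c k := fun k => Real.rpow_pos_of_pos (inv_pos.mpr (hS k)) _
  have hcp : ∀ k, c k ^ p = (w.partialSum (t (k + 1) - t k))⁻¹ := fun k => by
    simp only [hc]
    rw [one_div, Real.rpow_inv_rpow (inv_pos.mpr (hS k)).le hp0.ne']
  set v : ℕ → LorentzSpace w p := fun k =>
    c k • ofFinsupp w p (intervalVec (t k) (t (k + 1))) with hv
  have hvapp : ∀ k m, toSeq (v k) m =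
      if m ∈ Finset.Ico (t k) (t (k + 1)) then c k else 0 := by
    intro k m
    simp only [hv, map_smul, Pi.smul_apply, toSeq_ofFinsupp, intervalVec_apply, smul_eq_mul,
      mul_ite, mul_one, mul_zero]
  have hvnorm : ∀ k, ‖v k‖ = 1 := by
    intro k
    simp only [hv]
    rw [norm_smul, Real.norm_of_nonneg (hc0 k).le, norm_eq, toSeq_ofFinsupp]
    have h0 := lorentzNorm_nonneg w p (intervalVec (t k) (t (k + 1)))
    rw [← Real.rpow_left_inj (mul_nonneg (hc0 k).le h0) zero_le_one hp0.ne', Real.one_rpow,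
      Real.mul_rpow (hc0 k).le h0, hcp, lorentzNorm_intervalVec w hp.out,
      inv_mul_cancel₀ (hS k).ne']
  have hvd : IsDisjoint v := by
    intro m i j hi hj
    rw [hvapp] at hi hj
    refine disjoint_Ico_of_strictMono ht m i j ?_ ?_
    · by_contra h
      exact hi (if_neg (by simpa using h))
    · by_contra h
      exact hj (if_neg (by simpa using h))
  set u : ℕ → ∀ i, LorentzSpace (W i) p := fun k => Pi.single i₀ (v k) with hu
  have hui : ∀ k i, i ≠ i₀ → u k i = 0 := fun k i hi => Pi.single_eq_of_ne hi _
  have hui0 : ∀ k, u k i₀ = v k := fun k => Pi.single_eq_same _ _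
  have hnorm : ∀ (b : ℕ →₀ ℝ) (k : ℕ → ℕ),
      ‖∑ j ∈ b.support, b j • u (k j)‖ = ‖∑ j ∈ b.support, b j • v (k j)‖ := by
    intro b k
    apply le_antisymm
    · rw [pi_norm_le_iff_of_nonneg (norm_nonneg _)]
      intro i
      rw [sum_smul_pi_apply b (fun j => u (k j))]
      by_cases hi : i = i₀
      · subst hi
        simp only [hui0]
        exact le_rfl
      · simp only [hui _ i hi, smul_zero, Finset.sum_const_zero, norm_zero]
        exact norm_nonneg _
    · have h := norm_le_pi_norm (∑ j ∈ b.support, b j • u (k j)) i₀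
      rw [sum_smul_pi_apply b (fun j => u (k j))] at h
      simpa only [hui0] using h
  have h1 : ∀ k, ‖u k‖ = 1 := by
    intro k
    apply le_antisymm
    · rw [pi_norm_le_iff_of_nonneg zero_le_one]
      intro i
      by_cases hi : i = i₀
      · subst hi; rw [hui0, hvnorm]
      · rw [hui k i hi, norm_zero]; exact zero_le_one
    · have := norm_le_pi_norm (u k) i₀
      rwa [hui0, hvnorm] at this
  have hd : ∀ i, IsDisjoint fun k => u k i := by
    intro i
    by_cases hi : i = i₀
    · subst hi
      simp only [hui0]
      exact hvd
    · intro m k j hk _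
      simp only [hui _ i hi, map_zero, Pi.zero_apply, ne_eq, not_true_eq_false] at hk
  have hle := fun a => norm_sum_le_lpNorm_of_disjoint hd (fun k => (h1 k).le) a
  refine ⟨⟨lpSeminorm p, u, h1, isBasicSequence_of_disjoint hd fun k hk => ?_,
    isWeaklyNull_of_norm_sum_le hp1 hle,
    generates_of_forall_strictMono (ε := fun m : ℕ => 1 / ((m : ℝ) + 1)) (fun a b hab => ?_)
      tendsto_one_div_add_atTop_nhds_zero_nat fun m b k hk hkm => ?_⟩, rfl⟩
  · have := h1 k
    rw [hk, norm_zero] at this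
    exact zero_ne_one this
  · have : (a : ℝ) ≤ b := by exact_mod_cast hab
    exact one_div_le_one_div_of_le (by positivity) (by linarith)
  · have hdk : IsDisjoint fun j => v (k j) := fun q i j hi hj => hk.injective (hvd q _ _ hi hj)
    rw [hnorm, lpSeminorm_apply]
    have hlp := lpNorm_nonneg p b
    have hm0 : (0 : ℝ) ≤ m := Nat.cast_nonneg m
    constructor
    -- `ρ` equals (m+1)/(m+2). On its own interval the block with index k carries mass at least 1 -
    -- 1/(k+3), and k + 1 ≥ m gives 1/(k+3) ≤ 1/(m+2).
    · set ρ : ℝ := (1 + 1 / ((m : ℝ) + 1))⁻¹ with hρ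
      have hρ0 : 0 < ρ := by positivity
      have hρ1 : ρ ≤ 1 := by
        rw [hρ]
        exact inv_le_one_of_one_le₀ (by
          have : 0 ≤ 1 / ((m : ℝ) + 1) := by positivity
          linarith)
      have hpos := hdk.le_norm_sum_of_positions (fun _ => ρ)
        (fun j => Finset.Ico (t (k j)) (t (k j + 1)))
        (fun q i j hi hj => hk.injective (disjoint_Ico_of_strictMono ht q _ _
          (by simpa using hi) (by simpa using hj))) (fun _ => id) (fun _ => Set.injOn_id _)
        (fun j q hq => by
          rw [id, hvapp, if_pos hq]
          exact (hc0 _).ne') b (fun j _ => by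
        have e1 : ∑ q ∈ Finset.Ico (t (k j)) (t (k j + 1)),
            |toSeq (v (k j)) (id q)| ^ p * w.toFun q =
            c (k j) ^ p * (w.partialSum (t (k j + 1)) - w.partialSum (t (k j))) := by
          rw [LorentzWeight.partialSum, LorentzWeight.partialSum,
            ← Finset.sum_range_add_sum_Ico _ (hlt (k j)).le, add_sub_cancel_left, Finset.mul_sum]
          refine Finset.sum_congr rfl fun q hq => ?_
          rw [id, hvapp, if_pos hq, abs_of_pos (hc0 _)]
        rw [e1, hcp, inv_mul_eq_div, le_div_iff₀ (hS _), hρ, inv_mul_le_iff₀ (by positivity)]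
        have e2 := hgrow (k j)
        have e3 := w.partialSum_mono (Nat.sub_le (t (k j + 1)) (t (k j)))
        have e4 := w.partialSum_nonneg (t (k j))
        have e5 : (m : ℝ) ≤ k j + 1 := by exact_mod_cast hkm j
        set s := w.partialSum (t (k j + 1) - t (k j))
        have e6 : ((m : ℝ) + 2) * w.partialSum (t (k j)) ≤ s := by nlinarith
        have e7 : 1 + 1 / ((m : ℝ) + 1) = (m + 2) / (m + 1) := by field_simp; ring
        rw [e7, div_mul_eq_mul_div, le_div_iff₀ (by positivity)]
        nlinarith)
      rw [← Finset.sum_mul, ← lpNorm_rpow hp.out] at hpos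
      refine (Real.rpow_le_rpow_iff (mul_nonneg hρ0.le hlp) (norm_nonneg _) hp0).mp ?_
      rw [Real.mul_rpow hρ0.le hlp]
      refine le_trans ?_ hpos
      rw [mul_comm]
      refine mul_le_mul_of_nonneg_left ?_ (Real.rpow_nonneg hlp _)
      -- As ρ ≤ 1 and p ≥ 1, ρ^p ≤ ρ, so the bound on p-th powers survives taking roots.
      conv_rhs => rw [← Real.rpow_one ρ]
      exact Real.rpow_le_rpow_of_exponent_ge hρ0 hρ1 hp.out
    · refine (hdk.norm_sum_le (fun j => (hvnorm _).le) b).trans ?_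
      refine le_mul_of_one_le_left hlp ?_
      have : 0 ≤ 1 / ((m : ℝ) + 1) := by positivity
      linarith

end

/-! ### Dyadic interpolation of concave sequences -/

/-- Conditions on `v k = S (2 ^ k)` that make the linear interpolation `S` submultiplicative. -/
structure IsDyadicProfile (v : ℕ → ℝ) : Prop where
  zero : v 0 = 1
  one : v 1 = 2
  lt_succ : ∀ k, v k < v (k + 1)
  concave : ∀ k, v (k + 2) - v (k + 1) ≤ v (k + 1) - v k
  slow : v 2 - v 1 ≤ 2 / 3

/-- The affine function interpolating `v k` at `2 ^ k` and `v (k + 1)` at `2 ^ (k + 1)`. -/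
def dyadicChord (v : ℕ → ℝ) (k : ℕ) (x : ℝ) : ℝ := v k + (v (k + 1) - v k) * (x / 2 ^ k - 1)

/-- The piecewise linear function on `[1,∞)` interpolating `v k` at `2 ^ k`. -/
def dyadicInterp (v : ℕ → ℝ) (x : ℝ) : ℝ := dyadicChord v (Nat.log 2 ⌊x⌋₊) x

theorem mem_Icc_log_floor {x : ℝ} (hx : 1 ≤ x) :
    x ∈ Set.Icc ((2 : ℝ) ^ Nat.log 2 ⌊x⌋₊) (2 ^ (Nat.log 2 ⌊x⌋₊ + 1)) := by
  have h0 : ⌊x⌋₊ ≠ 0 := (Nat.floor_pos.mpr hx).ne'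
  constructor
  · have h1 : ((2 ^ Nat.log 2 ⌊x⌋₊ : ℕ) : ℝ) ≤ (⌊x⌋₊ : ℝ) := by
      exact_mod_cast Nat.pow_log_le_self 2 h0
    have h2 := h1.trans (Nat.floor_le (by linarith))
    push_cast at h2
    exact h2
  · have h1 : ((⌊x⌋₊ + 1 : ℕ) : ℝ) ≤ ((2 ^ (Nat.log 2 ⌊x⌋₊ + 1) : ℕ) : ℝ) := by
      exact_mod_cast Nat.lt_pow_succ_log_self (by norm_num) ⌊x⌋₊
    have h2 := (Nat.lt_floor_add_one x).le
    push_cast at h1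
    linarith

namespace IsDyadicProfile

variable {v : ℕ → ℝ}

theorem mono (hv : IsDyadicProfile v) : Monotone v :=
  monotone_nat_of_le_succ fun k => (hv.lt_succ k).le

theorem diff_antitone (hv : IsDyadicProfile v) : Antitone fun k => v (k + 1) - v k :=
  antitone_nat_of_succ_le hv.concave

theorem diff_le_one (hv : IsDyadicProfile v) (k : ℕ) : v (k + 1) - v k ≤ 1 := by
  have h := hv.diff_antitone (Nat.zero_le k)
  simp only [zero_add, hv.zero, hv.one] at h
  linarith

theorem one_le (hv : IsDyadicProfile v) (k : ℕ) : 1 ≤ v k := hv.zero ▸ hv.mono (Nat.zero_le k)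

theorem two_le (hv : IsDyadicProfile v) {k : ℕ} (hk : 1 ≤ k) : 2 ≤ v k := hv.one ▸ hv.mono hk

theorem add_sub_le (hv : IsDyadicProfile v) {j : ℕ} (hj : 1 ≤ j) (m : ℕ) :
    v (j + m) - v j ≤ v (1 + m) - v 1 := by
  induction m with
  | zero => simp
  | succ m ih =>
    have h : v (j + m + 1) - v (j + m) ≤ v (1 + m + 1) - v (1 + m) :=
      hv.diff_antitone (show 1 + m ≤ j + m by omega)
    rw [← add_assoc, ← add_assoc]
    linarith

/-- By concavity v(j+k+2) - v(j) ≤ v(k+3) - 2, and the three increments from k to k+3 are at most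
2/3 each. Thus v(j+k+2) ≤ v(j) + v(k), which is at most the product since both values are at least
2. The summand 2 in the index absorbs the rounding of both factors up to powers of two. -/
theorem mul_le (hv : IsDyadicProfile v) {j k : ℕ} (hj : 1 ≤ j) (hk : 1 ≤ k) :
    v (j + k + 2) ≤ v j * v k := by
  have h1 := hv.add_sub_le hj (k + 2)
  have hd : ∀ l, 1 ≤ l → v (l + 1) - v l ≤ 2 / 3 := fun l hl =>
    (hv.diff_antitone hl).trans hv.slow
  have h2 := hd k hk
  have h3 := hd (k + 1) (by omega)
  have h4 := hd (k + 2) (by omega)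
  rw [← add_assoc, show 1 + (k + 2) = k + 2 + 1 by ring] at h1
  have h5 := hv.one
  have h6 := hv.two_le hj
  have h7 := hv.two_le hk
  simp only [add_assoc] at h1 h2 h3 h4 ⊢
  norm_num at h1 h2 h3 h4 ⊢
  nlinarith

theorem chord_sub_chord_succ (v : ℕ → ℝ) (k : ℕ) (x : ℝ) :
    dyadicChord v k x - dyadicChord v (k + 1) x =
      (2 * (v (k + 1) - v k) - (v (k + 2) - v (k + 1))) / 2 ^ (k + 1) * (x - 2 ^ (k + 1)) := by
  have h2 : (2 : ℝ) ^ k ≠ 0 := by positivity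
  simp only [dyadicChord, pow_succ]
  field_simp
  ring

theorem chord_coeff_nonneg (hv : IsDyadicProfile v) (k : ℕ) :
    0 ≤ (2 * (v (k + 1) - v k) - (v (k + 2) - v (k + 1))) / 2 ^ (k + 1) := by
  have h1 := hv.concave k
  have h2 := hv.lt_succ k
  apply div_nonneg _ (by positivity)
  linarith

/-- Consecutive chords cross at 2^(k+1) and their slopes decrease, so the chord in use at a point is
the smallest of all. The interpolation is therefore a minimum of affine functions, which yields
monotonicity, concavity and the Lipschitz bound without treating breakpoints. -/
theorem chord_le_chord (hv : IsDyadicProfile v) {m : ℕ} {x : ℝ}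
    (hx : x ∈ Set.Icc ((2 : ℝ) ^ m) (2 ^ (m + 1))) (k : ℕ) :
    dyadicChord v m x ≤ dyadicChord v k x := by
  rcases le_total m k with h | h
  · induction k, h using Nat.le_induction with
    | base => exact le_rfl
    | succ k hmk ih =>
      refine ih.trans ?_
      have h1 := chord_sub_chord_succ v k x
      have h2 := hv.chord_coeff_nonneg k
      have h3 : (2 : ℝ) ^ (m + 1) ≤ 2 ^ (k + 1) := pow_le_pow_right₀ (by norm_num) (by omega)
      have h4 : x - 2 ^ (k + 1) ≤ 0 := by linarith [hx.2]
      linarith [mul_nonpos_of_nonneg_of_nonpos h2 h4]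
  · induction h using Nat.decreasingInduction with
    | self => exact le_rfl
    | of_succ k hkm ih =>
      refine ih.trans ?_
      have h1 := chord_sub_chord_succ v k x
      have h2 := hv.chord_coeff_nonneg k
      have h3 : (2 : ℝ) ^ (k + 1) ≤ 2 ^ m := pow_le_pow_right₀ (by norm_num) (by omega)
      have h4 : 0 ≤ x - 2 ^ (k + 1) := by linarith [hx.1]
      linarith [mul_nonneg h2 h4]

theorem interp_le_chord (hv : IsDyadicProfile v) {x : ℝ} (hx : 1 ≤ x) (k : ℕ) :
    dyadicInterp v x ≤ dyadicChord v k x :=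
  hv.chord_le_chord (mem_Icc_log_floor hx) k

theorem interp_eq_chord (hv : IsDyadicProfile v) {m : ℕ} {x : ℝ}
    (hx : x ∈ Set.Icc ((2 : ℝ) ^ m) (2 ^ (m + 1))) : dyadicInterp v x = dyadicChord v m x :=
  le_antisymm (hv.interp_le_chord ((one_le_pow₀ (by norm_num)).trans hx.1) m)
    (hv.chord_le_chord hx _)

theorem interp_two_pow (hv : IsDyadicProfile v) (k : ℕ) : dyadicInterp v (2 ^ k) = v k := by
  rw [hv.interp_eq_chord (m := k) ⟨le_rfl, pow_le_pow_right₀ (by norm_num) (Nat.le_succ k)⟩,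
    dyadicChord, div_self (by positivity)]
  ring

theorem chord_sub (v : ℕ → ℝ) (k : ℕ) (x y : ℝ) :
    dyadicChord v k y - dyadicChord v k x = (v (k + 1) - v k) / 2 ^ k * (y - x) := by
  simp only [dyadicChord]
  ring

theorem slope_pos (hv : IsDyadicProfile v) (k : ℕ) : 0 < (v (k + 1) - v k) / 2 ^ k :=
  div_pos (sub_pos.mpr (hv.lt_succ k)) (by positivity)

theorem slope_le_one (hv : IsDyadicProfile v) (k : ℕ) : (v (k + 1) - v k) / 2 ^ k ≤ 1 := by
  rw [div_le_one (by positivity)]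
  exact (hv.diff_le_one k).trans (one_le_pow₀ (by norm_num))

theorem strictMonoOn (hv : IsDyadicProfile v) : StrictMonoOn (dyadicInterp v) (Set.Ici 1) := by
  intro x hx y hy hxy
  have h1 := hv.interp_le_chord hx (Nat.log 2 ⌊y⌋₊)
  have h2 := chord_sub v (Nat.log 2 ⌊y⌋₊) x y
  have h3 := mul_pos (hv.slope_pos (Nat.log 2 ⌊y⌋₊)) (sub_pos.mpr hxy)
  have h4 : dyadicInterp v y = dyadicChord v (Nat.log 2 ⌊y⌋₊) y := rfl
  linarith

/-- A chord has nonnegative intercept, because increments are at most 1 and values at least 1; hence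
stretching its argument by `y` multiplies it by at most `y`. This settles submultiplicativity when
one factor lies in [1,2], where the function is the identity. -/
theorem interp_mul_le_interp_mul (hv : IsDyadicProfile v) {x y : ℝ} (hx : 1 ≤ x) (hy : 1 ≤ y) :
    dyadicInterp v (x * y) ≤ dyadicInterp v x * y := by
  have h1 := hv.interp_le_chord (one_le_mul_of_one_le_of_one_le hx hy) (Nat.log 2 ⌊x⌋₊)
  refine h1.trans ?_
  rw [dyadicInterp]
  set k := Nat.log 2 ⌊x⌋₊
  have h2 := hv.one_le k
  have h3 := hv.diff_le_one k
  have h4 : dyadicChord v k x * y - dyadicChord v k (x * y) =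
      (v k - (v (k + 1) - v k)) * (y - 1) := by
    simp only [dyadicChord]
    ring
  nlinarith [mul_nonneg (show 0 ≤ v k - (v (k + 1) - v k) by linarith) (sub_nonneg.mpr hy)]

theorem interp_of_mem_Icc (hv : IsDyadicProfile v) {x : ℝ} (hx : x ∈ Set.Icc (1 : ℝ) 2) :
    dyadicInterp v x = x := by
  rw [hv.interp_eq_chord (m := 0) (by simpa using hx), dyadicChord, zero_add, hv.zero, hv.one]
  ring

theorem isSubmultiplicative (hv : IsDyadicProfile v) : IsSubmultiplicative (dyadicInterp v) where
  piecewiseLinear := by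
    refine ⟨fun k => 2 ^ k, by simp, pow_right_strictMono₀ (by norm_num),
      tendsto_pow_atTop_atTop_of_one_lt (by norm_num), fun k =>
      ⟨(v (k + 1) - v k) / 2 ^ k, v k - (v (k + 1) - v k), fun x hx => ?_⟩⟩
    rw [hv.interp_eq_chord hx, dyadicChord]
    ring
  continuousOn := by
    have hlip : LipschitzOnWith 1 (dyadicInterp v) (Set.Ici 1) := by
      have key : ∀ x ∈ Set.Ici (1 : ℝ), ∀ y ∈ Set.Ici (1 : ℝ), x ≤ y →
          |dyadicInterp v y - dyadicInterp v x| ≤ |y - x| := by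
        intro x hx y hy hxy
        have h1 := hv.interp_le_chord hy (Nat.log 2 ⌊x⌋₊)
        have h2 := chord_sub v (Nat.log 2 ⌊x⌋₊) x y
        have h3 := hv.slope_le_one (Nat.log 2 ⌊x⌋₊)
        have h4 := hv.strictMonoOn.monotoneOn hx hy hxy
        have h5 : dyadicInterp v x = dyadicChord v (Nat.log 2 ⌊x⌋₊) x := rfl
        rw [abs_of_nonneg (sub_nonneg.mpr h4), abs_of_nonneg (sub_nonneg.mpr hxy)]
        nlinarith [mul_nonneg (sub_nonneg.mpr h3) (sub_nonneg.mpr hxy)]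
      refine LipschitzOnWith.of_dist_le_mul fun x hx y hy => ?_
      rw [NNReal.coe_one, one_mul, Real.dist_eq, Real.dist_eq]
      rcases le_total x y with h | h
      · rw [abs_sub_comm, abs_sub_comm x]
        exact key x hx y hy h
      · exact key y hy x hx h
    exact hlip.continuousOn
  strictMonoOn := hv.strictMonoOn
  concaveOn := by
    refine ⟨convex_Ici 1, fun x hx y hy a b ha hb hab => ?_⟩
    have hz : 1 ≤ a * x + b * y := by
      have h1 := mul_le_mul_of_nonneg_left (Set.mem_Ici.mp hx) ha
      have h2 := mul_le_mul_of_nonneg_left (Set.mem_Ici.mp hy) hb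
      linarith
    simp only [smul_eq_mul]
    rw [dyadicInterp.eq_def v (a * x + b * y)]
    set k := Nat.log 2 ⌊a * x + b * y⌋₊
    have h1 := mul_le_mul_of_nonneg_left (hv.interp_le_chord hx k) ha
    have h2 := mul_le_mul_of_nonneg_left (hv.interp_le_chord hy k) hb
    have h3 : dyadicChord v k (a * x + b * y) = a * dyadicChord v k x + b * dyadicChord v k y := by
      have hb' : b = 1 - a := by linarith
      subst hb'
      simp only [dyadicChord]
      ring
    linarith
  eq_self _ hx := hv.interp_of_mem_Icc hx
  mul_le := by
    intro x y hx hy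
    rcases le_total y 2 with h | h
    · rw [hv.interp_of_mem_Icc (x := y) ⟨hy, h⟩]
      exact hv.interp_mul_le_interp_mul hx hy
    rcases le_total x 2 with h' | h'
    · rw [hv.interp_of_mem_Icc (x := x) ⟨hx, h'⟩, mul_comm x y, mul_comm x]
      exact hv.interp_mul_le_interp_mul hy hx
    have hlog : ∀ z : ℝ, 2 ≤ z → 1 ≤ Nat.log 2 ⌊z⌋₊ := fun z hz =>
      Nat.log_pos (by norm_num) (Nat.le_floor (by exact_mod_cast hz))
    have hxm := mem_Icc_log_floor hx
    have hym := mem_Icc_log_floor hy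
    have hj := hlog x h'
    have hk := hlog y h
    set j := Nat.log 2 ⌊x⌋₊
    set k := Nat.log 2 ⌊y⌋₊
    have hmono := hv.strictMonoOn.monotoneOn
    have hone : ∀ l, (2 : ℝ) ^ l ∈ Set.Ici (1 : ℝ) := fun l =>
      Set.mem_Ici.mpr (one_le_pow₀ one_le_two)
    have h1 := hmono (hone j) hx hxm.1
    have h2 := hmono (hone k) hy hym.1
    have h3 : x * y ≤ 2 ^ (j + k + 2) := by
      calc x * y ≤ 2 ^ (j + 1) * 2 ^ (k + 1) :=
            mul_le_mul hxm.2 hym.2 (by linarith) (by positivity)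
        _ = 2 ^ (j + k + 2) := by ring
    have h4 := hmono (Set.mem_Ici.mpr (one_le_mul_of_one_le_of_one_le hx hy)) (hone _) h3
    rw [hv.interp_two_pow] at h1 h2 h4
    have h5 := hv.one_le j
    have h6 := hv.one_le k
    exact h4.trans ((hv.mul_le hj hk).trans (mul_le_mul h1 h2 (by linarith) (by linarith)))

end IsDyadicProfile

/-! ### An incomparable family -/

/-- Tangent lines to `2 √t` at the points `t = 4 ^ (r ^ 2)`, together with the identity. -/
def tangentLine (r k : ℕ) : ℝ :=
  if r = 0 then k else 2 ^ r ^ 2 + k / 2 ^ r ^ 2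

/-- The infimum of the tangent lines whose index is not labelled `i`. -/
def lineInf (i k : ℕ) : ℝ := ⨅ r : {r : ℕ // r = 0 ∨ (Nat.unpair r).1 ≠ i}, tangentLine r k

theorem tangentLine_nonneg (r k : ℕ) : 0 ≤ tangentLine r k := by
  rw [tangentLine]
  split_ifs <;> positivity

/-- Affine functions with slopes in [0,1] pass their monotonicity, unit growth bound and concavity
to infima. -/
theorem tangentLine_succ (r k : ℕ) : ∃ s, 0 ≤ s ∧ s ≤ 1 ∧ ∀ l, tangentLine r (k + l) =
    tangentLine r k + s * l := by
  by_cases h : r = 0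
  · exact ⟨1, zero_le_one, le_rfl, fun l => by simp [tangentLine, h]⟩
  · refine ⟨1 / 2 ^ r ^ 2, by positivity, ?_, fun l => ?_⟩
    · rw [div_le_one (by positivity)]
      exact one_le_pow₀ (by norm_num)
    · simp only [tangentLine, h, if_false]
      push_cast
      ring

instance (i : ℕ) : Nonempty {r : ℕ // r = 0 ∨ (Nat.unpair r).1 ≠ i} := ⟨⟨0, Or.inl rfl⟩⟩

theorem lineInf_le {i r : ℕ} (hr : r = 0 ∨ (Nat.unpair r).1 ≠ i) (k : ℕ) :
    lineInf i k ≤ tangentLine r k :=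
  ciInf_le (f := fun r : {r : ℕ // r = 0 ∨ (Nat.unpair r).1 ≠ i} => tangentLine r k)
    ⟨0, by rintro _ ⟨r, rfl⟩; exact tangentLine_nonneg _ _⟩ ⟨r, hr⟩

theorem le_lineInf {i k : ℕ} {c : ℝ}
    (h : ∀ r, (r = 0 ∨ (Nat.unpair r).1 ≠ i) → c ≤ tangentLine r k) : c ≤ lineInf i k :=
  le_ciInf fun r => h r.1 r.2

theorem lineInf_nonneg (i k : ℕ) : 0 ≤ lineInf i k := le_lineInf fun r _ => tangentLine_nonneg r k

theorem lineInf_zero (i : ℕ) : lineInf i 0 = 0 :=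
  le_antisymm ((lineInf_le (Or.inl rfl) 0).trans (by simp [tangentLine])) (lineInf_nonneg i 0)

theorem lineInf_le_succ (i k : ℕ) : lineInf i k ≤ lineInf i (k + 1) := by
  refine le_lineInf fun r hr => (lineInf_le hr k).trans ?_
  obtain ⟨s, h0, -, h⟩ := tangentLine_succ r k
  have := h 1
  push_cast at this
  linarith

theorem lineInf_succ_le (i k : ℕ) : lineInf i (k + 1) ≤ lineInf i k + 1 := by
  rw [← sub_le_iff_le_add]
  refine le_lineInf fun r hr => ?_
  have h1 := lineInf_le hr (k + 1)
  obtain ⟨s, h0, hs, h⟩ := tangentLine_succ r k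
  have := h 1
  push_cast at this
  linarith

theorem lineInf_concave (i k : ℕ) : lineInf i (k + 2) + lineInf i k ≤ 2 * lineInf i (k + 1) := by
  have : (lineInf i (k + 2) + lineInf i k) / 2 ≤ lineInf i (k + 1) := by
    refine le_lineInf fun r hr => ?_
    have h1 := lineInf_le hr (k + 2)
    have h2 := lineInf_le hr k
    obtain ⟨s, h0, hs, h⟩ := tangentLine_succ r k
    have h3 := h 1
    have h4 := h 2
    push_cast at h3 h4
    linarith
  linarith

/-- The values at the powers of two of the `i`-th function of the incomparable family. -/
def profile (i : ℕ) : ℕ → ℝ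
  | 0 => 1
  | k + 1 => 2 + (lineInf i k + 1 - (1 / 2) ^ k) / 3

theorem profile_succ (i k : ℕ) : profile i (k + 1) = 2 + (lineInf i k + 1 - (1 / 2) ^ k) / 3 := rfl

/-- The concave bounded term 1 - (1/2)^k makes the profile strictly increasing even where `lineInf`
is only known to be non-decreasing. Division by 3 makes the increment from index 1 to index 2 at
most (1 + 1/2)/3. -/
theorem isDyadicProfile_profile (i : ℕ) : IsDyadicProfile (profile i) where
  zero := rfl
  one := by simp [profile, lineInf_zero]
  lt_succ := by
    rintro (_ | k)
    · simp [profile, lineInf_zero]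
    · rw [profile_succ, profile_succ]
      have h1 := lineInf_le_succ i k
      have h2 : (0 : ℝ) < (1 / 2) ^ k := by positivity
      rw [pow_succ]
      linarith
  concave := by
    rintro (_ | k)
    · rw [profile_succ, profile_succ]
      have h := lineInf_succ_le i 0
      simp only [profile, lineInf_zero] at h ⊢
      norm_num at h ⊢
      linarith
    · rw [profile_succ, profile_succ, profile_succ]
      have h1 := lineInf_concave i k
      have h2 : (0 : ℝ) < (1 / 2) ^ k := by positivity
      rw [pow_succ, pow_succ]
      linarith
  slow := by
    have h := lineInf_succ_le i 0
    rw [profile_succ, profile_succ]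
    simp only [lineInf_zero] at h ⊢
    norm_num at h ⊢
    linarith

/-- At t = 4^(r²) the tangent that would be small is missing. A line with s < r contributes 2^(2r² -
s²), and one with s > r contributes 2^(s²); the gaps between consecutive squares put both exponents
at or above r² + r. The identity line gives 2^(2r²). -/
theorem le_lineInf_of_label {r j : ℕ} (hj : (Nat.unpair r).1 = j) (hr : r ≠ 0) :
    (2 : ℝ) ^ (r ^ 2 + r) ≤ lineInf j (2 ^ r ^ 2 * 2 ^ r ^ 2) := by
  refine le_lineInf fun s hs => ?_
  have hmono : ∀ {a b : ℕ}, a ≤ b → (2 : ℝ) ^ a ≤ 2 ^ b := fun h =>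
    pow_le_pow_right₀ (by norm_num) h
  by_cases h0 : s = 0
  · subst h0
    rw [tangentLine, if_pos rfl]
    push_cast
    rw [← pow_add]
    exact hmono (by nlinarith [Nat.pos_of_ne_zero hr])
  · have hsr : s ≠ r := by
      rintro rfl
      rcases hs with h | h
      · exact h0 h
      · exact h hj
    rw [tangentLine, if_neg h0]
    push_cast
    rcases lt_or_gt_of_ne hsr with h | h
    · have h1 : (2 : ℝ) ^ (r ^ 2 + r) ≤ 2 ^ r ^ 2 * 2 ^ r ^ 2 / 2 ^ s ^ 2 := by
        rw [le_div_iff₀ (by positivity), ← pow_add, ← pow_add]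
        exact hmono (by nlinarith)
      have h2 : (0 : ℝ) < 2 ^ s ^ 2 := by positivity
      linarith
    · have h1 : (2 : ℝ) ^ (r ^ 2 + r) ≤ 2 ^ s ^ 2 := hmono (by nlinarith)
      have h2 : (0 : ℝ) ≤ 2 ^ r ^ 2 * 2 ^ r ^ 2 / 2 ^ s ^ 2 := by positivity
      linarith

theorem lineInf_le_of_label {r i : ℕ} (hi : (Nat.unpair r).1 ≠ i) (hr : r ≠ 0) :
    lineInf i (2 ^ r ^ 2 * 2 ^ r ^ 2) ≤ 2 * 2 ^ r ^ 2 := by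
  refine (lineInf_le (Or.inr hi) _).trans (le_of_eq ?_)
  rw [tangentLine, if_neg hr]
  push_cast
  field_simp
  ring

/-- At the contact point of a tangent labelled `j`, all functions with other labels are small
simultaneously, which handles the maximum over `A`. There the quotient is at least (2^r Q/3)/(3Q) =
2^r/9 with Q = 2^(r²); pairing `j` with a large number makes r as large as desired. -/
theorem isIncomparableFamily_profile :
    IsIncomparableFamily fun i => dyadicInterp (profile i) where
  submultiplicative i := (isDyadicProfile_profile i).isSubmultiplicative
  unbounded := by
    intro A hA j hj
    rintro ⟨B, hB⟩
    obtain ⟨b, hb⟩ := pow_unbounded_of_one_lt (9 * B) (one_lt_two (α := ℝ))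
    set r := Nat.pair j (b + 1) with hr
    have hrb : b + 1 ≤ r := Nat.right_le_pair j (b + 1)
    have hr0 : r ≠ 0 := by omega
    have hlab : (Nat.unpair r).1 = j := by rw [hr, Nat.unpair_pair]
    set k := 2 ^ r ^ 2 * 2 ^ r ^ 2 with hk
    set Q : ℝ := 2 ^ r ^ 2 with hQ
    have hQ1 : 1 ≤ Q := one_le_pow₀ (by norm_num)
    have hhalf : (1 / 2 : ℝ) ^ k ≤ 1 := pow_le_one₀ (by norm_num) (by norm_num)
    have hhalf0 : (0 : ℝ) ≤ (1 / 2) ^ k := by positivity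
    have hval : ∀ i, dyadicInterp (profile i) ((2 ^ (k + 1) : ℕ) : ℝ) = profile i (k + 1) :=
      fun i => by
        push_cast
        exact (isDyadicProfile_profile i).interp_two_pow (k + 1)
    have hsup : (A.sup' hA fun i => dyadicInterp (profile i) ((2 ^ (k + 1) : ℕ) : ℝ)) ≤ 3 * Q := by
      refine Finset.sup'_le _ _ fun i hi => ?_
      have hne : (Nat.unpair r).1 ≠ i := by
        rw [hlab]; rintro rfl; exact hj hi
      have := lineInf_le_of_label hne hr0
      rw [hval, profile_succ]
      linarith
    have hsup0 : 0 < A.sup' hA fun i => dyadicInterp (profile i) ((2 ^ (k + 1) : ℕ) : ℝ) := by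
      obtain ⟨i, hi⟩ := hA
      refine lt_of_lt_of_le ?_ (Finset.le_sup' _ hi)
      rw [hval]
      linarith [(isDyadicProfile_profile i).one_le (k + 1)]
    have hnum : Q * 2 ^ r / 3 ≤ dyadicInterp (profile j) ((2 ^ (k + 1) : ℕ) : ℝ) := by
      have := le_lineInf_of_label hlab hr0
      rw [pow_add] at this
      rw [hval, profile_succ]
      linarith
    have hmem := hB ⟨2 ^ (k + 1), Nat.one_le_two_pow, rfl⟩
    rw [div_le_iff₀ hsup0] at hmem
    have h2r : (2 : ℝ) ^ b ≤ 2 ^ r := pow_le_pow_right₀ (by norm_num) (by omega)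
    have hB0 : 0 ≤ B := by
      by_contra hneg
      have h1 : 0 < Q * 2 ^ r / 3 := by positivity
      have h2 := mul_neg_of_neg_of_pos (not_le.mp hneg) hsup0
      linarith
    have h3 := mul_le_mul_of_nonneg_left hsup hB0
    nlinarith

/-! ### The order on spreading models -/

theorem DominatedBy.trans_seminorm {f g h : Seminorm ℝ (ℕ →₀ ℝ)} (h1 : DominatedBy f g)
    (h2 : DominatedBy g h) : DominatedBy f h := by
  obtain ⟨C, hC⟩ := h1
  obtain ⟨D, hD⟩ := h2
  refine ⟨|C| * D, fun a => (hC a).trans ?_⟩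
  rw [mul_assoc]
  exact (mul_le_mul_of_nonneg_right (le_abs_self C) (apply_nonneg _ _)).trans
    (mul_le_mul_of_nonneg_left (hD a) (abs_nonneg C))

theorem dominatedBy_of_le {f g : Seminorm ℝ (ℕ →₀ ℝ)} (h : f ≤ g) : DominatedBy f g :=
  ⟨1, fun a => by rw [one_mul]; exact h a⟩

/-- It reduces the order isomorphism to a surjective map from spreading models to nodes that
preserves and reflects the preorder. -/
theorem exists_orderIso_antisymmetrization {α β : Type*} [Preorder α] [PartialOrder β] (f : α → β)
    (hf : ∀ a b, f a ≤ f b ↔ a ≤ b) (hs : Function.Surjective f) :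
    ∃ e : Antisymmetrization α (· ≤ ·) ≃o β, ∀ a, e (toAntisymmetrization (· ≤ ·) a) = f a := by
  have hof : ∀ a, f (ofAntisymmetrization (· ≤ ·) (toAntisymmetrization (· ≤ ·) a)) = f a := by
    intro a
    have h := toAntisymmetrization_ofAntisymmetrization (· ≤ ·)
      (toAntisymmetrization (α := α) (· ≤ ·) a)
    apply le_antisymm
    · rw [hf, ← toAntisymmetrization_le_toAntisymmetrization_iff]
      exact h.le
    · rw [hf, ← toAntisymmetrization_le_toAntisymmetrization_iff]
      exact h.ge
  let g : Antisymmetrization α (· ≤ ·) ↪o β :=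
    OrderEmbedding.ofMapLEIff (fun q => f (ofAntisymmetrization (· ≤ ·) q)) fun a b => by
      rw [hf, ofAntisymmetrization_le_ofAntisymmetrization_iff]
  have hg : Function.Surjective g := fun b => by
    obtain ⟨a, rfl⟩ := hs b
    exact ⟨toAntisymmetrization (· ≤ ·) a, hof a⟩
  exact ⟨RelIso.ofSurjective g hg, hof⟩

/-! ### Norms attached to nodes and their comparison -/

section

variable {S : ℕ → ℝ → ℝ} (hS : IsIncomparableFamily S) (n : ℕ) (p : ℝ) [hp : Fact (1 ≤ p)]

theorem IsIncomparableFamily.partialSum_weight (i : ℕ) {m : ℕ} (hm : 1 ≤ m) :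
    (hS.weight i).partialSum m = S i m := by
  obtain ⟨m, rfl⟩ := Nat.exists_eq_add_of_le' hm
  push_cast
  exact sum_weightSeq (S i) m

theorem IsIncomparableFamily.partialSum_mul_le (i j m : ℕ) :
    (hS.weight i).partialSum (j * m) ≤
      (hS.weight i).partialSum j * (hS.weight i).partialSum m := by
  have h0 : (hS.weight i).partialSum 0 = 0 := by simp [LorentzWeight.partialSum]
  rcases Nat.eq_zero_or_pos j with rfl | hj
  · rw [zero_mul, h0, zero_mul]
  rcases Nat.eq_zero_or_pos m with rfl | hm
  · rw [mul_zero, h0, mul_zero]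
  rw [hS.partialSum_weight i hj, hS.partialSum_weight i hm,
    hS.partialSum_weight i (Nat.mul_pos hj hm)]
  push_cast
  exact (hS.submultiplicative i).mul_le j m (by exact_mod_cast hj) (by exact_mod_cast hm)

/-- The Lorentz norms with weights `w 0, …, w (n - 1)`, followed by the `ℓ_p` norm. -/
def indexSeminorm (i : ℕ) : Seminorm ℝ (ℕ →₀ ℝ) :=
  if i < n then lorentzSeminorm (hS.weight i) p else lpSeminorm p

open scoped Classical in
/-- The norm of the spreading model attached to a node. -/
def nodeSeminorm (ν : Set ℕ) : Seminorm ℝ (ℕ →₀ ℝ) :=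
  ((Finset.range (n + 1)).filter fun i => i + 1 ∈ ν).sup (indexSeminorm hS n p)

/-- The case i = n matters: ℓ_p dominates the Lorentz norm of the weight with index `n`, which is
absent from X_n(p). Condition (*) for that index then separates ℓ_p from the maxima, just as the
other indices are separated from one another. -/
theorem lorentzSeminorm_le_indexSeminorm (i : ℕ) :
    lorentzSeminorm (hS.weight i) p ≤ indexSeminorm hS n p i := by
  rw [indexSeminorm]
  split_ifs
  · exact le_rfl
  · exact fun a => lorentzNorm_le_lpNorm a

theorem indexSeminorm_le_lpSeminorm (i : ℕ) : indexSeminorm hS n p i ≤ lpSeminorm p := by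
  rw [indexSeminorm]
  split_ifs
  · exact fun a => lorentzNorm_le_lpNorm a
  · exact le_rfl

variable {n} in
theorem indexSeminorm_le_nodeSeminorm {i : ℕ} {ν : Set ℕ} (hi : i ≤ n) (h : i + 1 ∈ ν) :
    indexSeminorm hS n p i ≤ nodeSeminorm hS n p ν := by
  classical
  exact Finset.le_sup (f := indexSeminorm hS n p)
    (Finset.mem_filter.mpr ⟨Finset.mem_range.mpr (Nat.lt_succ_of_le hi), h⟩)

theorem nodeSeminorm_le {ν : Set ℕ} {q : Seminorm ℝ (ℕ →₀ ℝ)}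
    (h : ∀ i, i ≤ n → i + 1 ∈ ν → indexSeminorm hS n p i ≤ q) : nodeSeminorm hS n p ν ≤ q := by
  classical
  refine Finset.sup_le fun i hi => ?_
  rw [Finset.mem_filter, Finset.mem_range] at hi
  exact h i (Nat.le_of_lt_succ hi.1) hi.2

/-- ℓ_p dominates every Lorentz norm with constant 1, so it absorbs the whole maximum. -/
theorem nodeSeminorm_top : nodeSeminorm hS n p (Set.Icc 1 (n + 1)) = lpSeminorm p := by
  apply le_antisymm
  · exact nodeSeminorm_le hS n p fun i _ _ => indexSeminorm_le_lpSeminorm hS n p i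
  · have h : indexSeminorm hS n p n = lpSeminorm p := by rw [indexSeminorm, if_neg (lt_irrefl n)]
    rw [← h]
    exact indexSeminorm_le_nodeSeminorm hS p le_rfl ⟨by omega, le_rfl⟩

theorem nodeSeminorm_of_finset (A : Finset (Fin n)) :
    nodeSeminorm hS n p {m | ∃ i ∈ A, (i : ℕ) + 1 = m} =
      A.sup fun i => lorentzSeminorm (hS.weight i) p := by
  have hidx : ∀ i : Fin n, indexSeminorm hS n p i = lorentzSeminorm (hS.weight i) p := fun i => by
    rw [indexSeminorm, if_pos i.2]
  apply le_antisymm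
  · refine nodeSeminorm_le hS n p fun m _ hm => ?_
    obtain ⟨i, hi, him⟩ := hm
    obtain rfl : (i : ℕ) = m := Nat.succ_injective him
    rw [hidx]
    exact Finset.le_sup (f := fun i : Fin n => lorentzSeminorm (hS.weight i) p) hi
  · refine Finset.sup_le fun i hi => ?_
    rw [← hidx]
    exact indexSeminorm_le_nodeSeminorm hS p i.2.le ⟨i, hi, rfl⟩

variable {n} in
theorem Nodes.eq_top_or_exists (ν : Nodes n) : (ν : Set ℕ) = Set.Icc 1 (n + 1) ∨
    ∃ A : Finset (Fin n), A.Nonempty ∧ (ν : Set ℕ) = {m | ∃ i ∈ A, (i : ℕ) + 1 = m} := by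
  classical
  rcases ν.2.1 with h | h
  · right
    have hν : (ν : Set ℕ) = {m | ∃ i ∈ Finset.univ.filter (fun i : Fin n => (i : ℕ) + 1 ∈ (ν : Set ℕ)),
        (i : ℕ) + 1 = m} := by
      ext m
      constructor
      · intro hm
        have h1 := h hm
        refine ⟨⟨m - 1, by have := h1.1; have := h1.2; omega⟩, ?_, Nat.sub_add_cancel h1.1⟩
        simpa [Nat.sub_add_cancel h1.1] using hm
      · rintro ⟨i, hi, rfl⟩
        exact (Finset.mem_filter.mp hi).2
    refine ⟨_, ?_, hν⟩
    obtain ⟨m, hm⟩ := Set.nonempty_iff_ne_empty.mpr ν.2.2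
    rw [hν] at hm
    obtain ⟨i, hi, -⟩ := hm
    exact ⟨i, hi⟩
  · exact Or.inl h

variable {n} in
/-- The node with elements `i + 1`, `i ∈ A`. -/
def Nodes.ofFinset {A : Finset (Fin n)} (hA : A.Nonempty) : Nodes n :=
  ⟨{m | ∃ i ∈ A, (i : ℕ) + 1 = m}, by
    refine ⟨Or.inl ?_, ?_⟩
    · rintro m ⟨i, -, rfl⟩
      exact ⟨by omega, i.2⟩
    · obtain ⟨i, hi⟩ := hA
      exact Set.nonempty_iff_ne_empty.mp ⟨i + 1, i, hi, rfl⟩⟩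

/-- The top node. -/
def Nodes.top : Nodes n :=
  ⟨Set.Icc 1 (n + 1), Or.inr rfl, Set.nonempty_iff_ne_empty.mp ⟨1, by simp⟩⟩

/-- Inclusion gives domination at once. For the converse, take an index j + 1 of ν outside μ and
test on indicators of m points: domination with constant C forces S_j(m) ≤ |C|^p times the maximum
of S_i(m) over the indices i of μ, for all m, against (*). -/
theorem nodeSeminorm_dominatedBy_iff (ν μ : Nodes n) :
    DominatedBy (nodeSeminorm hS n p ν) (nodeSeminorm hS n p μ) ↔ ν ≤ μ := by
  have hp0 : 0 < p := by linarith [hp.out]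
  constructor
  · rintro ⟨C, hC⟩ x hx
    have hsub : (ν : Set ℕ) ⊆ Set.Icc 1 (n + 1) := by
      rcases ν.2.1 with h | h
      · exact h.trans (Set.Icc_subset_Icc_right (Nat.le_succ n))
      · exact h.subset
    have hx1 := hsub hx
    obtain ⟨j, rfl⟩ := Nat.exists_eq_add_of_le' hx1.1
    by_contra hj
    rcases μ.eq_top_or_exists with hμ | ⟨A, hA, hμ⟩
    · exact hj (hμ.symm.subset hx1)
    -- Here `j` may equal `n`, the ℓ_p index, while the indices in `A` are all below `n`.
    have hAj : j ∉ A.map Fin.valEmbedding := by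
      intro hm
      obtain ⟨i, hi, rfl⟩ := Finset.mem_map.mp hm
      exact hj (hμ.symm.subset ⟨i, hi, rfl⟩)
    have hA' : (A.map Fin.valEmbedding).Nonempty := hA.map
    refine hS.unbounded _ hA' j hAj ⟨|C| ^ p, ?_⟩
    rintro _ ⟨m, hm, rfl⟩
    set T := (A.map Fin.valEmbedding).sup' hA' fun i => S i m with hT
    have hST : ∀ i ∈ A, S i m ≤ T := fun i hi =>
      Finset.le_sup' (fun i => S i m) (Finset.mem_map_of_mem Fin.valEmbedding hi)
    have hS1 : ∀ i, 1 ≤ S i m := fun i => (hS.submultiplicative i).one_le (by exact_mod_cast hm)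
    have hT0 : 0 < T := by
      obtain ⟨i, hi⟩ := hA
      linarith [hS1 i, hST i hi]
    have hnorm : ∀ i, lorentzNorm (hS.weight i) p (intervalVec 0 m) ^ p = S i m := fun i => by
      rw [lorentzNorm_intervalVec _ hp.out, Nat.sub_zero, hS.partialSum_weight i hm]
    rw [div_le_iff₀ hT0]
    have h1 : lorentzNorm (hS.weight j) p (intervalVec 0 m) ≤
        nodeSeminorm hS n p ν (intervalVec 0 m) :=
      ((lorentzSeminorm_le_indexSeminorm hS n p j).trans
        (indexSeminorm_le_nodeSeminorm hS p (Nat.le_of_succ_le_succ hx1.2) hx)) (intervalVec 0 m)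
    have h2 : nodeSeminorm hS n p μ (intervalVec 0 m) ≤ T ^ (1 / p) := by
      rw [hμ, nodeSeminorm_of_finset]
      refine Seminorm.finset_sup_apply_le (Real.rpow_nonneg hT0.le _) fun i hi => ?_
      rw [lorentzSeminorm_apply]
      refine (Real.rpow_le_rpow_iff (lorentzNorm_nonneg _ _ _) (Real.rpow_nonneg hT0.le _) hp0).mp ?_
      rw [hnorm, one_div, Real.rpow_inv_rpow hT0.le hp0.ne']
      exact hST i hi
    have h3 : lorentzNorm (hS.weight j) p (intervalVec 0 m) ≤ |C| * T ^ (1 / p) :=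
      h1.trans ((hC _).trans ((mul_le_mul_of_nonneg_right (le_abs_self C) (apply_nonneg _ _)).trans
        (mul_le_mul_of_nonneg_left h2 (abs_nonneg C))))
    have h4 := Real.rpow_le_rpow (lorentzNorm_nonneg _ _ _) h3 hp0.le
    rwa [hnorm, Real.mul_rpow (abs_nonneg C) (Real.rpow_nonneg hT0.le _), one_div,
      Real.rpow_inv_rpow hT0.le hp0.ne'] at h4
  · intro h
    exact dominatedBy_of_le (nodeSeminorm_le hS n p fun i hi hiν =>
      indexSeminorm_le_nodeSeminorm hS p hi (h hiν))

theorem exists_node (M : WeaklyNullSpreadingModel (XSpace hS n p)) :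
    ∃ ν : Nodes n, DominatedBy M.norm (nodeSeminorm hS n p ν) ∧
      DominatedBy (nodeSeminorm hS n p ν) M.norm := by
  obtain ⟨x, h1, -, hw, hg⟩ := M.generated
  rcases Generates.classification (W := fun i : Fin n => hS.weight i)
    (fun i => hS.partialSum_mul_le i) hg hw h1 with h | ⟨A, hA, h⟩
  · refine ⟨Nodes.top n, ?_⟩
    change DominatedBy M.norm (nodeSeminorm hS n p (Set.Icc 1 (n + 1))) ∧
      DominatedBy (nodeSeminorm hS n p (Set.Icc 1 (n + 1))) M.norm
    rw [nodeSeminorm_top]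
    exact h
  · refine ⟨Nodes.ofFinset hA, ?_⟩
    change DominatedBy M.norm (nodeSeminorm hS n p {m | ∃ i ∈ A, (i : ℕ) + 1 = m}) ∧
      DominatedBy (nodeSeminorm hS n p {m | ∃ i ∈ A, (i : ℕ) + 1 = m}) M.norm
    rw [nodeSeminorm_of_finset]
    exact h

theorem exists_model (hp1 : 1 < p) (hn : 1 ≤ n) (ν : Nodes n) :
    ∃ M : WeaklyNullSpreadingModel (XSpace hS n p), M.norm = nodeSeminorm hS n p ν := by
  rcases ν.eq_top_or_exists with h | ⟨A, hA, h⟩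
  · rw [h, nodeSeminorm_top]
    exact exists_spreadingModel_lp (W := fun i : Fin n => hS.weight i) hp1 ⟨0, hn⟩
  · rw [h, nodeSeminorm_of_finset]
    exact exists_spreadingModel_sup (W := fun i : Fin n => hS.weight i) hp1 hA

/-- A model and its node norm dominate each other, so comparing models amounts to comparing node
norms, which is inclusion of nodes. Being equivalent to ℓ_p is then the same as having the top node.
-/
theorem exists_orderIso_nodes (hp1 : 1 < p) (hn : 1 ≤ n) :
    ∃ e : SPw (XSpace hS n p) ≃o Nodes n,
      ∀ M : WeaklyNullSpreadingModel (XSpace hS n p),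
        (e (toAntisymmetrization (· ≤ ·) M) : Set ℕ) = Set.Icc 1 (n + 1) ↔
          EquivalentToLp M p := by
  choose f hf1 hf2 using exists_node hS n p
  have hle : ∀ M N, f M ≤ f N ↔ M ≤ N := by
    intro M N
    rw [← nodeSeminorm_dominatedBy_iff hS n p]
    exact ⟨fun h => ((hf1 M).trans_seminorm h).trans_seminorm (hf2 N),
      fun h => ((hf2 M).trans_seminorm h).trans_seminorm (hf1 N)⟩
  have hsurj : Function.Surjective f := by
    intro ν
    obtain ⟨M, hM⟩ := exists_model hS n p hp1 hn ν
    have h1 := hf1 M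
    have h2 := hf2 M
    rw [hM] at h1 h2
    exact ⟨M, le_antisymm ((nodeSeminorm_dominatedBy_iff hS n p _ _).mp h2)
      ((nodeSeminorm_dominatedBy_iff hS n p _ _).mp h1)⟩
  obtain ⟨e, he⟩ := exists_orderIso_antisymmetrization f hle hsurj
  refine ⟨e, fun M => ?_⟩
  rw [he]
  have htop : nodeSeminorm hS n p (Nodes.top n) = lpSeminorm p := nodeSeminorm_top hS n p
  constructor
  · intro h
    have h1 := hf1 M
    have h2 := hf2 M
    rw [h, nodeSeminorm_top] at h1 h2
    exact ⟨h1, h2⟩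
  · rintro ⟨h1, h2⟩
    have : f M = Nodes.top n := by
      apply le_antisymm
      · rw [← nodeSeminorm_dominatedBy_iff hS n p, htop]
        exact (hf2 M).trans_seminorm (h := lpSeminorm p) h1
      · rw [← nodeSeminorm_dominatedBy_iff hS n p, htop]
        exact DominatedBy.trans_seminorm (f := lpSeminorm p) h2 (hf1 M)
    rw [this]
    rfl

end

end SpreadingModels

end

theorem theorem2p10 :
    (∃ S : ℕ → ℝ → ℝ, SpreadingModels.IsIncomparableFamily S) ∧
    ∀ (S : ℕ → ℝ → ℝ) (hS : SpreadingModels.IsIncomparableFamily S)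
      (p : ℝ) [Fact (1 ≤ p)], 1 < p → ∀ n : ℕ, 1 ≤ n →
      ∃ e : SpreadingModels.SPw (SpreadingModels.XSpace hS n p) ≃o SpreadingModels.Nodes n,
        ∀ M : SpreadingModels.WeaklyNullSpreadingModel (SpreadingModels.XSpace hS n p),
          (e (toAntisymmetrization (· ≤ ·) M) : Set ℕ) = Set.Icc 1 (n + 1) ↔
            SpreadingModels.EquivalentToLp M p :=
  ⟨⟨_, SpreadingModels.isIncomparableFamily_profile⟩, fun _ hS p _ hp1 n hn =>
    SpreadingModels.exists_orderIso_nodes hS n p hp1 hn⟩
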